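/- A planar straight-line drawing of a graph places its vertices at distinct points of the plane and draws every edge as the straight segment between its end vertices, so that no edge passes through a vertex other than its ends and two different edges meet only in common end vertices. The segments of such a drawing are the maximal sets of edges that form a path of the graph drawn as a single line segment. Every tree with $n \ge 3$ vertices has a planar straight-line drawing with all vertices on the $n \times n$ grid $\{0,\dots,n-1\}^2$ that uses at most $3n/4 - 1$ segments, and such a drawing can be computed in $O(n)$ time: there is one program for a random access machine (unit cost for arithmetic operations, comparisons and memory accesses, words of $O(\log n)$ bits) that, for every tree with $n \ge 3$ vertices given by a list of its edges, computes the coordinates of the vertices of such a drawing in at most $cn$ steps, where $c$ is an absolute constant. -/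

import Mathlib

namespace SegmentDrawing

/-! ### Planar straight-line drawings and their segments -/

/-- `pos` places the vertices of `G` so that drawing every edge as the straight segment between its
end vertices gives a planar drawing: distinct vertices have distinct positions, no edge passes
through a vertex that is not one of its ends, and two different edges meet only in common ends. -/
structure IsPlanarStraightLineDrawing {V : Type*} (G : SimpleGraph V) (pos : V → ℝ × ℝ) :
    Prop where
  injective : Function.Injective pos
  vertex_edge : ∀ u v w : V, G.Adj u v → pos w ∈ segment ℝ (pos u) (pos v) → w = u ∨ w = v
  edge_edge : ∀ u v u' v' : V, G.Adj u v → G.Adj u' v' → s(u, v) ≠ s(u', v') →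
    ∀ p : ℝ × ℝ, p ∈ segment ℝ (pos u) (pos v) → p ∈ segment ℝ (pos u') (pos v') →
      ∃ w : V, w ∈ s(u, v) ∧ w ∈ s(u', v') ∧ p = pos w

/-- Two edges with a common end whose ends all lie on one line. In a planar straight-line drawing
two different such edges continue each other across their common end. -/
def Aligned {V : Type*} (G : SimpleGraph V) (pos : V → ℝ × ℝ) (e f : G.edgeSet) : Prop :=
  (∃ v : V, v ∈ e.1 ∧ v ∈ f.1) ∧ Collinear ℝ (pos '' {v : V | v ∈ e.1 ∨ v ∈ f.1})

/-- The segments of a drawing: the classes of edges under the equivalence relation generated by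
`Aligned`. The edges of a class form a path of `G` that is drawn as one line segment, and a class
is maximal with this property; collinear segments that do not touch are different. -/
def Segments {V : Type*} (G : SimpleGraph V) (pos : V → ℝ × ℝ) : Type _ :=
  Quot (Aligned G pos)

/-- The number of segments of a drawing. -/
noncomputable def segmentCount {V : Type*} (G : SimpleGraph V) (pos : V → ℝ × ℝ) : ℕ :=
  Nat.card (Segments G pos)

/-! ### Random access machine

Programs are structured programs over finitely many word variables and finitely many arrays of
words with random access. Every arithmetic operation, comparison, memory access and
control step costs one unit of time, and all words that occur must be smaller than a bound `W`
(the execution is undefined otherwise). -/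

/-- The unit-time operations on words; subtraction is truncated at `0`, and comparisons return
`1` for true and `0` for false. -/
inductive BinOp : Type
  | add | sub | mul | lt | eq

def BinOp.eval : BinOp → ℕ → ℕ → ℕ
  | .add, a, b => a + b
  | .sub, a, b => a - b
  | .mul, a, b => a * b
  | .lt, a, b => if a < b then 1 else 0
  | .eq, a, b => if a = b then 1 else 0

/-- The memory: the word in each variable and in each cell of each array. -/
structure State : Type where
  var : ℕ → ℕ
  arr : ℕ → ℕ → ℕ

/-- Expressions: constants, variables, array cells, operations. -/
inductive Expr : Type
  | lit (c : ℕ)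
  | var (x : ℕ)
  | get (a : ℕ) (i : Expr)
  | bin (op : BinOp) (e₁ e₂ : Expr)

/-- The value of an expression. -/
def Expr.eval (s : State) : Expr → ℕ
  | .lit c => c
  | .var x => s.var x
  | .get a i => s.arr a (i.eval s)
  | .bin op e₁ e₂ => op.eval (e₁.eval s) (e₂.eval s)

/-- All values that occur in the evaluation of an expression are smaller than `W`. -/
def Expr.Fits (W : ℕ) (s : State) : Expr → Prop
  | .lit c => c < W
  | .var x => s.var x < W
  | .get a i => i.Fits W s ∧ s.arr a (i.eval s) < W
  | .bin op e₁ e₂ => e₁.Fits W s ∧ e₂.Fits W s ∧ op.eval (e₁.eval s) (e₂.eval s) < W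

/-- The time to evaluate an expression: one unit per constant, access and operation. -/
def Expr.cost : Expr → ℕ
  | .lit _ => 1
  | .var _ => 1
  | .get _ i => i.cost + 1
  | .bin _ e₁ e₂ => e₁.cost + e₂.cost + 1

/-- Programs. In `cond` and `loop` a non-zero value of the expression means true. -/
inductive Program : Type
  | nop
  | assign (x : ℕ) (e : Expr)
  | store (a : ℕ) (i e : Expr)
  | seq (p q : Program)
  | cond (e : Expr) (p q : Program)
  | loop (e : Expr) (p : Program)

/-- Write `v` into the variable `x`. -/
def State.setVar (s : State) (x v : ℕ) : State where
  var := Function.update s.var x v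
  arr := s.arr

/-- Write `v` into cell `i` of the array `a`. -/
def State.setArr (s : State) (a i v : ℕ) : State where
  var := s.var
  arr := Function.update s.arr a (Function.update (s.arr a) i v)

/-- `Exec W p s t s'`: with words smaller than `W`, the program `p` started in the memory `s` halts
after exactly `t` units of time with the memory `s'`. -/
inductive Exec (W : ℕ) : Program → State → ℕ → State → Prop
  | nop (s : State) : Exec W .nop s 1 s
  | assign (x : ℕ) (e : Expr) (s : State) (he : e.Fits W s) :
      Exec W (.assign x e) s (e.cost + 1) (s.setVar x (e.eval s))
  | store (a : ℕ) (i e : Expr) (s : State) (hi : i.Fits W s) (he : e.Fits W s) :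
      Exec W (.store a i e) s (i.cost + e.cost + 1) (s.setArr a (i.eval s) (e.eval s))
  | seq (p q : Program) (s s₁ s₂ : State) (t₁ t₂ : ℕ)
      (hp : Exec W p s t₁ s₁) (hq : Exec W q s₁ t₂ s₂) : Exec W (.seq p q) s (t₁ + t₂) s₂
  | cond_true (e : Expr) (p q : Program) (s s₁ : State) (t : ℕ) (he : e.Fits W s)
      (h : e.eval s ≠ 0) (hp : Exec W p s t s₁) : Exec W (.cond e p q) s (e.cost + 1 + t) s₁
  | cond_false (e : Expr) (p q : Program) (s s₁ : State) (t : ℕ) (he : e.Fits W s)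
      (h : e.eval s = 0) (hq : Exec W q s t s₁) : Exec W (.cond e p q) s (e.cost + 1 + t) s₁
  | loop_true (e : Expr) (p : Program) (s s₁ s₂ : State) (t₁ t₂ : ℕ) (he : e.Fits W s)
      (h : e.eval s ≠ 0) (hp : Exec W p s t₁ s₁) (hl : Exec W (.loop e p) s₁ t₂ s₂) :
      Exec W (.loop e p) s (e.cost + 1 + t₁ + t₂) s₂
  | loop_false (e : Expr) (p : Program) (s : State) (he : e.Fits W s) (h : e.eval s = 0) :
      Exec W (.loop e p) s (e.cost + 1) s

/-! ### Input and output of graph drawing programs -/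

/-- `E` lists every edge of `G` exactly once, in any order and with its ends in any order. -/
def IsEdgeList {n m : ℕ} (G : SimpleGraph (Fin n)) (E : Fin m → Fin n × Fin n) : Prop :=
  Function.Injective (fun j : Fin m => s((E j).1, (E j).2)) ∧
    Set.range (fun j : Fin m => s((E j).1, (E j).2)) = G.edgeSet

/-- The initial memory: the numbers of vertices and edges in the variables `0` and `1`, the first
and second ends of the edges in the arrays `0` and `1`, and `0` everywhere else. -/
def inputState {n m : ℕ} (E : Fin m → Fin n × Fin n) : State where
  var := fun x => if x = 0 then n else if x = 1 then m else 0
  arr := fun a i =>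
    if h : i < m then
      if a = 0 then (E ⟨i, h⟩).1 else if a = 1 then (E ⟨i, h⟩).2 else 0
    else 0

/-- The computed drawing: the coordinates of the vertices are in the arrays `2` and `3`. -/
def outputDrawing (n : ℕ) (s : State) (v : Fin n) : ℝ × ℝ :=
  ((s.arr 2 v : ℝ), (s.arr 3 v : ℝ))

/-- Every graph on `n` labelled vertices has an edge list. -/
theorem exists_isEdgeList {n : ℕ} (G : SimpleGraph (Fin n)) :
    ∃ (m : ℕ) (E : Fin m → Fin n × Fin n), IsEdgeList G E := by
  classical
  obtain ⟨m, ⟨f⟩⟩ := Finite.exists_equiv_fin G.edgeSet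
  refine ⟨m, fun j => Quot.out (f.symm j).1, ?_⟩
  have key : ∀ z : Sym2 (Fin n), s((Quot.out z).1, (Quot.out z).2) = z := fun z => Quot.out_eq z
  refine ⟨?_, ?_⟩
  · intro i j hij
    simp only [key] at hij
    exact f.symm.injective (Subtype.ext hij)
  · ext z
    simp only [key, Set.mem_range]
    constructor
    · rintro ⟨j, rfl⟩
      exact (f.symm j).2
    · intro hz
      exact ⟨f ⟨z, hz⟩, by simp⟩

end SegmentDrawing

/-! Root the tree at `0` and choose at every vertex with children a heavy child, which may be a leaf
only if all children are leaves; the size of its subtree plays no role. The other children are twigs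
(at most one vertex below them) or branches. The vertices outside the twigs form the spine, a
subtree through the root.

A spine vertex `u` reserves an interval of `d u + 1` rows. The subtree of its heavy child takes the
lowest block, the blocks of the branches are stacked above it, and the top `own u + 1` rows hold `u`
with its twigs. The heavy child stays in the column of `u`, while branches move so far to the right
that siblings on the spine are at least three columns apart. Hence spine edges descend weakly to the
right, reserved intervals are nested or disjoint, and the own rows of different spine vertices are
disjoint. The twigs at `u` form a fan with the directions `(-1, -i)` and `(1, i)`, and also `(0, 1)`
if `u` is not a heavy child; the second edge of a twig is horizontal unless the twig is vertical.
Planarity then rests on three facts: the arms of a fan meet only at its centre (`arm_inj`), an arm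
meets an incident spine edge only at the centre (`arm_inter_spine_edge`), and everything else is
separated by a row or a column (`rows_disjoint`, `edge_separated`).

For the segments, say that an edge continues another one if it prolongs a heavy chain, if it points
straight up above the first edge of a heavy chain, or if it is the second of two opposite arms.
Every segment contains an edge that does not continue, so it suffices that at least `n / 4` of the
`n - 1` edges continue. This follows from a potential: essentially `d v + 1` at the top of a heavy
chain and `d v + 2` at the later inner vertices. At each vertex it is at most the sum of the
potentials of the children plus four times the number of continuing edges to them (`potential_le`).
Summed over the tree this telescopes to the potential of the root, which is `n`.

Linear time comes from peeling leaves. Each vertex stores its remaining degree and the sum of its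
remaining neighbours; once a single neighbour is left, the sum is that neighbour. This yields
parents, subtree sizes, heavy children and an order with children first. A pass in numerical order
computes the ranks of twigs and the offsets of branches, and a pass in the reverse peeling order
solves the equations `EqAt`. Geometry and program meet only in the predicate `IsLayout`. All stored
words are at most `n ^ 4`, and every intermediate value is at most a fixed power of that. -/

namespace SegmentDrawing

/-! ### Running loop-free programs -/

/-- All words in the memory are at most `M`. -/
def Small (M : ℕ) (s : State) : Prop :=
  (∀ x, s.var x ≤ M) ∧ ∀ a i, s.arr a i ≤ M

/-- An exponent `r` such that the value of the expression is at most `M ^ r` in a memory with words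
at most `M`. -/
def Expr.rank : Expr → ℕ
  | .lit c => c + 1
  | .var _ => 1
  | .get _ i => i.rank + 1
  | .bin _ e₁ e₂ => e₁.rank + e₂.rank + 1

/-- The extra `1` in the exponent supplies a factor `2`, which absorbs a sum of two terms; products
and comparisons need less. -/
theorem BinOp.eval_le {M r₁ r₂ a b : ℕ} (hM : 2 ≤ M) (op : BinOp) (ha : a ≤ M ^ r₁)
    (hb : b ≤ M ^ r₂) : op.eval a b ≤ M ^ (r₁ + r₂ + 1) := by
  have h1 : 1 ≤ M ^ r₁ := Nat.one_le_pow _ _ (by omega)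
  have h2 : 1 ≤ M ^ r₂ := Nat.one_le_pow _ _ (by omega)
  have h3 : M ^ r₁ ≤ M ^ r₁ * M ^ r₂ := Nat.le_mul_of_pos_right _ h2
  have h4 : M ^ r₂ ≤ M ^ r₁ * M ^ r₂ := Nat.le_mul_of_pos_left _ h1
  have h5 : M ^ r₁ * M ^ r₂ * 2 ≤ M ^ (r₁ + r₂ + 1) := by
    rw [pow_succ, pow_add]
    exact Nat.mul_le_mul_left _ hM
  have h6 : a * b ≤ M ^ r₁ * M ^ r₂ := Nat.mul_le_mul ha hb
  cases op <;> simp only [BinOp.eval] <;> (try split_ifs) <;> omega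

theorem Expr.eval_le {M : ℕ} (hM : 2 ≤ M) {s : State} (hs : Small M s) :
    ∀ e : Expr, e.eval s ≤ M ^ e.rank
  -- Only `2 ≤ M` is known, so a constant `c` is dominated through `c < 2 ^ (c + 1)`.
  | .lit c => by
      have : c + 1 < 2 ^ (c + 1) := Nat.lt_two_pow_self
      have h2 : 2 ^ (c + 1) ≤ M ^ (c + 1) := Nat.pow_le_pow_left hM _
      simp only [Expr.eval, Expr.rank]
      omega
  | .var x => by simpa [Expr.eval, Expr.rank] using hs.1 x
  | .get a i => by
      have h := hs.2 a (i.eval s)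
      have h2 : M ^ 1 ≤ M ^ (i.rank + 1) := Nat.pow_le_pow_right (by omega) (by omega)
      simp only [Expr.eval, Expr.rank]
      rw [pow_one] at h2
      omega
  | .bin op e₁ e₂ => BinOp.eval_le hM op (Expr.eval_le hM hs e₁) (Expr.eval_le hM hs e₂)

theorem Expr.fits_of_small {M W : ℕ} (hM : 2 ≤ M) {s : State} (hs : Small M s) :
    ∀ e : Expr, M ^ e.rank < W → e.Fits W s
  | .lit c, h => (Expr.eval_le hM hs (.lit c)).trans_lt h
  | .var x, h => (Expr.eval_le hM hs (.var x)).trans_lt h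
  | .get a i, h =>
      ⟨Expr.fits_of_small hM hs i ((Nat.pow_le_pow_right (by omega) (by simp [Expr.rank])).trans_lt h),
        (Expr.eval_le hM hs (.get a i)).trans_lt h⟩
  | .bin op e₁ e₂, h =>
      ⟨Expr.fits_of_small hM hs e₁
          ((Nat.pow_le_pow_right (by omega) (by simp only [Expr.rank]; omega)).trans_lt h),
        Expr.fits_of_small hM hs e₂
          ((Nat.pow_le_pow_right (by omega) (by simp only [Expr.rank]; omega)).trans_lt h),
        (Expr.eval_le hM hs (.bin op e₁ e₂)).trans_lt h⟩

/-- An exponent that bounds the values of all expressions of a program. -/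
def Program.rank : Program → ℕ
  | .nop => 0
  | .assign _ e => e.rank
  | .store _ i e => i.rank + e.rank
  | .seq p q => p.rank + q.rank
  | .cond e p q => e.rank + p.rank + q.rank
  | .loop e p => e.rank + p.rank

/-- The memory after a loop-free program. -/
def Program.denote : Program → State → State
  | .nop, s => s
  | .assign x e, s => s.setVar x (e.eval s)
  | .store a i e, s => s.setArr a (i.eval s) (e.eval s)
  | .seq p q, s => q.denote (p.denote s)
  | .cond e p q, s => if e.eval s ≠ 0 then p.denote s else q.denote s
  -- Junk value: `Safe` is false for loops, so it is never used.
  | .loop _ _, s => s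

/-- The program is loop-free and writes only words at most `M`. -/
def Program.Safe (M : ℕ) : Program → State → Prop
  | .nop, _ => True
  | .assign _ e, s => e.eval s ≤ M
  | .store _ _ e, s => e.eval s ≤ M
  | .seq p q, s => p.Safe M s ∧ q.Safe M (p.denote s)
  | .cond e p q, s => if e.eval s ≠ 0 then p.Safe M s else q.Safe M s
  | .loop _ _, _ => False

/-- A bound for the time of a loop-free program. -/
def Program.cost : Program → ℕ
  | .nop => 1
  | .assign _ e => e.cost + 1
  | .store _ i e => i.cost + e.cost + 1
  | .seq p q => p.cost + q.cost
  | .cond e p q => e.cost + 1 + (p.cost + q.cost)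
  | .loop e _ => e.cost + 1

theorem Small.setVar {M : ℕ} {s : State} (hs : Small M s) {x v : ℕ} (hv : v ≤ M) :
    Small M (s.setVar x v) := by
  refine ⟨fun y => ?_, hs.2⟩
  simp only [State.setVar, Function.update_apply]
  split_ifs
  exacts [hv, hs.1 y]

theorem Small.setArr {M : ℕ} {s : State} (hs : Small M s) {a i v : ℕ} (hv : v ≤ M) :
    Small M (s.setArr a i v) := by
  refine ⟨hs.1, fun b j => ?_⟩
  simp only [State.setArr, Function.update_apply]
  split_ifs with h
  · simp only [Function.update_apply]
    split_ifs
    exacts [hv, hs.2 a j]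
  · exact hs.2 b j

/-- From the memory `s` the program `p` halts after at most `T` units of time in a memory with words
at most `M` that satisfies `Q`. -/
def Runs (W M : ℕ) (p : Program) (s : State) (T : ℕ) (Q : State → Prop) : Prop :=
  ∃ t s', Exec W p s t s' ∧ t ≤ T ∧ Small M s' ∧ Q s'

/-- This replaces derivations in `Exec` by evaluation of `denote`. Only the words that are written
have to be bounded by `M`; intermediate values are covered by `rank`. -/
theorem runs_of_safe {W M : ℕ} (hM : 2 ≤ M) :
    ∀ (p : Program) (s : State), Small M s → p.Safe M s → M ^ p.rank < W →
      Runs W M p s p.cost (fun s' => s' = p.denote s)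
  | .nop, s, hs, _, _ => ⟨1, s, .nop s, le_rfl, hs, rfl⟩
  | .assign x e, s, hs, h, hW =>
      ⟨_, _, .assign x e s (e.fits_of_small hM hs hW), le_rfl, hs.setVar h, rfl⟩
  | .store a i e, s, hs, h, hW =>
      ⟨_, _, .store a i e s
        (i.fits_of_small hM hs
          ((Nat.pow_le_pow_right (by omega) (by simp only [Program.rank]; omega)).trans_lt hW))
        (e.fits_of_small hM hs
          ((Nat.pow_le_pow_right (by omega) (by simp only [Program.rank]; omega)).trans_lt hW)),
        le_rfl, hs.setArr h, rfl⟩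
  | .seq p q, s, hs, h, hW => by
      obtain ⟨t₁, s₁, h₁, ht₁, hs₁, rfl⟩ := runs_of_safe hM p s hs h.1
        ((Nat.pow_le_pow_right (by omega) (by simp only [Program.rank]; omega)).trans_lt hW)
      obtain ⟨t₂, s₂, h₂, ht₂, hs₂, rfl⟩ := runs_of_safe hM q _ hs₁ h.2
        ((Nat.pow_le_pow_right (by omega) (by simp only [Program.rank]; omega)).trans_lt hW)
      exact ⟨_, _, .seq p q _ _ _ _ _ h₁ h₂, Nat.add_le_add ht₁ ht₂, hs₂, rfl⟩
  | .cond e p q, s, hs, h, hW => by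
      have he : e.Fits W s := e.fits_of_small hM hs
        ((Nat.pow_le_pow_right (by omega) (by simp only [Program.rank]; omega)).trans_lt hW)
      simp only [Program.Safe] at h
      by_cases h0 : e.eval s = 0
      · rw [if_neg (by simpa using h0)] at h
        obtain ⟨t₂, s₂, h₂, ht₂, hs₂, rfl⟩ := runs_of_safe hM q _ hs h
          ((Nat.pow_le_pow_right (by omega) (by simp only [Program.rank]; omega)).trans_lt hW)
        refine ⟨_, _, .cond_false e p q _ _ _ he h0 h₂, ?_, hs₂, ?_⟩
        · simp only [Program.cost]; omega
        · simp [Program.denote, h0]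
      · rw [if_pos h0] at h
        obtain ⟨t₂, s₂, h₂, ht₂, hs₂, rfl⟩ := runs_of_safe hM p _ hs h
          ((Nat.pow_le_pow_right (by omega) (by simp only [Program.rank]; omega)).trans_lt hW)
        refine ⟨_, _, .cond_true e p q _ _ _ he h0 h₂, ?_, hs₂, ?_⟩
        · simp only [Program.cost]; omega
        · simp [Program.denote, h0]
  | .loop _ _, _, _, h, _ => h.elim

theorem Runs.seq {W M : ℕ} {p q : Program} {s : State} {T₁ T₂ : ℕ} {Q R : State → Prop}
    (hp : Runs W M p s T₁ Q) (hq : ∀ s', Small M s' → Q s' → Runs W M q s' T₂ R) :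
    Runs W M (.seq p q) s (T₁ + T₂) R := by
  obtain ⟨t₁, s₁, h₁, ht₁, hs₁, hQ⟩ := hp
  obtain ⟨t₂, s₂, h₂, ht₂, hs₂, hR⟩ := hq s₁ hs₁ hQ
  exact ⟨_, _, .seq p q _ _ _ _ _ h₁ h₂, Nat.add_le_add ht₁ ht₂, hs₂, hR⟩

/-- A loop with a loop-free body that keeps the invariant `I` and runs exactly `N` times. -/
theorem runs_loop {W M N : ℕ} (hM : 2 ≤ M) {e : Expr} {p : Program} (I : ℕ → State → Prop)
    (hW : M ^ (Program.loop e p).rank < W)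
    (hstep : ∀ i < N, ∀ s, Small M s → I i s →
      e.eval s ≠ 0 ∧ p.Safe M s ∧ I (i + 1) (p.denote s))
    (hend : ∀ s, Small M s → I N s → e.eval s = 0) {s : State} (hs : Small M s) (h0 : I 0 s) :
    Runs W M (.loop e p) s ((N + 1) * (e.cost + 1 + p.cost)) (I N) := by
  have hr : M ^ e.rank < W :=
    (Nat.pow_le_pow_right (by omega) (by simp only [Program.rank]; omega)).trans_lt hW
  have hr' : M ^ p.rank < W :=
    (Nat.pow_le_pow_right (by omega) (by simp only [Program.rank]; omega)).trans_lt hW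
  have key : ∀ j i, i + j = N → ∀ s, Small M s → I i s →
      Runs W M (.loop e p) s ((j + 1) * (e.cost + 1 + p.cost)) (I N) := by
    intro j
    induction j with
    | zero =>
      intro i hi s hs h
      obtain rfl : i = N := by omega
      refine ⟨_, s, .loop_false e p s (e.fits_of_small hM hs hr) (hend s hs h), ?_, hs, h⟩
      omega
    | succ j ih =>
      intro i hi s hs h
      obtain ⟨he, hsafe, hI⟩ := hstep i (by omega) s hs h
      obtain ⟨t₁, s₁, h₁, ht₁, hs₁, rfl⟩ := runs_of_safe hM p s hs hsafe hr'
      obtain ⟨t₂, s₂, h₂, ht₂, hs₂, hR⟩ := ih (i + 1) (by omega) _ hs₁ hI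
      refine ⟨_, s₂, .loop_true e p s _ _ _ _ (e.fits_of_small hM hs hr) he h₁ h₂, ?_, hs₂, hR⟩
      have : (j + 1 + 1) * (e.cost + 1 + p.cost)
          = (j + 1) * (e.cost + 1 + p.cost) + (e.cost + 1 + p.cost) := by ring
      omega
  exact key N 0 (by omega) s hs h0

end SegmentDrawing

namespace SegmentDrawing

/-! ### Rooting a tree -/

theorem exists_adj_dist_lt {V : Type*} {G : SimpleGraph V} (hG : G.Connected) (r v : V)
    (hv : v ≠ r) : ∃ w, G.Adj v w ∧ G.dist w r < G.dist v r := by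
  obtain ⟨p, hp⟩ := hG.exists_walk_length_eq_dist v r
  cases p with
  | nil => exact (hv rfl).elim
  | cons h q =>
    refine ⟨_, h, ?_⟩
    have := SimpleGraph.dist_le q
    simp only [SimpleGraph.Walk.length_cons] at hp
    omega

/-- A tree on `Fin n` can be rooted at `0`: `par` is the parent and `dep` decreases towards the root;
summing over the edges is summing over the vertices other than the root. -/
theorem exists_parent {n : ℕ} (hn : 0 < n) (G : SimpleGraph (Fin n)) (hG : G.IsTree) :
    ∃ par dep : ℕ → ℕ, par 0 = 0 ∧ (∀ v < n, par v < n) ∧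
      (∀ v < n, v ≠ 0 → dep (par v) < dep v) ∧
      (∀ u v : Fin n, G.Adj u v ↔
        ((u : ℕ) ≠ 0 ∧ par u = v) ∨ ((v : ℕ) ≠ 0 ∧ par v = u)) ∧
      ∀ (m : ℕ) (E : Fin m → Fin n × Fin n), IsEdgeList G E → m + 1 = n ∧
        ∀ F : ℕ → ℕ → ℕ, (∀ a b, F a b = F b a) →
          ∑ j : Fin m, F (E j).1 (E j).2 = ∑ u ∈ Finset.range n, if u ≠ 0 then F u (par u) else 0 := by
  classical
  let r : Fin n := ⟨0, hn⟩
  have hex : ∀ v : Fin n, ∃ w : Fin n, (v = r → w = r) ∧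
      (v ≠ r → G.Adj v w ∧ G.dist w r < G.dist v r) := by
    intro v
    by_cases h : v = r
    · exact ⟨r, fun _ => rfl, fun h' => (h' h).elim⟩
    · obtain ⟨w, hw⟩ := exists_adj_dist_lt hG.connected r v h
      exact ⟨w, fun h' => (h h').elim, fun _ => hw⟩
  choose p hp0 hp using hex
  -- Two vertices with the same parent edge would be parents of each other, and the distance to the
  -- root would drop both ways. So `φ` is injective, and since a tree has `n - 1` edges it is
  -- bijective.
  let φ : {v : Fin n // v ≠ r} → G.edgeSet := fun v => ⟨s(v.1, p v.1), (hp v.1 v.2).1⟩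
  have hφi : Function.Injective φ := by
    rintro ⟨v, hv⟩ ⟨w, hw⟩ h
    have h' : s(v, p v) = s(w, p w) := congrArg Subtype.val h
    rcases Sym2.eq_iff.1 h' with h1 | h1
    · exact Subtype.ext h1.1
    · have h2 := (hp v hv).2
      have h3 := (hp w hw).2
      rw [h1.2] at h2
      rw [← h1.1] at h3
      omega
  have hφc : Fintype.card {v : Fin n // v ≠ r} = Fintype.card G.edgeSet := by
    have h1 := hG.card_edgeFinset
    rw [SimpleGraph.edgeFinset_card, Fintype.card_fin] at h1
    rw [Fintype.card_subtype_compl, Fintype.card_fin, Fintype.card_subtype_eq]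
    omega
  have hφ : Function.Bijective φ := (Fintype.bijective_iff_injective_and_card φ).2 ⟨hφi, hφc⟩
  let par : ℕ → ℕ := fun v => if h : v < n then (p ⟨v, h⟩ : ℕ) else 0
  have hpar : ∀ v : Fin n, par v = p v := fun v => by simp [par]
  have hr : ∀ v : Fin n, v ≠ r ↔ (v : ℕ) ≠ 0 := fun v => by simp [r, Fin.ext_iff]
  refine ⟨par, fun v => if h : v < n then G.dist ⟨v, h⟩ r else 0, ?_, ?_, ?_, ?_, ?_⟩
  · have := hpar r
    rw [hp0 r rfl] at this
    exact this
  · intro v hv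
    rw [hpar ⟨v, hv⟩]
    exact (p ⟨v, hv⟩).2
  · intro v hv h0
    have h1 := (hp ⟨v, hv⟩ ((hr _).2 h0)).2
    rw [hpar ⟨v, hv⟩]
    simpa [hv] using h1
  · intro u v
    constructor
    · intro h
      obtain ⟨⟨w, hw⟩, hwe⟩ := hφ.2 ⟨s(u, v), h⟩
      have h' : s(w, p w) = s(u, v) := congrArg Subtype.val hwe
      rcases Sym2.eq_iff.1 h' with h1 | h1
      · left
        rw [hpar, ← h1.1, h1.2]
        exact ⟨(hr w).1 hw, rfl⟩
      · right
        rw [hpar, ← h1.1, h1.2]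
        exact ⟨(hr w).1 hw, rfl⟩
    · rintro (⟨h0, h⟩ | ⟨h0, h⟩)
      · rw [hpar] at h
        have := (hp u ((hr u).2 h0)).1
        rwa [Fin.ext h] at this
      · rw [hpar] at h
        have := (hp v ((hr v).2 h0)).1
        rw [Fin.ext h] at this
        exact this.symm
  · intro m E hE
    have hmem : ∀ j, s((E j).1, (E j).2) ∈ G.edgeSet := fun j => by
      rw [← hE.2]
      exact ⟨j, rfl⟩
    let ψ : Fin m → G.edgeSet := fun j => ⟨s((E j).1, (E j).2), hmem j⟩
    have hψ : Function.Bijective ψ := by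
      constructor
      · intro i j h
        exact hE.1 (congrArg Subtype.val h)
      · rintro ⟨e, he⟩
        rw [← hE.2] at he
        obtain ⟨j, rfl⟩ := he
        exact ⟨j, rfl⟩
    constructor
    · have h1 := hG.card_edgeFinset
      rw [SimpleGraph.edgeFinset_card, Fintype.card_fin, ← Fintype.card_of_bijective hψ,
        Fintype.card_fin] at h1
      exact h1
    · intro F hF
      let f : Sym2 (Fin n) → ℕ := Sym2.lift ⟨fun a b => F a b, fun a b => hF a b⟩
      have h1 : ∑ j : Fin m, F (E j).1 (E j).2 = ∑ e : G.edgeSet, f e.1 :=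
        hψ.sum_comp (fun e : G.edgeSet => f e.1)
      have h2 : ∑ v : {v : Fin n // v ≠ r}, F v.1 (p v.1) = ∑ e : G.edgeSet, f e.1 :=
        hφ.sum_comp (fun e : G.edgeSet => f e.1)
      rw [h1, ← h2, Finset.sum_range]
      have h3 : ∀ v : Fin n, (if (v : ℕ) ≠ 0 then F v (par v) else 0)
          = if v ≠ r then F v (p v) else 0 := fun v => by
        rw [hpar]
        exact if_congr (hr v).symm rfl rfl
      rw [Finset.sum_congr rfl fun v _ => h3 v, ← Finset.sum_filter]
      exact (Finset.sum_subtype (Finset.univ.filter fun v => v ≠ r) (p := fun v => v ≠ r)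
        (fun v => by simp) fun v => F v (p v)).symm

end SegmentDrawing

namespace SegmentDrawing

/-! ### Rooted trees with heavy children -/

/-- A tree on the numbers below `n` with root `0`: the parents, a function that decreases towards the
root, the numbers of proper descendants, and for every vertex with children a heavy child, which is a
leaf only if all children are. -/
structure HeavyTree : Type where
  n : ℕ
  par : ℕ → ℕ
  dep : ℕ → ℕ
  d : ℕ → ℕ
  hv : ℕ → ℕ
  three_le : 3 ≤ n
  par_zero : par 0 = 0
  par_lt : ∀ v < n, par v < n
  dep_par : ∀ v < n, v ≠ 0 → dep (par v) < dep v
  d_eq : ∀ v < n, d v = ∑ c ∈ Finset.range n, if c ≠ 0 ∧ par c = v then d c + 1 else 0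
  hv_spec : ∀ v < n, d v ≠ 0 → hv v ≠ 0 ∧ hv v < n ∧ par (hv v) = v ∧
    (d (hv v) = 0 → ∀ c < n, c ≠ 0 → par c = v → d c = 0)

/-- Each vertex other than the root has exactly one parent. This turns local relations between a
vertex and its children into global ones. -/
theorem sum_by_parent {n : ℕ} {par : ℕ → ℕ} (hpar : ∀ v < n, par v < n) (f : ℕ → ℕ) :
    ∑ v ∈ Finset.range n, ∑ c ∈ Finset.range n, (if c ≠ 0 ∧ par c = v then f c else 0)
      = ∑ c ∈ Finset.range n, if c ≠ 0 then f c else 0 := by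
  rw [Finset.sum_comm]
  refine Finset.sum_congr rfl fun c hc => ?_
  by_cases h : c = 0
  · simp [h]
  · simp [h, hpar c (Finset.mem_range.1 hc)]

theorem sum_ne_zero_add {n : ℕ} (hn : 0 < n) (f : ℕ → ℕ) :
    (∑ c ∈ Finset.range n, if c ≠ 0 then f c else 0) + f 0 = ∑ c ∈ Finset.range n, f c := by
  obtain ⟨k, rfl⟩ : ∃ k, n = k + 1 := ⟨n - 1, by omega⟩
  rw [Finset.sum_range_succ', Finset.sum_range_succ']
  simp

namespace HeavyTree

variable (T : HeavyTree)

/-- A light child that is a leaf or has a single leaf below it. -/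
def Twig (u : ℕ) : Prop := u ≠ 0 ∧ T.hv (T.par u) ≠ u ∧ T.d u < 2

/-- A light child with at least two proper descendants. -/
def Branch (u : ℕ) : Prop := u ≠ 0 ∧ T.hv (T.par u) ≠ u ∧ 2 ≤ T.d u

/-- A vertex that is neither a twig nor the leaf of a twig. -/
def Spine (u : ℕ) : Prop := ¬ T.Twig u ∧ ¬ (u ≠ 0 ∧ T.Twig (T.par u))

instance : DecidablePred T.Twig := fun _ => inferInstanceAs (Decidable (_ ∧ _))
instance : DecidablePred T.Branch := fun _ => inferInstanceAs (Decidable (_ ∧ _))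
instance : DecidablePred T.Spine := fun _ => inferInstanceAs (Decidable (_ ∧ _))

/-- The number of twigs at `v`. -/
def twigs (v : ℕ) : ℕ := ∑ c ∈ Finset.range T.n, if T.Twig c ∧ T.par c = v then 1 else 0

/-- The number of vertices in twigs at `v`. -/
def own (v : ℕ) : ℕ := ∑ c ∈ Finset.range T.n, if T.Twig c ∧ T.par c = v then T.d c + 1 else 0

/-- The number of vertices in branches at `v`. -/
def branchSum (v : ℕ) : ℕ :=
  ∑ c ∈ Finset.range T.n, if T.Branch c ∧ T.par c = v then T.d c + 1 else 0

/-- The number of smaller twigs at the same vertex. -/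
def rank (u : ℕ) : ℕ := ∑ c ∈ Finset.range u, if T.Twig c ∧ T.par c = T.par u then 1 else 0

/-- The number of vertices in smaller branches at the same vertex. -/
def off (u : ℕ) : ℕ :=
  ∑ c ∈ Finset.range u, if T.Branch c ∧ T.par c = T.par u then T.d c + 1 else 0

/-- The position of a twig in the fan of its parent; position `0` (straight up) is used only at the
vertices that are not heavy children. -/
def slot (u : ℕ) : ℕ := T.rank u + if T.hv (T.par (T.par u)) = T.par u then 1 else 0

/-! ### Subtree sizes, ranks and offsets, and closure properties of the spine -/

variable {T}

/-- Summing the recursion for `d` over all vertices, every `d c` with `c ≠ 0` appears on both sides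
and cancels. -/
theorem d_root : T.d 0 + 1 = T.n := by
  have h1 : ∑ v ∈ Finset.range T.n, T.d v
      = ∑ c ∈ Finset.range T.n, if c ≠ 0 then T.d c + 1 else 0 := by
    rw [← sum_by_parent T.par_lt]
    exact Finset.sum_congr rfl fun v hv => T.d_eq v (Finset.mem_range.1 hv)
  have h2 := sum_ne_zero_add (n := T.n) (by have := T.three_le; omega) (fun c => T.d c + 1)
  rw [← h1, Finset.sum_add_distrib] at h2
  simp at h2
  omega

theorem d_child {c : ℕ} (hc : c < T.n) (h0 : c ≠ 0) : T.d c + 1 ≤ T.d (T.par c) := by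
  rw [T.d_eq (T.par c) (T.par_lt c hc)]
  have := Finset.single_le_sum
    (f := fun c' => if c' ≠ 0 ∧ T.par c' = T.par c then T.d c' + 1 else 0)
    (fun _ _ => Nat.zero_le _) (Finset.mem_range.2 hc)
  simpa [h0] using this

/-- The children of `v` are the heavy child, the twigs and the branches. This identity is the
division of the reserved rows. -/
theorem d_split {v : ℕ} (hv : v < T.n) (h0 : T.d v ≠ 0) :
    T.d v = T.d (T.hv v) + 1 + T.own v + T.branchSum v := by
  obtain ⟨h1, h2, h3, -⟩ := T.hv_spec v hv h0
  have h4 : ∑ c ∈ Finset.range T.n, (if c = T.hv v then T.d c + 1 else 0) = T.d (T.hv v) + 1 := by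
    simp [h2]
  rw [← h4, own, branchSum, ← Finset.sum_add_distrib, ← Finset.sum_add_distrib, T.d_eq v hv]
  refine Finset.sum_congr rfl fun c _ => ?_
  by_cases hc0 : c = 0
  · subst hc0
    simp [Twig, Branch, h1.symm]
  by_cases hcp : T.par c = v
  · subst hcp
    by_cases hch : c = T.hv (T.par c)
    · rw [if_pos ⟨hc0, rfl⟩, if_pos hch, if_neg (fun h => h.1.2.1 hch.symm),
        if_neg (fun h => h.1.2.1 hch.symm)]
    · have hch' : T.hv (T.par c) ≠ c := fun h => hch h.symm
      by_cases hd : T.d c < 2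
      · rw [if_pos ⟨hc0, rfl⟩, if_neg hch, if_pos ⟨⟨hc0, hch', hd⟩, rfl⟩,
          if_neg (fun h => by have := h.1.2.2; omega)]
        omega
      · rw [if_pos ⟨hc0, rfl⟩, if_neg hch, if_neg (fun h => hd h.1.2.2),
          if_pos ⟨⟨hc0, hch', by omega⟩, rfl⟩]
        omega
  · have hch : c ≠ T.hv v := fun h => hcp (h ▸ h3)
    simp [hcp, hch]

theorem own_eq_zero {v : ℕ} (hv : v < T.n) (h0 : T.d v = 0) : T.own v = 0 := by
  refine Finset.sum_eq_zero fun c hc => if_neg ?_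
  rintro ⟨h, rfl⟩
  have := d_child (Finset.mem_range.1 hc) h.1
  omega

theorem own_le {v : ℕ} (hv : v < T.n) : T.own v ≤ T.d v := by
  by_cases h0 : T.d v = 0
  · rw [own_eq_zero hv h0]
    omega
  · have := d_split hv h0
    omega

theorem twigs_le_own (v : ℕ) : T.twigs v ≤ T.own v := by
  refine Finset.sum_le_sum fun c _ => ?_
  split_ifs <;> omega

theorem own_le_two_mul (v : ℕ) : T.own v ≤ 2 * T.twigs v := by
  rw [twigs, Finset.mul_sum]
  refine Finset.sum_le_sum fun c _ => ?_
  split_ifs with h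
  · have := h.1.2.2
    omega
  · omega

theorem own_eq_twigs {v : ℕ} (hv : v < T.n) (h0 : T.d v ≠ 0) (h : T.d (T.hv v) = 0) :
    T.own v = T.twigs v := by
  refine Finset.sum_congr rfl fun c hc => ?_
  split_ifs with h1
  · rw [(T.hv_spec v hv h0).2.2.2 h c (Finset.mem_range.1 hc) h1.1.1 h1.2]
  · rfl

/-- A twig with two vertices adds a row beyond the count of twigs; `leaf_bounds` uses it for the
leaf above a vertical twig. -/
theorem twigs_add_le_own {u : ℕ} (hu : u < T.n) (h : T.Twig u) :
    T.twigs (T.par u) + T.d u ≤ T.own (T.par u) := by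
  have h4 : ∑ c ∈ Finset.range T.n, (if c = u then T.d c else 0) = T.d u := by
    simp [hu]
  conv_lhs => rw [← h4]
  rw [twigs, own, ← Finset.sum_add_distrib]
  refine Finset.sum_le_sum fun c _ => ?_
  by_cases hc : c = u
  · subst hc
    simp [h]
    omega
  · simp only [hc, if_false, add_zero]
    split_ifs <;> omega

theorem rank_lt {u : ℕ} (hu : u < T.n) (h : T.Twig u) : T.rank u < T.twigs (T.par u) := by
  have h1 : ∑ c ∈ Finset.range (u + 1), (if T.Twig c ∧ T.par c = T.par u then 1 else 0)
      ≤ T.twigs (T.par u) :=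
    Finset.sum_le_sum_of_subset (Finset.range_subset_range.2 hu)
  rw [Finset.sum_range_succ, if_pos ⟨h, rfl⟩] at h1
  exact h1

theorem rank_lt_rank {u v : ℕ} (huv : u < v) (h : T.Twig u) (hp : T.par u = T.par v) :
    T.rank u < T.rank v := by
  have h1 : ∑ c ∈ Finset.range (u + 1), (if T.Twig c ∧ T.par c = T.par u then 1 else 0)
      ≤ T.rank v := by
    rw [rank, hp]
    exact Finset.sum_le_sum_of_subset (Finset.range_subset_range.2 huv)
  rw [Finset.sum_range_succ, if_pos ⟨h, rfl⟩] at h1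
  exact h1

theorem rank_inj {u v : ℕ} (hu : T.Twig u) (hv : T.Twig v) (hp : T.par u = T.par v)
    (h : T.rank u = T.rank v) : u = v := by
  rcases lt_trichotomy u v with h1 | h1 | h1
  · have := rank_lt_rank h1 hu hp
    omega
  · exact h1
  · have := rank_lt_rank h1 hv hp.symm
    omega

theorem off_add_le {u : ℕ} (hu : u < T.n) (h : T.Branch u) :
    T.off u + T.d u + 1 ≤ T.branchSum (T.par u) := by
  have h1 : ∑ c ∈ Finset.range (u + 1), (if T.Branch c ∧ T.par c = T.par u then T.d c + 1 else 0)
      ≤ T.branchSum (T.par u) :=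
    Finset.sum_le_sum_of_subset (Finset.range_subset_range.2 hu)
  rw [Finset.sum_range_succ, if_pos ⟨h, rfl⟩] at h1
  exact h1

/-- Offsets are prefix sums, so the blocks of the branches at one vertex are consecutive and
disjoint. -/
theorem off_add_le_off {u v : ℕ} (huv : u < v) (h : T.Branch u) (hp : T.par u = T.par v) :
    T.off u + T.d u + 1 ≤ T.off v := by
  have h1 : ∑ c ∈ Finset.range (u + 1), (if T.Branch c ∧ T.par c = T.par u then T.d c + 1 else 0)
      ≤ T.off v := by
    rw [off, hp]
    exact Finset.sum_le_sum_of_subset (Finset.range_subset_range.2 huv)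
  rw [Finset.sum_range_succ, if_pos ⟨h, rfl⟩] at h1
  exact h1

/-- A twig has at most one proper descendant. If `u` were not the heavy child, it and the heavy
child would already be two. -/
theorem Twig.leaf {u : ℕ} (hu : u < T.n) (h0 : u ≠ 0) (h : T.Twig (T.par u)) :
    T.d u = 0 ∧ T.d (T.par u) = 1 ∧ T.hv (T.par u) = u := by
  have h1 := d_child hu h0
  have h2 := h.2.2
  refine ⟨by omega, by omega, ?_⟩
  by_contra hne
  have hp := T.par_lt u hu
  have h3 := d_split hp (by omega)
  have h4 : 1 ≤ T.twigs (T.par u) := by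
    have := rank_lt hu ⟨h0, hne, by omega⟩
    omega
  have h5 := T.twigs_le_own (T.par u)
  omega

theorem Twig.not_leaf {u : ℕ} (hu : u < T.n) (h : T.Twig u) :
    ¬ (u ≠ 0 ∧ T.Twig (T.par u)) := fun h' => h.2.1 (Twig.leaf hu h'.1 h'.2).2.2

theorem Twig.par_ne_leaf {u : ℕ} (hu : u < T.n) (h0 : u ≠ 0) :
    ¬ (T.par u ≠ 0 ∧ T.Twig (T.par (T.par u))) := fun h' => by
  have h1 := (Twig.leaf (T.par_lt u hu) h'.1 h'.2).1
  have h2 := d_child hu h0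
  omega

theorem Twig.spine_par {u : ℕ} (hu : u < T.n) (h : T.Twig u) : T.Spine (T.par u) :=
  ⟨fun h' => h.not_leaf hu ⟨h.1, h'⟩, Twig.par_ne_leaf hu h.1⟩

/-- The spine is closed towards the root, which permits induction along it. -/
theorem Spine.par {u : ℕ} (hu : u < T.n) (h0 : u ≠ 0) (h : T.Spine u) : T.Spine (T.par u) :=
  ⟨fun h' => h.2 ⟨h0, h'⟩, Twig.par_ne_leaf hu h0⟩

theorem Spine.cases {u : ℕ} (h0 : u ≠ 0) (h : T.Spine u) : T.hv (T.par u) = u ∨ T.Branch u := by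
  by_cases h1 : T.hv (T.par u) = u
  · exact Or.inl h1
  · refine Or.inr ⟨h0, h1, ?_⟩
    by_contra h2
    exact h.1 ⟨h0, h1, by omega⟩

theorem Branch.spine {u : ℕ} (hu : u < T.n) (h : T.Branch u) : T.Spine u := by
  refine ⟨fun h' => ?_, fun h' => ?_⟩
  · have h1 := h.2.2
    have h2 := h'.2.2
    omega
  · exact h.2.1 (Twig.leaf hu h'.1 h'.2).2.2

theorem Spine.hv {v : ℕ} (hv : v < T.n) (h0 : T.d v ≠ 0) (h : T.Spine v) : T.Spine (T.hv v) := by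
  obtain ⟨h1, h2, h3, -⟩ := T.hv_spec v hv h0
  refine ⟨fun h' => h'.2.1 (by rw [h3]), fun h' => h.1 ?_⟩
  have := h'.2
  rwa [h3] at this

theorem spine_zero : T.Spine 0 := ⟨fun h => h.1 rfl, fun h => h.1 rfl⟩

end HeavyTree

end SegmentDrawing

namespace SegmentDrawing

namespace HeavyTree

/-! ### The layout -/

/-- The equations for the coordinates `x`, `y` of `u` and for the lowest row `l` of the rows reserved
for the descendants of a vertex `u` of the spine, in terms of the values `X`, `Y`, `lo` above `u`. -/
structure EqAt (T : HeavyTree) (lo X Y : ℕ → ℕ) (u l x y : ℕ) : Prop where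
  root : u = 0 → l = 0 ∧ x = 2
  -- The own rows begin at `l + d u - own u`; the arms of odd slot go down by at most `twigs u / 2`
  -- rows below the vertex.
  spine : T.Spine u → y = l + T.d u - T.own u + T.twigs u / 2
  heavy : u ≠ 0 → T.Spine u → T.hv (T.par u) = u → l = lo (T.par u) ∧ x = X (T.par u)
  branch : T.Branch u → l = lo (T.par u) + T.d (T.hv (T.par u)) + 1 + T.off u ∧
    x = X (T.par u) + T.d (T.hv (T.par u)) + T.off u + 2
  twig_zero : T.Twig u → T.slot u = 0 → x = X (T.par u) ∧ y = Y (T.par u) + 1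
  twig_odd : T.Twig u → T.slot u % 2 = 1 →
    x = X (T.par u) - 1 ∧ y = Y (T.par u) - T.slot u / 2
  twig_even : T.Twig u → T.slot u ≠ 0 → T.slot u % 2 = 0 →
    x = X (T.par u) + 1 ∧ y = Y (T.par u) + T.slot u / 2 - 1
  -- The column is reflected but the row is kept except for a vertical twig: going on straight would
  -- double the height of the fan.
  leaf : u ≠ 0 → T.Twig (T.par u) → x = 2 * X (T.par u) - X (T.par (T.par u)) ∧
    y = Y (T.par u) + if X (T.par u) = X (T.par (T.par u)) then 1 else 0

/-- The equations of the layout hold at all vertices. -/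
def IsLayout (T : HeavyTree) (lo X Y : ℕ → ℕ) : Prop := ∀ u < T.n, T.EqAt lo X Y u (lo u) (X u) (Y u)

/-- `c` is a child of `a` on the spine. -/
def SpineChild (T : HeavyTree) (a c : ℕ) : Prop := c < T.n ∧ c ≠ 0 ∧ T.par c = a ∧ T.Spine c

/-- `u` is a descendant of `a` on the spine. -/
def Desc (T : HeavyTree) : ℕ → ℕ → Prop := Relation.ReflTransGen T.SpineChild

variable {T : HeavyTree} {lo X Y : ℕ → ℕ}

/-! ### Rows and columns of the spine and of the fans -/

theorem SpineChild.left {a c : ℕ} (h : T.SpineChild a c) : a < T.n ∧ T.Spine a := by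
  obtain ⟨h1, h2, rfl, h4⟩ := h
  exact ⟨T.par_lt c h1, h4.par h1 h2⟩

theorem desc_zero {u : ℕ} (hu : u < T.n) (h : T.Spine u) : T.Desc 0 u := by
  induction hk : T.dep u using Nat.strong_induction_on generalizing u with
  | _ k ih =>
    by_cases h0 : u = 0
    · subst h0
      exact .refl
    · exact (ih _ (hk ▸ T.dep_par u hu h0) (T.par_lt u hu) (h.par hu h0) rfl).tail
        ⟨hu, h0, rfl, h⟩

namespace IsLayout

/-- By `d_split`, the blocks of the heavy child and of the branches fit below the top `own a + 1`
rows of `a`. -/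
theorem child_bounds (hL : T.IsLayout lo X Y) {a c : ℕ} (h : T.SpineChild a c) :
    lo a ≤ lo c ∧ lo c + T.d c + T.own a + 1 ≤ lo a + T.d a ∧ X a ≤ X c := by
  have ha := h.left
  obtain ⟨h1, h2, rfl, h4⟩ := h
  have hd := d_child h1 h2
  have hs := d_split ha.1 (by omega)
  rcases h4.cases h2 with hc | hc
  · have := (hL c h1).heavy h2 h4 hc
    rw [hc] at hs
    omega
  · have := (hL c h1).branch hc
    have := off_add_le h1 hc
    omega

theorem desc_bounds (hL : T.IsLayout lo X Y) {a u : ℕ} (h : T.Desc a u) :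
    lo a ≤ lo u ∧ lo u + T.d u ≤ lo a + T.d a ∧ X a ≤ X u := by
  induction h with
  | refl => exact ⟨le_rfl, le_rfl, le_rfl⟩
  | tail _ h2 ih =>
    have := hL.child_bounds h2
    omega

theorem siblings_of_branch (hL : T.IsLayout lo X Y) {a b c : ℕ} (hb : T.SpineChild a b)
    (hc : T.SpineChild a c) (hne : b ≠ c) (hcB : T.Branch c) :
    (lo b + T.d b < lo c ∧ X b + 3 ≤ X c) ∨ (lo c + T.d c < lo b ∧ X c + 3 ≤ X b) := by
  have ha := hb.left
  obtain ⟨hb1, hb2, rfl, hb4⟩ := hb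
  obtain ⟨hc1, hc2, hc3, hc4⟩ := hc
  have h1 := (hL c hc1).branch hcB
  have hd := d_child hb1 hb2
  have hh := T.hv_spec _ ha.1 (by omega)
  rw [hc3] at h1
  rcases hb4.cases hb2 with hbH | hbB
  · have h2 := (hL b hb1).heavy hb2 hb4 hbH
    -- A branch is a child with descendants, so the heavy child is not a leaf. This raises the shift
    -- `d + 2` of a branch to at least three columns.
    have h3 : T.d (T.hv (T.par b)) ≠ 0 := fun h => by
      have := hh.2.2.2 h c hc1 hc2 hc3
      have := hcB.2.2
      omega
    rw [hbH] at h1 h3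
    omega
  · have h2 := (hL b hb1).branch hbB
    have := hbB.2.2
    have := hcB.2.2
    rcases lt_or_gt_of_ne hne with h | h
    · have := off_add_le_off h hbB hc3.symm
      omega
    · have := off_add_le_off h hcB hc3
      omega

/-- Of two siblings on the spine one lies above and to the right of the other. -/
theorem siblings (hL : T.IsLayout lo X Y) {a b c : ℕ} (hb : T.SpineChild a b)
    (hc : T.SpineChild a c) (hne : b ≠ c) :
    (lo b + T.d b < lo c ∧ X b + 3 ≤ X c) ∨ (lo c + T.d c < lo b ∧ X c + 3 ≤ X b) := by
  rcases hc.2.2.2.cases hc.2.1 with hcH | hcB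
  · rcases hb.2.2.2.cases hb.2.1 with hbH | hbB
    · rw [hb.2.2.1] at hbH
      rw [hc.2.2.1] at hcH
      exact (hne (hbH.symm.trans hcH)).elim
    · exact (hL.siblings_of_branch hc hb hne.symm hbB).symm
  · exact hL.siblings_of_branch hb hc hne hcB

/-- Induction from the root to `u`. The only step that can leave the path to `a` compares `u` with
its sibling on this path, and siblings have disjoint blocks. -/
theorem laminar (hL : T.IsLayout lo X Y) (a : ℕ) (ha : a < T.n) (hsa : T.Spine a) {u : ℕ}
    (hu : u < T.n) (h : T.Spine u) :
    T.Desc a u ∨ T.Desc u a ∨ lo a + T.d a < lo u ∨ lo u + T.d u < lo a := by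
  induction hk : T.dep u using Nat.strong_induction_on generalizing u with
  | _ k ih =>
    by_cases h0 : u = 0
    · subst h0
      exact Or.inr (Or.inl (desc_zero ha hsa))
    · have hc : T.SpineChild (T.par u) u := ⟨hu, h0, rfl, h⟩
      have hb := hL.child_bounds hc
      rcases ih _ (hk ▸ T.dep_par u hu h0) (T.par_lt u hu) (h.par hu h0) rfl with h1 | h1 | h1
      · exact Or.inl (h1.tail hc)
      · rcases h1.cases_head with h2 | ⟨c, h2, h3⟩
        · exact Or.inl (h2 ▸ Relation.ReflTransGen.single hc)
        · by_cases hcu : c = u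
          · exact Or.inr (Or.inl (hcu ▸ h3))
          · have h4 := hL.desc_bounds h3
            have h5 := hL.siblings h2 hc hcu
            omega
      · omega

/-- The vertical coordinate lies in the own rows of the vertex. -/
theorem row_bounds (hL : T.IsLayout lo X Y) {u : ℕ} (hu : u < T.n) (h : T.Spine u) :
    Y u + T.own u = lo u + T.d u + T.twigs u / 2 := by
  have := (hL u hu).spine h
  have := own_le hu
  omega

/-- The own rows of different vertices of the spine are disjoint. -/
theorem rows_disjoint (hL : T.IsLayout lo X Y) {u v : ℕ} (hu : u < T.n) (hsu : T.Spine u)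
    (hv : v < T.n) (hsv : T.Spine v) (hne : u ≠ v) :
    lo u + T.d u + T.own v < lo v + T.d v ∨ lo v + T.d v + T.own u < lo u + T.d u := by
  have h1 := own_le hu
  have h2 := own_le hv
  rcases hL.laminar u hu hsu hv hsv with h | h | h
  · rcases h.cases_head with h3 | ⟨c, h3, h4⟩
    · exact (hne h3).elim
    · have := hL.child_bounds h3
      have := hL.desc_bounds h4
      omega
  · rcases h.cases_head with h3 | ⟨c, h3, h4⟩
    · exact (hne h3.symm).elim
    · have := hL.child_bounds h3
      have := hL.desc_bounds h4
      omega
  · omega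

/-- The own rows of a vertex of the spine lie above or below a spine edge of other vertices, or the
vertex lies to the right of the edge. -/
theorem edge_separated (hL : T.IsLayout lo X Y) {a b u : ℕ} (hab : T.SpineChild a b)
    (hu : u < T.n) (hsu : T.Spine u) (hua : u ≠ a) (hub : u ≠ b) :
    Y a + T.own u < lo u + T.d u ∨ lo u + T.d u < Y b ∨ X b + 3 ≤ X u := by
  have ha := hab.left
  have h1 := own_le hu
  have h2 := own_le ha.1
  have h3 := hL.row_bounds ha.1 ha.2
  have h4 := hL.row_bounds hab.1 hab.2.2.2
  have h5 := own_le hab.1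
  have h6 := T.twigs_le_own a
  have hb := hL.child_bounds hab
  rcases hL.laminar a ha.1 ha.2 hu hsu with h | h | h
  · rcases h.cases_head with h7 | ⟨c, h7, h8⟩
    · exact (hua h7.symm).elim
    · have h9 := hL.desc_bounds h8
      -- Descendants of `b` lie below the own rows of `b`. Those of another child `c` lie below the
      -- block of `b`, or to its right if `c` is the upper sibling.
      by_cases hcb : c = b
      · subst hcb
        rcases h8.cases_head with h10 | ⟨c', h10, h11⟩
        · exact (hub h10.symm).elim
        · have := hL.child_bounds h10
          have := hL.desc_bounds h11
          omega
      · have := hL.siblings hab h7 (Ne.symm hcb)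
        omega
  · rcases h.cases_head with h7 | ⟨c, h7, h8⟩
    · exact (hua h7).elim
    · have := hL.child_bounds h7
      have := hL.desc_bounds h8
      omega
  · omega

/-- The sum `X u + d u` never increases down the spine: the two extra columns of a branch are paid
for by the branch vertex and its heavy sibling. For a branch, `2 ≤ d u` then gives `X u < n`. -/
theorem spine_bounds (hL : T.IsLayout lo X Y) {u : ℕ} (hu : u < T.n) (h : T.Spine u) :
    2 ≤ X u ∧ X u + T.d u + 1 ≤ T.n + 2 ∧ X u + 1 ≤ T.n ∧ lo u + T.d u < T.n := by
  have hn := T.three_le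
  have hr := T.d_root
  have h0 := (hL 0 (by omega)).root rfl
  have hd := desc_zero hu h
  have hb := hL.desc_bounds hd
  suffices X u + T.d u + 1 ≤ T.n + 2 ∧ X u + 1 ≤ T.n by omega
  clear hb
  induction hd with
  | refl => omega
  | @tail a c h1 h2 ih =>
    have ha := h2.left
    have ih := ih ha.1 ha.2
    obtain ⟨h3, h4, rfl, h5⟩ := h2
    have hd := d_child h3 h4
    have hs := d_split ha.1 (by omega)
    rcases h5.cases h4 with hc | hc
    · have := (hL c h3).heavy h4 h5 hc
      omega
    · have := (hL c h3).branch hc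
      have := off_add_le h3 hc
      have := hc.2.2
      omega

/-- The position of a twig relative to its parent. -/
theorem twig_position (hL : T.IsLayout lo X Y) {u : ℕ} (hu : u < T.n) (h : T.Twig u) :
    (T.slot u = 0 ∧ X u = X (T.par u) ∧ Y u = Y (T.par u) + 1) ∨
    (T.slot u % 2 = 1 ∧ X u + 1 = X (T.par u) ∧ Y u + T.slot u / 2 = Y (T.par u)) ∨
    (T.slot u ≠ 0 ∧ T.slot u % 2 = 0 ∧ X u = X (T.par u) + 1 ∧
      Y u = Y (T.par u) + (T.slot u / 2 - 1)) := by
  have hp := T.par_lt u hu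
  have hs := h.spine_par hu
  have h1 := hL.spine_bounds hp hs
  have h2 := hL.row_bounds hp hs
  have h3 := rank_lt hu h
  have h4 := own_le hp
  have h5 : T.slot u ≤ T.rank u + 1 := by
    rw [slot]
    split_ifs <;> omega
  by_cases hz : T.slot u = 0
  · have := (hL u hu).twig_zero h hz
    omega
  · by_cases ho : T.slot u % 2 = 1
    · have := (hL u hu).twig_odd h ho
      omega
    · have := (hL u hu).twig_even h hz (by omega)
      omega

theorem slot_le {u : ℕ} (hu : u < T.n) (h : T.Twig u) : T.slot u ≤ T.twigs (T.par u) := by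
  have h3 := rank_lt hu h
  rw [slot]
  split_ifs <;> omega

/-- A slot is at most the number of twigs, so about half of them go down and half go up, within the
`own + 1` rows. An arm to the right has slot at least `2`, and the two twigs leave a column free. -/
theorem twig_bounds (hL : T.IsLayout lo X Y) {u : ℕ} (hu : u < T.n) (h : T.Twig u) :
    lo (T.par u) + T.d (T.par u) ≤ Y u + T.own (T.par u) ∧
      Y u ≤ lo (T.par u) + T.d (T.par u) ∧ X (T.par u) ≤ X u + 2 ∧ X u < T.n := by
  have hp := T.par_lt u hu
  have hs := h.spine_par hu
  have h1 := hL.spine_bounds hp hs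
  have h2 := hL.row_bounds hp hs
  have h3 := rank_lt hu h
  have h4 := own_le hp
  have h5 := slot_le hu h
  have h6 := T.twigs_le_own (T.par u)
  have h7 := d_split hp (by have := d_child hu h.1; omega)
  have h8 := hL.twig_position hu h
  omega

/-- The position of the leaf of a twig relative to the twig and its parent. -/
theorem leaf_position (hL : T.IsLayout lo X Y) {u : ℕ} (hu : u < T.n) (h0 : u ≠ 0)
    (h : T.Twig (T.par u)) :
    (T.slot (T.par u) = 0 ∧ X u = X (T.par (T.par u)) ∧ Y u = Y (T.par (T.par u)) + 2) ∨
    (T.slot (T.par u) % 2 = 1 ∧ X u + 2 = X (T.par (T.par u)) ∧ Y u = Y (T.par u)) ∨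
    (T.slot (T.par u) ≠ 0 ∧ T.slot (T.par u) % 2 = 0 ∧ X u = X (T.par (T.par u)) + 2 ∧
      Y u = Y (T.par u)) := by
  have hp := T.par_lt u hu
  have h1 := hL.twig_position hp h
  have h2 := (hL u hu).leaf h0 h
  have h3 := hL.spine_bounds (T.par_lt _ hp) (h.spine_par hp)
  split_ifs at h2 <;> omega

theorem leaf_bounds (hL : T.IsLayout lo X Y) {u : ℕ} (hu : u < T.n) (h0 : u ≠ 0)
    (h : T.Twig (T.par u)) :
    lo (T.par (T.par u)) + T.d (T.par (T.par u)) ≤ Y u + T.own (T.par (T.par u)) ∧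
      Y u ≤ lo (T.par (T.par u)) + T.d (T.par (T.par u)) ∧
      X (T.par (T.par u)) ≤ X u + 2 ∧ X u < T.n := by
  have hp := T.par_lt u hu
  have hpp := T.par_lt _ hp
  have h1 := hL.twig_bounds hp h
  have h2 := hL.leaf_position hu h0 h
  have h3 := hL.spine_bounds hpp (h.spine_par hp)
  have h4 := hL.row_bounds hpp (h.spine_par hp)
  have h5 := twigs_add_le_own hp h
  have h6 := (h.leaf hu h0).2.1
  have h7 := slot_le hp h
  have h8 := rank_lt hp h
  have h9 : T.d (T.par (T.par u)) ≠ 0 := by have := d_child hp h.1; omega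
  have h10 := d_split hpp h9
  -- The twig has a leaf below it, so it is a child with descendants and the heavy child cannot be a
  -- leaf.
  have h11 : T.d (T.hv (T.par (T.par u))) ≠ 0 := fun h' => by
    have := (T.hv_spec _ hpp h9).2.2.2 h' _ hp h.1 rfl
    omega
  omega

end IsLayout

end HeavyTree

end SegmentDrawing

namespace SegmentDrawing

/-! ### Planarity of the layout -/

/-- The point at which the layout places `u`. -/
def point (X Y : ℕ → ℕ) (u : ℕ) : ℝ × ℝ := ((X u : ℝ), (Y u : ℝ))

/-- The arms of a fan: twigs lie at parameter `1` and their leaves at parameter `2`. -/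
noncomputable def arm (s : ℕ) (t : ℝ) : ℝ × ℝ :=
  if s = 0 then (0, t)
  else if s % 2 = 1 then (-t, -((s / 2 : ℕ) : ℝ) * min t 1)
  else (t, ((s / 2 - 1 : ℕ) : ℝ) * min t 1)

theorem arm_zero (s : ℕ) : arm s 0 = 0 := by
  unfold arm
  split_ifs <;> simp

theorem smul_arm_one (s : ℕ) {a : ℝ} (h1 : a ≤ 1) : a • arm s 1 = arm s a := by
  unfold arm
  split_ifs <;> simp [min_eq_left h1, mul_comm]

/-- An arm is piecewise linear with its only possible bend at parameter `1`, so the second edge of a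
twig covers the parameters from `1` to `2`. -/
theorem combo_arm (s : ℕ) {a b : ℝ} (ha : 0 ≤ a) (h : a + b = 1) :
    a • arm s 2 + b • arm s 1 = arm s (1 + a) := by
  have h1 : min (1 + a) 1 = 1 := min_eq_right (by linarith)
  obtain rfl : b = 1 - a := by linarith
  unfold arm
  split_ifs <;> simp [h1] <;> (try constructor) <;> ring

theorem arm_cases (s : ℕ) {t : ℝ} (ht : 0 ≤ t) :
    (s = 0 ∧ (arm s t).1 = 0 ∧ (arm s t).2 = t) ∨ (s ≠ 0 ∧ (arm s t).1 = -t ∧ (arm s t).2 ≤ 0) ∨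
      (s ≠ 0 ∧ (arm s t).1 = t ∧ 0 ≤ (arm s t).2) := by
  unfold arm
  split_ifs with h1 h2
  · exact Or.inl ⟨h1, rfl, rfl⟩
  · refine Or.inr (Or.inl ⟨h1, rfl, ?_⟩)
    have : 0 ≤ ((s / 2 : ℕ) : ℝ) * min t 1 := by positivity
    simp only [neg_mul]
    linarith
  · exact Or.inr (Or.inr ⟨h1, rfl, by positivity⟩)

/-- Away from the centre, the sign of the first coordinate tells slot `0`, odd and even slots apart;
inside a class the second coordinate determines the slot. -/
theorem arm_inj {s s' : ℕ} {t t' : ℝ} (ht : 0 ≤ t) (ht' : 0 ≤ t') (h : arm s t = arm s' t') :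
    (t = 0 ∧ t' = 0) ∨ (s = s' ∧ t = t') := by
  by_cases hz : t = 0 ∧ t' = 0
  · exact Or.inl hz
  refine Or.inr ?_
  have hz' : ¬ (t = 0 ∧ t' = 0) := hz
  unfold arm at h
  split_ifs at h with h1 h2 h3 h4 h5 h6 h7 h8 <;> rw [Prod.mk.injEq] at h <;> obtain ⟨hx, hy⟩ := h
  · exact ⟨by omega, hy⟩
  · have : t' = 0 := by linarith
    subst this
    simp at hy
    exact (hz' ⟨hy, rfl⟩).elim
  · have : t' = 0 := by linarith
    subst this
    simp at hy
    exact (hz' ⟨hy, rfl⟩).elim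
  · have : t = 0 := by linarith
    subst this
    simp at hy
    exact (hz' ⟨rfl, hy.symm⟩).elim
  -- On one side of the fan the parameter is the horizontal distance; cancelling `min t 1` then
  -- recovers `s / 2`, and the parity is known.
  · obtain rfl : t = t' := by linarith
    have hm : min t 1 ≠ 0 := by
      have : 0 < t := lt_of_le_of_ne ht fun h => hz' ⟨h.symm, h.symm⟩
      exact (lt_min this one_pos).ne'
    have := mul_right_cancel₀ hm hy
    have h10 : s / 2 = s' / 2 := by exact_mod_cast neg_injective this
    exact ⟨by omega, rfl⟩
  · exact (hz' ⟨by linarith, by linarith⟩).elim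
  · have : t = 0 := by linarith
    subst this
    simp at hy
    exact (hz' ⟨rfl, hy.symm⟩).elim
  · exact (hz' ⟨by linarith, by linarith⟩).elim
  · obtain rfl : t = t' := by linarith
    have hm : min t 1 ≠ 0 := by
      have : 0 < t := lt_of_le_of_ne ht fun h => hz' ⟨h.symm, h.symm⟩
      exact (lt_min this one_pos).ne'
    have := mul_right_cancel₀ hm hy
    have h10 : s / 2 - 1 = s' / 2 - 1 := by exact_mod_cast this
    exact ⟨by omega, rfl⟩

/-- A point on a segment that descends weakly to the right. -/
theorem mem_segment_facts {A B p : ℝ × ℝ} (h1 : A.1 ≤ B.1) (h2 : B.2 < A.2)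
    (hp : p ∈ segment ℝ B A) :
    A.1 ≤ p.1 ∧ p.1 ≤ B.1 ∧ B.2 ≤ p.2 ∧ p.2 ≤ A.2 ∧ (p.2 = A.2 → p = A) ∧ (p.2 = B.2 → p = B) ∧
      (A.1 < B.1 → p.1 = A.1 → p = A) ∧ (A.1 < B.1 → p.1 = B.1 → p = B) := by
  obtain ⟨a, b, ha, hb, hab, rfl⟩ := hp
  obtain rfl : b = 1 - a := by linarith
  obtain ⟨x, y⟩ := A
  obtain ⟨x', y'⟩ := B
  simp only [Prod.smul_mk, smul_eq_mul, Prod.mk_add_mk, Prod.mk.injEq] at *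
  have e1 : 0 ≤ a * (x' - x) := mul_nonneg ha (by linarith)
  have e2 : 0 ≤ (1 - a) * (x' - x) := mul_nonneg hb (by linarith)
  have e3 : 0 ≤ a * (y - y') := mul_nonneg ha (by linarith)
  have e4 : 0 ≤ (1 - a) * (y - y') := mul_nonneg hb (by linarith)
  have z : a = 0 → a * x' + (1 - a) * x = x ∧ a * y' + (1 - a) * y = y := by
    rintro rfl
    constructor <;> ring
  have o : a = 1 → a * x' + (1 - a) * x = x' ∧ a * y' + (1 - a) * y = y' := by
    rintro rfl
    constructor <;> ring
  refine ⟨by linarith, by linarith, by linarith, by linarith, fun h => z ?_, fun h => o ?_,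
    fun h3 h => z ?_, fun h3 h => o ?_⟩
  · have : a * (y - y') = 0 := by linarith
    exact (mul_eq_zero.1 this).resolve_right (by linarith)
  · have : (1 - a) * (y - y') = 0 := by linarith
    have := (mul_eq_zero.1 this).resolve_right (by linarith)
    linarith
  · have : a * (x' - x) = 0 := by linarith
    exact (mul_eq_zero.1 this).resolve_right (by linarith)
  · have : (1 - a) * (x' - x) = 0 := by linarith
    have := (mul_eq_zero.1 this).resolve_right (by linarith)
    linarith

/-- Two descending segments from `A`, one of which ends to the right and above the other, meet only
in `A`. -/
theorem eq_of_mem_segments {A B C p : ℝ × ℝ} (h1 : A.1 ≤ B.1) (h2 : B.1 < C.1) (h3 : B.2 < C.2)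
    (h4 : C.2 < A.2) (hB : p ∈ segment ℝ B A) (hC : p ∈ segment ℝ C A) : p = A := by
  obtain ⟨a, b, ha, hb, hab, rfl⟩ := hB
  obtain ⟨a', b', ha', hb', hab', h⟩ := hC
  obtain rfl : b = 1 - a := by linarith
  obtain rfl : b' = 1 - a' := by linarith
  obtain ⟨x, y⟩ := A
  obtain ⟨x', y'⟩ := B
  obtain ⟨x'', y''⟩ := C
  simp only [Prod.smul_mk, smul_eq_mul, Prod.mk_add_mk, Prod.mk.injEq] at *
  have e1 : a' * (x'' - x) = a * (x' - x) := by linarith [h.1]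
  have e2 : a' * (y - y'') = a * (y - y') := by linarith [h.2]
  -- Eliminating `a'` leaves `a` times the cross product of the two directions, which `e4` and `e5`
  -- show to be negative.
  have e3 : a * ((x' - x) * (y - y'') - (x'' - x) * (y - y')) = 0 := by
    linear_combination (x'' - x) * e2 - (y - y'') * e1
  have e4 : (x' - x) * (y - y'') ≤ (x'' - x) * (y - y'') :=
    mul_le_mul_of_nonneg_right (by linarith) (by linarith)
  have e5 : (x'' - x) * (y - y'') < (x'' - x) * (y - y') :=
    mul_lt_mul_of_pos_left (by linarith) (by linarith)
  have : a = 0 := (mul_eq_zero.1 e3).resolve_right (by linarith)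
  subst this
  constructor <;> ring

namespace HeavyTree

/-! ### Intersections of spine edges and arms -/

variable {T : HeavyTree} {lo X Y : ℕ → ℕ}

namespace IsLayout

theorem point_twig (hL : T.IsLayout lo X Y) {u : ℕ} (hu : u < T.n) (h : T.Twig u) :
    point X Y u = point X Y (T.par u) + arm (T.slot u) 1 := by
  rcases hL.twig_position hu h with ⟨h1, h2, h3⟩ | ⟨h1, h2, h3⟩ | ⟨h1, h2, h3, h4⟩
  · simp [point, arm, h1, h2, h3]
  · have h0 : T.slot u ≠ 0 := by omega
    simp [point, arm, h0, h1, ← h2, ← h3, -Nat.cast_div]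
  · simp [point, arm, h1, h2, h3, h4, -Nat.cast_div]

theorem point_leaf (hL : T.IsLayout lo X Y) {u : ℕ} (hu : u < T.n) (h0 : u ≠ 0)
    (h : T.Twig (T.par u)) :
    point X Y u = point X Y (T.par (T.par u)) + arm (T.slot (T.par u)) 2 := by
  have hp := hL.twig_position (T.par_lt u hu) h
  rcases hL.leaf_position hu h0 h with ⟨h1, h2, h3⟩ | ⟨h1, h2, h3⟩ | ⟨h1, h2, h3, h4⟩
  · simp [point, arm, h1, h2, h3]
  · have h0 : T.slot (T.par u) ≠ 0 := by omega
    have h5 : Y (T.par u) + T.slot (T.par u) / 2 = Y (T.par (T.par u)) := by omega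
    simp [point, arm, h0, h1, ← h2, ← h5, h3, -Nat.cast_div]
  · have h5 : Y (T.par u) = Y (T.par (T.par u)) + (T.slot (T.par u) / 2 - 1) := by omega
    simp [point, arm, h1, h2, h3, h4, h5, -Nat.cast_div]

/-- The edges of the drawing outside the spine run along an arm at a vertex of the spine, inside the
own rows of this vertex. -/
theorem arm_edge (hL : T.IsLayout lo X Y) {u : ℕ} (hu : u < T.n) (h0 : u ≠ 0) (h : ¬ T.Spine u) :
    ∃ (c : ℕ) (t₀ : ℝ), c < T.n ∧ T.Twig c ∧ ((u = c ∧ t₀ = 0) ∨ (T.par u = c ∧ t₀ = 1)) ∧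
      ∀ p ∈ segment ℝ (point X Y u) (point X Y (T.par u)),
        (∃ t, t₀ ≤ t ∧ t ≤ t₀ + 1 ∧ p = point X Y (T.par c) + arm (T.slot c) t) ∧
        (lo (T.par c) + T.d (T.par c) : ℝ) ≤ p.2 + T.own (T.par c) ∧
        p.2 ≤ lo (T.par c) + T.d (T.par c) ∧ (X (T.par c) : ℝ) ≤ p.1 + 2 := by
  -- Convexity carries bounds from the ends to the whole edge; upper bounds use negated coordinates.
  have mid : ∀ (a b x y z : ℝ), 0 ≤ a → 0 ≤ b → a + b = 1 → z ≤ x → z ≤ y → z ≤ a * x + b * y := by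
    intro a b x y z ha hb hab hx hy
    obtain rfl : b = 1 - a := by linarith
    nlinarith
  by_cases ht : T.Twig u
  · refine ⟨u, 0, hu, ht, Or.inl ⟨rfl, rfl⟩, ?_⟩
    rintro p ⟨a, b, ha, hb, hab, rfl⟩
    have hs := ht.spine_par hu
    have hp := T.par_lt u hu
    have b1 := hL.twig_bounds hu ht
    have b2 := hL.row_bounds hp hs
    have b3 := T.twigs_le_own (T.par u)
    have b4 := own_le hp
    refine ⟨⟨a, ha, by linarith, ?_⟩, ?_, ?_, ?_⟩
    · rw [hL.point_twig hu ht, smul_add, smul_arm_one _ (by linarith), add_right_comm, ← add_smul,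
        hab, one_smul]
    · have e1 : (lo (T.par u) + T.d (T.par u) : ℝ) ≤ Y u + T.own (T.par u) := by
        exact_mod_cast b1.1
      have e2 : (lo (T.par u) + T.d (T.par u) : ℝ) ≤ Y (T.par u) + T.own (T.par u) := by
        norm_cast
        omega
      have := mid a b (Y u) (Y (T.par u)) (lo (T.par u) + T.d (T.par u) - T.own (T.par u)) ha hb hab
        (by linarith) (by linarith)
      simp only [point, Prod.smul_mk, smul_eq_mul, Prod.mk_add_mk]
      linarith
    · have e1 : (Y u : ℝ) ≤ lo (T.par u) + T.d (T.par u) := by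
        exact_mod_cast b1.2.1
      have e2 : (Y (T.par u) : ℝ) ≤ lo (T.par u) + T.d (T.par u) := by
        norm_cast
        omega
      have := mid a b (-Y u) (-Y (T.par u)) (-(lo (T.par u) + T.d (T.par u))) ha hb hab
        (by linarith) (by linarith)
      simp only [point, Prod.smul_mk, smul_eq_mul, Prod.mk_add_mk]
      linarith
    · have e1 : (X (T.par u) : ℝ) ≤ X u + 2 := by exact_mod_cast b1.2.2.1
      have := mid a b (X u) (X (T.par u)) (X (T.par u) - 2) ha hb hab (by linarith) (by linarith)
      simp only [point, Prod.smul_mk, smul_eq_mul, Prod.mk_add_mk]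
      linarith
  · have hc : T.Twig (T.par u) := by
      by_contra hc
      exact h ⟨ht, fun h' => hc h'.2⟩
    have hp := T.par_lt u hu
    refine ⟨T.par u, 1, hp, hc, Or.inr ⟨rfl, rfl⟩, ?_⟩
    rintro p ⟨a, b, ha, hb, hab, rfl⟩
    have b1 := hL.twig_bounds hp hc
    have b2 := hL.leaf_bounds hu h0 hc
    set v := T.par (T.par u)
    refine ⟨⟨1 + a, by linarith, by linarith, ?_⟩, ?_, ?_, ?_⟩
    · rw [hL.point_leaf hu h0 hc, hL.point_twig hp hc, smul_add, smul_add, add_add_add_comm,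
        combo_arm _ ha hab, ← add_smul, hab, one_smul]
    · have e1 : (lo v + T.d v : ℝ) ≤ Y u + T.own v := by exact_mod_cast b2.1
      have e2 : (lo v + T.d v : ℝ) ≤ Y (T.par u) + T.own v := by exact_mod_cast b1.1
      have := mid a b (Y u) (Y (T.par u)) (lo v + T.d v - T.own v) ha hb hab
        (by linarith) (by linarith)
      simp only [point, Prod.smul_mk, smul_eq_mul, Prod.mk_add_mk]
      linarith
    · have e1 : (Y u : ℝ) ≤ lo v + T.d v := by exact_mod_cast b2.2.1
      have e2 : (Y (T.par u) : ℝ) ≤ lo v + T.d v := by exact_mod_cast b1.2.1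
      have := mid a b (-Y u) (-Y (T.par u)) (-(lo v + T.d v)) ha hb hab
        (by linarith) (by linarith)
      simp only [point, Prod.smul_mk, smul_eq_mul, Prod.mk_add_mk]
      linarith
    · have e1 : (X v : ℝ) ≤ X u + 2 := by exact_mod_cast b2.2.2.1
      have e2 : (X v : ℝ) ≤ X (T.par u) + 2 := by exact_mod_cast b1.2.2.1
      have := mid a b (X u) (X (T.par u)) (X v - 2) ha hb hab (by linarith) (by linarith)
      simp only [point, Prod.smul_mk, smul_eq_mul, Prod.mk_add_mk]
      linarith

/-- The block of `b` lies below the own rows of `a`, and only a heavy child keeps the column. -/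
theorem spine_descends (hL : T.IsLayout lo X Y) {a b : ℕ} (h : T.SpineChild a b) :
    X a ≤ X b ∧ Y b < Y a ∧ (X a < X b ∨ T.hv a = b) := by
  have ha := h.left
  have h1 := hL.child_bounds h
  have h2 := hL.row_bounds ha.1 ha.2
  have h3 := hL.row_bounds h.1 h.2.2.2
  have h4 := T.twigs_le_own b
  refine ⟨h1.2.2, by omega, ?_⟩
  obtain ⟨h5, h6, rfl, h7⟩ := h
  rcases h7.cases h6 with hc | hc
  · exact Or.inr hc
  · have := (hL b h5).branch hc
    omega

theorem spine_edge_facts (hL : T.IsLayout lo X Y) {a b : ℕ} (h : T.SpineChild a b) {p : ℝ × ℝ}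
    (hp : p ∈ segment ℝ (point X Y b) (point X Y a)) :
    X a ≤ p.1 ∧ p.1 ≤ X b ∧ Y b ≤ p.2 ∧ p.2 ≤ Y a ∧ (p.2 = Y a → p = point X Y a) ∧
      (p.2 = Y b → p = point X Y b) ∧ (X a < X b → p.1 = X a → p = point X Y a) ∧
      (X a < X b → p.1 = X b → p = point X Y b) := by
  have h1 := hL.spine_descends h
  have := mem_segment_facts (A := point X Y a) (B := point X Y b)
    (by simpa [point] using h1.1) (by simpa [point] using h1.2.1) hp
  simpa [point] using this

/-- An arm at an end of a spine edge meets the edge only in this end. -/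
theorem arm_inter_spine_edge (hL : T.IsLayout lo X Y) {a b c : ℕ} (h : T.SpineChild a b)
    (hv : T.par c = a ∨ T.par c = b) {t : ℝ} (ht : 0 ≤ t)
    (hp : point X Y (T.par c) + arm (T.slot c) t ∈ segment ℝ (point X Y b) (point X Y a)) :
    t = 0 := by
  obtain ⟨h1, h2, h3, h4, h5, h6, h7, h8⟩ := hL.spine_edge_facts h hp
  have h9 := hL.spine_descends h
  set q := arm (T.slot c) t with hq
  have hz : q = 0 → t = 0 := fun h0 => by
    rcases arm_cases (T.slot c) ht with ⟨-, -, e⟩ | ⟨-, e, -⟩ | ⟨-, e, -⟩ <;>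
      rw [← hq, h0] at e <;> simp at e <;> linarith
  have hX : (X a : ℝ) ≤ X b := by exact_mod_cast h9.1
  rcases hv with hv | hv
  · rw [hv] at h1 h2 h3 h4 h5 h6 h7 h8
    simp only [point, Prod.fst_add, Prod.snd_add] at h1 h2 h3 h4
    have g5 : (Y a : ℝ) + q.2 = Y a → q = 0 := fun h => by simpa using h5 h
    -- At the upper end the edge runs strictly down and weakly right, while arms run straight up, to
    -- the left, or to the right without descending.
    rcases arm_cases (T.slot c) ht with ⟨-, e1, e2⟩ | ⟨-, e1, e2⟩ | ⟨-, e1, e2⟩ <;>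
      rw [← hq] at e1 e2
    · linarith
    · linarith
    · exact hz (g5 (by linarith))
  · rw [hv] at h1 h2 h3 h4 h5 h6 h7 h8
    simp only [point, Prod.fst_add, Prod.snd_add] at h1 h2 h3 h4
    have g6 : (Y b : ℝ) + q.2 = Y b → q = 0 := fun h => by simpa using h6 h
    have g8 : X a < X b → (X b : ℝ) + q.1 = X b → q = 0 := fun h h' => by simpa using h8 h h'
    rcases arm_cases (T.slot c) ht with ⟨e0, e1, e2⟩ | ⟨-, e1, e2⟩ | ⟨-, e1, e2⟩ <;>
      rw [← hq] at e1 e2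
    · refine hz (g8 ?_ (by linarith))
      rcases h9.2.2 with h10 | h10
      · exact h10
      -- Slot `0` at the lower end would run along a vertical edge, but then this end is a heavy
      -- child and its slots start at `1`.
      · rw [slot, hv, h.2.2.1, if_pos h10] at e0
        omega
    · exact hz (g6 (by linarith))
    · linarith

/-- Either the centre of the arm is an end of the spine edge, or `edge_separated` applies; arms
reach two columns to the left, less than the gap of three. -/
theorem inter_spine_arm (hL : T.IsLayout lo X Y) {u v : ℕ} (hu : u < T.n) (hu0 : u ≠ 0)
    (hus : T.Spine u) (hv : v < T.n) (hv0 : v ≠ 0) (hvs : ¬ T.Spine v) {p : ℝ × ℝ}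
    (hpu : p ∈ segment ℝ (point X Y u) (point X Y (T.par u)))
    (hpv : p ∈ segment ℝ (point X Y v) (point X Y (T.par v))) :
    ∃ w, (w = u ∨ w = T.par u) ∧ (w = v ∨ w = T.par v) ∧ p = point X Y w := by
  have hc : T.SpineChild (T.par u) u := ⟨hu, hu0, rfl, hus⟩
  obtain ⟨c, t₀, h1, h2, h3, h4⟩ := hL.arm_edge hv hv0 hvs
  obtain ⟨⟨t, h5, h6, h7⟩, h8, h9, h10⟩ := h4 p hpv
  have ht0 : 0 ≤ t₀ := by rcases h3 with h | h <;> simp [h.2]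
  by_cases hm : T.par c = T.par u ∨ T.par c = u
  · have h11 : t = 0 := hL.arm_inter_spine_edge hc hm (by linarith) (h7 ▸ hpu)
    rcases h3 with ⟨rfl, -⟩ | ⟨-, h3⟩
    · refine ⟨T.par v, hm.symm, Or.inr rfl, ?_⟩
      rw [h7, h11, arm_zero, add_zero]
    · linarith
  · rw [not_or] at hm
    obtain ⟨f1, f2, f3, f4, -⟩ := hL.spine_edge_facts hc hpu
    rcases hL.edge_separated hc (T.par_lt c h1) (h2.spine_par h1) hm.1 hm.2 with h | h | h
    · have : (Y (T.par u) : ℝ) + T.own (T.par c) < lo (T.par c) + T.d (T.par c) := by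
        exact_mod_cast h
      linarith
    · have : (lo (T.par c) : ℝ) + T.d (T.par c) < Y u := by exact_mod_cast h
      linarith
    · have : (X u : ℝ) + 3 ≤ X (T.par c) := by exact_mod_cast h
      linarith

/-- Arms with different centres lie in disjoint rows; with a common centre, `arm_inj` leaves the
centre or the same arm. -/
theorem inter_arm_arm (hL : T.IsLayout lo X Y) {u v : ℕ} (hu : u < T.n) (hu0 : u ≠ 0)
    (hus : ¬ T.Spine u) (hv : v < T.n) (hv0 : v ≠ 0) (hvs : ¬ T.Spine v) (hne : u ≠ v) {p : ℝ × ℝ}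
    (hpu : p ∈ segment ℝ (point X Y u) (point X Y (T.par u)))
    (hpv : p ∈ segment ℝ (point X Y v) (point X Y (T.par v))) :
    ∃ w, (w = u ∨ w = T.par u) ∧ (w = v ∨ w = T.par v) ∧ p = point X Y w := by
  obtain ⟨c, t₀, h1, h2, h3, h4⟩ := hL.arm_edge hu hu0 hus
  obtain ⟨⟨t, h5, h6, h7⟩, h8, h9, h10⟩ := h4 p hpu
  obtain ⟨c', t₀', h1', h2', h3', h4'⟩ := hL.arm_edge hv hv0 hvs
  obtain ⟨⟨t', h5', h6', h7'⟩, h8', h9', h10'⟩ := h4' p hpv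
  have ht0 : 0 ≤ t₀ := by rcases h3 with h | h <;> simp [h.2]
  have ht0' : 0 ≤ t₀' := by rcases h3' with h | h <;> simp [h.2]
  by_cases hc : T.par c = T.par c'
  · have h11 := h7.symm.trans h7'
    rw [hc] at h11
    rcases arm_inj (by linarith) (by linarith) (add_left_cancel h11) with h12 | h12
    · rcases h3 with ⟨rfl, -⟩ | ⟨-, h3⟩
      · rcases h3' with ⟨rfl, -⟩ | ⟨-, h3'⟩
        · refine ⟨T.par u, Or.inr rfl, Or.inr hc, ?_⟩
          rw [h7, h12.1, arm_zero, add_zero]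
        · linarith
      · linarith
    · obtain rfl : c = c' := by
        refine rank_inj h2 h2' hc ?_
        have := h12.1
        rw [slot, slot, hc] at this
        omega
      obtain rfl : t = t' := h12.2
      rcases h3 with ⟨rfl, h3⟩ | ⟨h3, h3t⟩ <;> rcases h3' with ⟨h3', h3't⟩ | ⟨h3', h3't⟩
      · exact (hne h3'.symm).elim
      · obtain rfl : t = 1 := by linarith
        exact ⟨u, Or.inl rfl, Or.inr h3'.symm, h7.trans (hL.point_twig hu h2).symm⟩
      · subst h3'
        obtain rfl : t = 1 := by linarith
        exact ⟨v, Or.inr h3.symm, Or.inl rfl, h7.trans (hL.point_twig hv h2).symm⟩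
      · have e1 := (Twig.leaf hu hu0 (h3 ▸ h2)).2.2
        have e2 := (Twig.leaf hv hv0 (h3' ▸ h2)).2.2
        rw [h3] at e1
        rw [h3'] at e2
        exact (hne (e1.symm.trans e2)).elim
  · rcases hL.rows_disjoint (T.par_lt c h1) (h2.spine_par h1) (T.par_lt c' h1') (h2'.spine_par h1')
      hc with h | h
    · have : (lo (T.par c) : ℝ) + T.d (T.par c) + T.own (T.par c')
        < lo (T.par c') + T.d (T.par c') := by exact_mod_cast h
      linarith
    · have : (lo (T.par c') : ℝ) + T.d (T.par c') + T.own (T.par c)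
        < lo (T.par c) + T.d (T.par c) := by exact_mod_cast h
      linarith

theorem inter_spine_spine (hL : T.IsLayout lo X Y) {u v : ℕ} (hu : u < T.n) (hu0 : u ≠ 0)
    (hus : T.Spine u) (hv : v < T.n) (hv0 : v ≠ 0) (hvs : T.Spine v) (hne : u ≠ v) {p : ℝ × ℝ}
    (hpu : p ∈ segment ℝ (point X Y u) (point X Y (T.par u)))
    (hpv : p ∈ segment ℝ (point X Y v) (point X Y (T.par v))) :
    ∃ w, (w = u ∨ w = T.par u) ∧ (w = v ∨ w = T.par v) ∧ p = point X Y w := by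
  have hcu : T.SpineChild (T.par u) u := ⟨hu, hu0, rfl, hus⟩
  have hcv : T.SpineChild (T.par v) v := ⟨hv, hv0, rfl, hvs⟩
  obtain ⟨f1, f2, f3, f4, f5, f6, -⟩ := hL.spine_edge_facts hcu hpu
  obtain ⟨g1, g2, g3, g4, g5, g6, -⟩ := hL.spine_edge_facts hcv hpv
  by_cases h1 : T.par u = T.par v
  · refine ⟨T.par u, Or.inr rfl, Or.inr h1, ?_⟩
    have du := hL.spine_descends hcu
    have dv := hL.spine_descends hcv
    have ru := hL.row_bounds hu hus
    have rv := hL.row_bounds hv hvs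
    have ou := own_le hu
    have ov := own_le hv
    have wu := T.twigs_le_own u
    have wv := T.twigs_le_own v
    rw [← h1] at hpv
    rcases hL.siblings hcu (h1 ▸ hcv) hne with h | h
    · refine eq_of_mem_segments (B := point X Y u) (C := point X Y v) ?_ ?_ ?_ ?_ hpu hpv <;>
        (simp only [point]; norm_cast) <;> first | omega | (rw [h1]; omega)
    · refine eq_of_mem_segments (B := point X Y v) (C := point X Y u) ?_ ?_ ?_ ?_ hpv hpu <;>
        (simp only [point]; norm_cast) <;> first | omega | (rw [h1]; omega)
  by_cases h2 : T.par v = u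
  · refine ⟨u, Or.inl rfl, Or.inr h2.symm, f6 ?_⟩
    rw [h2] at g4
    linarith
  by_cases h3 : T.par u = v
  · refine ⟨v, Or.inr h3.symm, Or.inl rfl, g6 ?_⟩
    rw [h3] at f4
    linarith
  have hpu' := T.par_lt u hu
  have hpv' := T.par_lt v hv
  have s1 := hL.edge_separated hcu hpv' (hvs.par hv hv0) (Ne.symm h1) h2
  have s2 := hL.edge_separated hcv hpu' (hus.par hu hu0) h1 h3
  have ru := hL.row_bounds hpu' (hus.par hu hu0)
  have rv := hL.row_bounds hpv' (hvs.par hv hv0)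
  have wu := T.twigs_le_own (T.par u)
  have wv := T.twigs_le_own (T.par v)
  exfalso
  -- Each upper end is separated from the other edge. Not both can lie above the other one, so some
  -- upper end lies entirely below or to the right of the other edge, and its edge only goes further
  -- down and right.
  have key : Y (T.par v) < Y u ∨ X u < X (T.par v) ∨ Y (T.par u) < Y v ∨ X v < X (T.par u) := by
    omega
  rcases key with h | h | h | h
  · have : (Y (T.par v) : ℝ) < Y u := by exact_mod_cast h
    linarith
  · have : (X u : ℝ) < X (T.par v) := by exact_mod_cast h
    linarith
  · have : (Y (T.par u) : ℝ) < Y v := by exact_mod_cast h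
    linarith
  · have : (X v : ℝ) < X (T.par u) := by exact_mod_cast h
    linarith

/-- Two different edges of the drawing meet only in common ends. -/
theorem inter_edges (hL : T.IsLayout lo X Y) {u v : ℕ} (hu : u < T.n) (hu0 : u ≠ 0)
    (hv : v < T.n) (hv0 : v ≠ 0) (hne : u ≠ v) {p : ℝ × ℝ}
    (hpu : p ∈ segment ℝ (point X Y u) (point X Y (T.par u)))
    (hpv : p ∈ segment ℝ (point X Y v) (point X Y (T.par v))) :
    ∃ w, (w = u ∨ w = T.par u) ∧ (w = v ∨ w = T.par v) ∧ p = point X Y w := by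
  by_cases hus : T.Spine u <;> by_cases hvs : T.Spine v
  · exact hL.inter_spine_spine hu hu0 hus hv hv0 hvs hne hpu hpv
  · exact hL.inter_spine_arm hu hu0 hus hv hv0 hvs hpu hpv
  · obtain ⟨w, h1, h2, h3⟩ := hL.inter_spine_arm hv hv0 hvs hu hu0 hus hpv hpu
    exact ⟨w, h2, h1, h3⟩
  · exact hL.inter_arm_arm hu hu0 hus hv hv0 hvs hne hpu hpv

/-- Every vertex lies on an arm at a vertex of the spine, in the own rows of this vertex. -/
theorem exists_center (hL : T.IsLayout lo X Y) {u : ℕ} (hu : u < T.n) :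
    ∃ (v s : ℕ) (t : ℝ), v < T.n ∧ T.Spine v ∧ 0 ≤ t ∧ point X Y u = point X Y v + arm s t ∧
      lo v + T.d v ≤ Y u + T.own v ∧ Y u ≤ lo v + T.d v ∧ X u < T.n ∧
      ((u = v ∧ t = 0) ∨ (T.Twig u ∧ T.par u = v ∧ s = T.slot u ∧ t = 1) ∨
        (u ≠ 0 ∧ T.Twig (T.par u) ∧ T.par (T.par u) = v ∧ s = T.slot (T.par u) ∧ t = 2)) := by
  by_cases ht : T.Twig u
  · have h := hL.twig_bounds hu ht
    exact ⟨T.par u, T.slot u, 1, T.par_lt u hu, ht.spine_par hu, zero_le_one, hL.point_twig hu ht,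
      h.1, h.2.1, h.2.2.2, Or.inr (Or.inl ⟨ht, rfl, rfl, rfl⟩)⟩
  by_cases hl : u ≠ 0 ∧ T.Twig (T.par u)
  · have h := hL.leaf_bounds hu hl.1 hl.2
    have hp := T.par_lt u hu
    exact ⟨T.par (T.par u), T.slot (T.par u), 2, T.par_lt _ hp, hl.2.spine_par hp, zero_le_two,
      hL.point_leaf hu hl.1 hl.2, h.1, h.2.1, h.2.2.2, Or.inr (Or.inr ⟨hl.1, hl.2, rfl, rfl, rfl⟩)⟩
  · have hs : T.Spine u := ⟨ht, hl⟩
    have h1 := hL.row_bounds hu hs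
    have h2 := hL.spine_bounds hu hs
    have h3 := T.twigs_le_own u
    exact ⟨u, 0, 0, hu, hs, le_rfl, by rw [arm_zero, add_zero], by omega, by omega, by omega,
      Or.inl ⟨rfl, rfl⟩⟩

/-- Equal rows force a common centre, since own rows are disjoint; slot and parameter on its arms
then determine the vertex. -/
theorem point_inj (hL : T.IsLayout lo X Y) {u u' : ℕ} (hu : u < T.n) (hu' : u' < T.n)
    (h : point X Y u = point X Y u') : u = u' := by
  obtain ⟨v, s, t, h1, h2, h3, h4, h5, h6, -, h7⟩ := hL.exists_center hu
  obtain ⟨v', s', t', h1', h2', h3', h4', h5', h6', -, h7'⟩ := hL.exists_center hu'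
  have hY : Y u = Y u' := by
    have : (Y u : ℝ) = Y u' := congrArg Prod.snd h
    exact_mod_cast this
  have hv : v = v' := by
    by_contra hne
    have := hL.rows_disjoint h1 h2 h1' h2' hne
    omega
  subst hv
  rw [h4, h4'] at h
  have key : t = t' ∧ (t = 0 ∨ s = s') := by
    rcases arm_inj h3 h3' (add_left_cancel h) with e | e
    · exact ⟨e.1.trans e.2.symm, Or.inl e.1⟩
    · exact ⟨e.2, Or.inr e.1⟩
  obtain ⟨rfl, key⟩ := key
  rcases h7 with ⟨e1, e2⟩ | ⟨e1, e2, e3, e4⟩ | ⟨e1, e2, e3, e4, e5⟩ <;>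
    rcases h7' with ⟨g1, g2⟩ | ⟨g1, g2, g3, g4⟩ | ⟨g1, g2, g3, g4, g5⟩ <;>
    first | (exfalso; linarith) | skip
  · exact e1.trans g1.symm
  · have hs := key.resolve_left (by linarith)
    refine rank_inj e1 g1 (e2.trans g2.symm) ?_
    rw [e3, g3, slot, slot, e2, g2] at hs
    omega
  · have hs := key.resolve_left (by linarith)
    have hp : T.par u = T.par u' := by
      refine rank_inj e2 g2 (e3.trans g3.symm) ?_
      rw [e4, g4, slot, slot, e3, g3] at hs
      omega
    have k1 := (Twig.leaf hu e1 e2).2.2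
    have k2 := (Twig.leaf hu' g1 g2).2.2
    rw [hp] at k1
    exact k1.symm.trans k2

theorem coord_lt (hL : T.IsLayout lo X Y) {u : ℕ} (hu : u < T.n) : X u < T.n ∧ Y u < T.n := by
  obtain ⟨v, s, t, h1, h2, h3, h4, h5, h6, h7, -⟩ := hL.exists_center hu
  have := hL.spine_bounds h1 h2
  omega

/-- The layout is a planar straight-line drawing. -/
theorem planar (hL : T.IsLayout lo X Y) {n : ℕ} (hn : T.n = n) {G : SimpleGraph (Fin n)}
    (hG : ∀ u v : Fin n, G.Adj u v ↔
      ((u : ℕ) ≠ 0 ∧ T.par u = v) ∨ ((v : ℕ) ≠ 0 ∧ T.par v = u)) :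
    IsPlanarStraightLineDrawing G fun v : Fin n => point X Y v := by
  subst hn
  have hedge : ∀ u v : Fin T.n, G.Adj u v → ∃ c : Fin T.n, (c : ℕ) ≠ 0 ∧
      s(u, v) = s(c, ⟨T.par c, T.par_lt c c.2⟩) ∧
      segment ℝ (point X Y u) (point X Y v) = segment ℝ (point X Y c) (point X Y (T.par c)) := by
    intro u v h
    rcases (hG u v).1 h with ⟨h1, h2⟩ | ⟨h1, h2⟩
    · refine ⟨u, h1, ?_, by rw [h2]⟩
      congr 2
      exact Fin.ext h2.symm
    · refine ⟨v, h1, ?_, by rw [h2, segment_symm]⟩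
      rw [Sym2.eq_swap]
      congr 2
      exact Fin.ext h2.symm
  have hinj : Function.Injective fun v : Fin T.n => point X Y v := fun u v h =>
    Fin.ext (hL.point_inj u.2 v.2 h)
  have hee : ∀ u v u' v' : Fin T.n, G.Adj u v → G.Adj u' v' → s(u, v) ≠ s(u', v') →
      ∀ p : ℝ × ℝ, p ∈ segment ℝ (point X Y u) (point X Y v) →
        p ∈ segment ℝ (point X Y u') (point X Y v') →
        ∃ w : Fin T.n, w ∈ s(u, v) ∧ w ∈ s(u', v') ∧ p = point X Y w := by
    intro u v u' v' h h' hne p hp hp'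
    obtain ⟨c, hc0, hc, hcs⟩ := hedge u v h
    obtain ⟨c', hc0', hc', hcs'⟩ := hedge u' v' h'
    rw [hcs] at hp
    rw [hcs'] at hp'
    have hcc : (c : ℕ) ≠ c' := fun e => hne (by
      obtain rfl : c = c' := Fin.ext e
      rw [hc, hc'])
    obtain ⟨w, h1, h2, h3⟩ := hL.inter_edges c.2 hc0 c'.2 hc0' hcc hp hp'
    have hw : w < T.n := by
      rcases h1 with rfl | rfl
      · exact c.2
      · exact T.par_lt c c.2
    refine ⟨⟨w, hw⟩, ?_, ?_, h3⟩
    · rw [hc, Sym2.mem_iff]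
      exact h1.imp Fin.ext Fin.ext
    · rw [hc', Sym2.mem_iff]
      exact h2.imp Fin.ext Fin.ext
  refine ⟨hinj, ?_, hee⟩
  intro u v w huv hw
  have hn := T.three_le
  -- Every vertex is an end of some edge, so a vertex on a foreign edge would be a meeting point of
  -- two edges, which `hee` settles.
  have hwe : ∃ z : Fin T.n, G.Adj w z := by
    by_cases h0 : (w : ℕ) = 0
    · have h1 : T.d 0 ≠ 0 := by have := T.d_root; omega
      obtain ⟨e1, e2, e3, -⟩ := T.hv_spec 0 (by omega) h1
      exact ⟨⟨T.hv 0, e2⟩, (hG _ _).2 (Or.inr ⟨e1, e3.trans h0.symm⟩)⟩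
    · exact ⟨⟨T.par w, T.par_lt w w.2⟩, (hG _ _).2 (Or.inl ⟨h0, rfl⟩)⟩
  obtain ⟨z, hz⟩ := hwe
  by_cases he : s(u, v) = s(w, z)
  · have : w ∈ s(u, v) := he ▸ Sym2.mem_mk_left w z
    exact Sym2.mem_iff.1 this
  · obtain ⟨x, h1, -, h3⟩ := hee u v w z huv hz he (point X Y w) hw (left_mem_segment _ _ _)
    have : w = x := hinj h3
    exact Sym2.mem_iff.1 (this ▸ h1)

end IsLayout

end HeavyTree

end SegmentDrawing

namespace SegmentDrawing

namespace HeavyTree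

/-! ### Counting segments -/

/-- The edge from `u` to its parent continues an edge that is used to count the segment: it leads
from a heavy child to its heavy child, or it is the second edge of a line in a fan. -/
def Continues (T : HeavyTree) (u : ℕ) : Prop :=
  (T.Twig u ∧ T.slot u % 2 = 0) ∨
    (T.Spine u ∧ u ≠ 0 ∧ T.hv (T.par u) = u ∧ T.hv (T.par (T.par u)) = T.par u)

instance (T : HeavyTree) : DecidablePred T.Continues :=
  fun _ => inferInstanceAs (Decidable (_ ∨ _))

/-- The potential used to count the edges that continue others. -/
def potential (T : HeavyTree) (v : ℕ) : ℕ :=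
  if T.Spine v then
    if v ≠ 0 ∧ T.hv (T.par v) = v then if T.d v = 0 then 0 else T.d v + 2 else T.d v + 1
  else 0

variable {T : HeavyTree} {lo X Y : ℕ → ℕ}

theorem Continues.ne_zero {u : ℕ} (h : T.Continues u) : u ≠ 0 := by
  rcases h with h | h
  · exact h.1.1
  · exact h.2.1

/-- The slots at `v` are consecutive numbers starting at `1` if `v` is a heavy child and at `0`
otherwise, so half of them, rounded down or up, are even. -/
theorem sum_even_slot (v k : ℕ) :
    ∑ c ∈ Finset.range k, (if (T.Twig c ∧ T.par c = v) ∧ T.slot c % 2 = 0 then 1 else 0)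
      = ((∑ c ∈ Finset.range k, if T.Twig c ∧ T.par c = v then 1 else 0) + 1
          - if T.hv (T.par v) = v then 1 else 0) / 2 := by
  induction k with
  | zero =>
    simp only [Finset.range_zero, Finset.sum_empty]
    split_ifs <;> rfl
  | succ k ih =>
    rw [Finset.sum_range_succ, Finset.sum_range_succ, ih]
    by_cases hk : T.Twig k ∧ T.par k = v
    · have hs : T.slot k = (∑ c ∈ Finset.range k, if T.Twig c ∧ T.par c = v then 1 else 0)
          + if T.hv (T.par v) = v then 1 else 0 := by
        rw [slot, rank, hk.2]
      simp only [hk, true_and, and_self, if_true]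
      split_ifs at hs ⊢ <;> omega
    · simp [hk]

theorem branchSum_eq_zero {v : ℕ} (hv : v < T.n) (h0 : T.d v ≠ 0) (h : T.d (T.hv v) = 0) :
    T.branchSum v = 0 := by
  refine Finset.sum_eq_zero fun c hc => if_neg ?_
  rintro ⟨h1, h2⟩
  have := (T.hv_spec v hv h0).2.2.2 h c (Finset.mem_range.1 hc) h1.1 h2
  have := h1.2.2
  omega

/-- Four per even slot pays for `own v ≤ 2 * twigs v`, up to a deficit of at most `2` when the slots
start at `1`. In that case `v` is a heavy child, the edge to its heavy child continues and pays `4`.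
If the heavy child is a leaf, its potential is lost, but then `own v = twigs v` and there are no
branches. -/
theorem potential_le {v : ℕ} (hv : v < T.n) :
    T.potential v ≤ ∑ c ∈ Finset.range T.n, if c ≠ 0 ∧ T.par c = v then
      4 * (if T.Continues c then 1 else 0) + T.potential c else 0 := by
  by_cases hs : T.Spine v
  swap
  · rw [potential, if_neg hs]
    exact Nat.zero_le _
  have hr := T.d_root
  have hn := T.three_le
  have hz : T.hv (T.par v) = v → v ≠ 0 := by
    rintro h rfl
    rw [T.par_zero] at h
    exact (T.hv_spec 0 hv (by omega)).1 h
  have htop : T.hv (T.par v) ≠ v → 2 ≤ T.d v := fun h => by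
    by_cases h0 : v = 0
    · subst h0
      omega
    · exact ((hs.cases h0).resolve_left h).2.2
  by_cases hd : T.d v = 0
  · have h1 : T.hv (T.par v) = v := by
      by_contra h
      have := htop h
      omega
    rw [potential, if_pos hs, if_pos ⟨hz h1, h1⟩, if_pos hd]
    exact Nat.zero_le _
  obtain ⟨g1, g2, g3, -⟩ := T.hv_spec v hv hd
  have gs := hs.hv hv hd
  set h := T.hv v with hh
  have e1 : ∑ c ∈ Finset.range T.n,
      (if c = h then 4 * (if T.Continues c then 1 else 0) + T.potential c else 0)
      = 4 * (if T.Continues h then 1 else 0) + T.potential h := by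
    simp [g2]
  have e2 := sum_even_slot (T := T) v T.n
  change _ = (T.twigs v + 1 - _) / 2 at e2
  have e3 : (∑ c ∈ Finset.range T.n,
      (if c = h then 4 * (if T.Continues c then 1 else 0) + T.potential c else 0))
      + 4 * (∑ c ∈ Finset.range T.n,
        (if (T.Twig c ∧ T.par c = v) ∧ T.slot c % 2 = 0 then 1 else 0)) + T.branchSum v
      ≤ ∑ c ∈ Finset.range T.n, if c ≠ 0 ∧ T.par c = v then
        4 * (if T.Continues c then 1 else 0) + T.potential c else 0 := by
    rw [branchSum, Finset.mul_sum, ← Finset.sum_add_distrib, ← Finset.sum_add_distrib]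
    refine Finset.sum_le_sum fun c hc => ?_
    by_cases hch : c = h
    · subst hch
      have k1 : ¬ T.Twig h := gs.1
      have k2 : ¬ T.Branch h := fun h' => h'.2.1 (by rw [g3])
      simp [k1, k2, g1, g3]
    · by_cases hcT : T.Twig c ∧ T.par c = v
      · have k2 : ¬ T.Branch c := fun h' => by
          have := h'.2.2
          have := hcT.1.2.2
          omega
        rw [if_neg hch, if_neg (show ¬ (T.Branch c ∧ T.par c = v) from fun h' => k2 h'.1),
          if_pos (show c ≠ 0 ∧ T.par c = v from ⟨hcT.1.1, hcT.2⟩)]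
        by_cases he : T.slot c % 2 = 0
        · rw [if_pos ⟨hcT, he⟩, if_pos (show T.Continues c from Or.inl ⟨hcT.1, he⟩)]
          omega
        · rw [if_neg (show ¬ (_ ∧ T.slot c % 2 = 0) from fun h' => he h'.2)]
          omega
      · rw [if_neg hch, if_neg (show ¬ (_ ∧ T.slot c % 2 = 0) from fun h' => hcT h'.1)]
        by_cases hcB : T.Branch c ∧ T.par c = v
        · have k3 := hcB.1.spine (Finset.mem_range.1 hc)
          have k4 : ¬ (c ≠ 0 ∧ T.hv (T.par c) = c) := fun h' => hcB.1.2.1 h'.2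
          rw [if_pos hcB, if_pos (show c ≠ 0 ∧ T.par c = v from ⟨hcB.1.1, hcB.2⟩), potential, if_pos k3, if_neg k4]
          omega
        · rw [if_neg hcB]
          exact Nat.zero_le _
  refine le_trans ?_ e3
  rw [e1, e2]
  have f1 := d_split hv hd
  have f2 := T.own_le_two_mul v
  have f3 := fun h' => own_eq_twigs hv hd h'
  have f4 := fun h' => branchSum_eq_zero hv hd h'
  rw [← hh] at f1 f3 f4
  have p1 : T.potential h = if T.d h = 0 then 0 else T.d h + 2 := by
    rw [potential, if_pos gs, if_pos ⟨g1, by rw [g3]⟩]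
  have p2 : T.Continues h ↔ T.hv (T.par v) = v := by
    rw [Continues, g3]
    constructor
    · rintro (h' | h')
      · exact (gs.1 h'.1).elim
      · exact h'.2.2.2
    · exact fun h' => Or.inr ⟨gs, g1, rfl, h'⟩
  rw [p1, potential, if_pos hs]
  by_cases ht : T.hv (T.par v) = v
  · rw [if_pos ⟨hz ht, ht⟩, if_neg hd, if_pos (p2.2 ht), if_pos ht]
    split_ifs with hd0
    · have := f3 hd0
      omega
    · omega
  · rw [if_neg (fun h' => ht h'.2), if_neg (fun h' => ht (p2.1 h')), if_neg ht]
    have := htop ht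
    split_ifs with hd0
    · have := f3 hd0
      have := f4 hd0
      omega
    · omega

/-- At least a quarter of the vertices have an edge that continues another one. -/
theorem le_four_mul_continues :
    T.n ≤ 4 * ∑ c ∈ Finset.range T.n, if T.Continues c then 1 else 0 := by
  have hr := T.d_root
  have hn := T.three_le
  have h1 : ∑ v ∈ Finset.range T.n, T.potential v ≤ ∑ c ∈ Finset.range T.n,
      if c ≠ 0 then 4 * (if T.Continues c then 1 else 0) + T.potential c else 0 := by
    rw [← sum_by_parent T.par_lt]
    exact Finset.sum_le_sum fun v hv => potential_le (Finset.mem_range.1 hv)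
  have h2 := sum_ne_zero_add (n := T.n) (by omega)
    (fun c => 4 * (if T.Continues c then 1 else 0) + T.potential c)
  rw [Finset.sum_add_distrib, ← Finset.mul_sum] at h2
  have h3 : T.potential 0 = T.n := by
    rw [potential, if_pos spine_zero, if_neg (fun h => h.1 rfl), hr]
  omega

theorem card_not_continues :
    4 * ((Finset.range T.n).filter fun u => u ≠ 0 ∧ ¬ T.Continues u).card + 4 ≤ 3 * T.n := by
  have h1 := T.le_four_mul_continues
  have hn := T.three_le
  have h2 : ∑ c ∈ Finset.range T.n, (if c = 0 then 1 else 0) = 1 := by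
    simp [show 0 < T.n by omega]
  have h3 : (∑ c ∈ Finset.range T.n, if c ≠ 0 ∧ ¬ T.Continues c then 1 else 0)
      + (∑ c ∈ Finset.range T.n, if T.Continues c then 1 else 0)
      + ∑ c ∈ Finset.range T.n, (if c = 0 then 1 else 0) = T.n := by
    rw [← Finset.sum_add_distrib, ← Finset.sum_add_distrib]
    refine (Finset.sum_congr rfl fun c _ => ?_).trans (by simp : ∑ _c ∈ Finset.range T.n, 1 = T.n)
    by_cases hc : T.Continues c
    · simp [hc, hc.ne_zero]
    · by_cases h0 : c = 0
      · subst h0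
        simp [hc]
      · simp [hc, h0]
  rw [Finset.card_filter]
  omega

/-- Ranks at a vertex have no gaps. For an even nonzero slot, the preceding twig is the opposite
arm. -/
theorem exists_previous_twig {u : ℕ} (h : T.rank u ≠ 0) :
    ∃ w < u, T.Twig w ∧ T.par w = T.par u ∧ T.rank w + 1 = T.rank u := by
  have key : ∀ k, ∑ c ∈ Finset.range k, (if T.Twig c ∧ T.par c = T.par u then 1 else 0) ≠ 0 →
      ∃ w < k, T.Twig w ∧ T.par w = T.par u ∧ T.rank w + 1
        = ∑ c ∈ Finset.range k, (if T.Twig c ∧ T.par c = T.par u then 1 else 0) := by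
    intro k
    induction k with
    | zero => simp
    | succ k ih =>
      rw [Finset.sum_range_succ]
      by_cases hk : T.Twig k ∧ T.par k = T.par u
      · intro _
        exact ⟨k, by omega, hk.1, hk.2, by rw [if_pos hk, rank, hk.2]⟩
      · rw [if_neg hk, add_zero]
        intro h'
        obtain ⟨w, h1, h2⟩ := ih h'
        exact ⟨w, by omega, h2⟩
  exact key u h

namespace IsLayout

/-- Every segment of the layout contains an edge that does not continue another one. -/
theorem exists_not_continues (hL : T.IsLayout lo X Y) {n : ℕ} (hn : T.n = n)
    {G : SimpleGraph (Fin n)} (e : ℕ → G.edgeSet)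
    (he : ∀ u < n, u ≠ 0 → ∀ x : Fin n, x ∈ (e u).1 ↔ (x : ℕ) = u ∨ (x : ℕ) = T.par u) {u : ℕ}
    (hu : u < n) (hu0 : u ≠ 0) :
    ∃ w < n, w ≠ 0 ∧ ¬ T.Continues w ∧
      (Quot.mk _ (e u) : Segments G fun v : Fin n => point X Y v) = Quot.mk _ (e w) := by
  subst hn
  have align : ∀ u w z : ℕ, u < T.n → u ≠ 0 → w < T.n → w ≠ 0 → (z = u ∨ z = T.par u) →
      (z = w ∨ z = T.par w) → ∀ D : ℝ × ℝ,
      (∀ x, x = u ∨ x = T.par u ∨ x = w ∨ x = T.par w →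
        ∃ r : ℝ, point X Y x = r • D + point X Y z) →
      (Quot.mk _ (e u) : Segments G fun v : Fin T.n => point X Y v) = Quot.mk _ (e w) := by
    intro u w z hu hu0 hw hw0 hzu hzw D hD
    have hz : z < T.n := by
      rcases hzu with rfl | rfl
      · exact hu
      · exact T.par_lt u hu
    refine Quot.sound ⟨⟨⟨z, hz⟩, (he u hu hu0 _).2 hzu, (he w hw hw0 _).2 hzw⟩, ?_⟩
    rw [collinear_iff_exists_forall_eq_smul_vadd]
    refine ⟨point X Y z, D, ?_⟩
    rintro _ ⟨x, hx, rfl⟩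
    refine hD x ?_
    rcases hx with hx | hx
    · have := (he u hu hu0 x).1 hx
      tauto
    · have := (he w hw hw0 x).1 hx
      tauto
  have vert : ∀ x z : ℕ, X x = X z →
      ∃ r : ℝ, point X Y x = r • ((0 : ℝ), (1 : ℝ)) + point X Y z := by
    intro x z h
    exact ⟨(Y x : ℝ) - Y z, by simp [point, h]⟩
  induction hk : T.dep u using Nat.strong_induction_on generalizing u with
  | _ k ih =>
    by_cases hc : T.Continues u
    swap
    · exact ⟨u, hu, hu0, hc, rfl⟩
    have hp := T.par_lt u hu
    rcases hc with ⟨ht, hev⟩ | ⟨hs, -, hh, hh'⟩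
    · by_cases h0 : T.slot u = 0
      · have hd : T.d (T.par u) ≠ 0 := by have := d_child hu hu0; omega
        obtain ⟨g1, g2, g3, -⟩ := T.hv_spec _ hp hd
        have gs := (ht.spine_par hu).hv hp hd
        have gx := ((hL _ g2).heavy g1 gs (by rw [g3])).2
        rw [g3] at gx
        have ux := ((hL u hu).twig_zero ht h0).1
        -- A vertical twig lies in line with the heavy edge below it. As slot `0` occurs only where
        -- the parent is not a heavy child, this heavy edge is the first of its chain.
        refine ⟨T.hv (T.par u), g2, g1, ?_, ?_⟩
        · rintro (h | h)
          · exact gs.1 h.1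
          · have := h.2.2.2
            rw [g3] at this
            rw [slot, if_pos this] at h0
            omega
        · refine align u _ (T.par u) hu hu0 g2 g1 (Or.inr rfl) (Or.inr g3.symm) (0, 1) ?_
          rintro x (rfl | rfl | rfl | rfl)
          · exact vert _ _ ux
          · exact vert _ _ rfl
          · exact vert _ _ gx
          · rw [g3]
            exact vert _ _ rfl
      · have hr : T.rank u ≠ 0 := fun h => by
          rw [slot, h] at hev h0
          split_ifs at hev h0; all_goals omega
        obtain ⟨w, w1, w2, w3, w4⟩ := exists_previous_twig hr
        have hsl : T.slot w + 1 = T.slot u := by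
          rw [slot, slot, w3]
          omega
        refine ⟨w, by omega, w2.1, ?_, ?_⟩
        · rintro (h | h)
          · omega
          · exact h.1.1 w2
        · have hu' := hL.twig_position hu ht
          have hw' := hL.twig_position (by omega) w2
          -- With `slot w = 2 * i + 1` and `slot u = 2 * i + 2`, the twigs are displaced by `-(1,
          -- i)` and `(1, i)`.
          refine align u w (T.par u) hu hu0 (by omega) w2.1 (Or.inr rfl) (Or.inr w3.symm)
            (1, ((T.slot w / 2 : ℕ) : ℝ)) ?_
          have hus : point X Y u
              = (1 : ℝ) • ((1 : ℝ), ((T.slot w / 2 : ℕ) : ℝ)) + point X Y (T.par u) := by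
            have e1 : X u = 1 + X (T.par u) := by omega
            have e2 : Y u = T.slot w / 2 + Y (T.par u) := by omega
            simp [point, e1, e2, -Nat.cast_div]
          have hws : point X Y w
              = (-1 : ℝ) • ((1 : ℝ), ((T.slot w / 2 : ℕ) : ℝ)) + point X Y (T.par u) := by
            have e1 : X (T.par u) = X w + 1 := by rw [w3] at hw'; omega
            have e2 : Y (T.par u) = Y w + T.slot w / 2 := by rw [w3] at hw'; omega
            simp [point, e1, e2, -Nat.cast_div]
          rintro x (rfl | rfl | rfl | rfl)
          · exact ⟨1, hus⟩
          · exact ⟨0, by simp⟩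
          · exact ⟨-1, hws⟩
          · rw [w3]
            exact ⟨0, by simp⟩
    -- A heavy edge below a heavy edge lies in the same column; induction climbs to the first edge
    -- of the chain.
    · have hp0 : T.par u ≠ 0 := fun h => by
        rw [h, T.par_zero] at hh'
        rw [h] at hh
        exact hu0 (hh.symm.trans hh')
      have hsp := hs.par hu hu0
      obtain ⟨w, w1, w2, w3, w4⟩ := ih _ (hk ▸ T.dep_par u hu hu0) hp0 hp rfl
      refine ⟨w, w1, w2, w3, Eq.trans ?_ w4⟩
      have x1 := ((hL u hu).heavy hu0 hs hh).2
      have x2 := ((hL _ hp).heavy hp0 hsp hh').2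
      refine align u (T.par u) (T.par u) hu hu0 hp hp0 (Or.inr rfl) (Or.inl rfl) (0, 1) ?_
      rintro x (rfl | rfl | rfl | rfl)
      · exact vert _ _ x1
      · exact vert _ _ rfl
      · exact vert _ _ rfl
      · exact vert _ _ x2.symm

/-- The edges that do not continue another one map onto the set of segments. -/
theorem segmentCount_le (hL : T.IsLayout lo X Y) {n : ℕ} (hn : T.n = n) {G : SimpleGraph (Fin n)}
    (hG : ∀ u v : Fin n, G.Adj u v ↔
      ((u : ℕ) ≠ 0 ∧ T.par u = v) ∨ ((v : ℕ) ≠ 0 ∧ T.par v = u)) :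
    4 * segmentCount G (fun v : Fin n => point X Y v) + 4 ≤ 3 * n := by
  classical
  have h3 := T.three_le
  have hr := T.d_root
  have hpar : ∀ u < n, T.par u < n := fun u hu => hn ▸ T.par_lt u (hn ▸ hu)
  have hadj : ∀ u (hu : u < n), u ≠ 0 → G.Adj ⟨u, hu⟩ ⟨T.par u, hpar u hu⟩ := fun u hu h0 =>
    (hG _ _).2 (Or.inl ⟨h0, rfl⟩)
  have he1 : ∃ e₁ : G.edgeSet, True := by
    obtain ⟨k1, k2, -⟩ := T.hv_spec 0 (by omega) (by omega)
    exact ⟨⟨s(_, _), hadj (T.hv 0) (by omega) k1⟩, trivial⟩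
  obtain ⟨e₁, -⟩ := he1
  let e : ℕ → G.edgeSet := fun u => if h : u < n ∧ u ≠ 0 then ⟨s(_, _), hadj u h.1 h.2⟩ else e₁
  have he : ∀ u < n, u ≠ 0 → ∀ x : Fin n, x ∈ (e u).1 ↔ (x : ℕ) = u ∨ (x : ℕ) = T.par u := by
    intro u hu h0 x
    simp only [e, dif_pos (⟨hu, h0⟩ : u < n ∧ u ≠ 0), Sym2.mem_iff, Fin.ext_iff]
  have hsurj : Function.Surjective
      (fun u : ((Finset.range T.n).filter fun u => u ≠ 0 ∧ ¬ T.Continues u) =>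
        (Quot.mk _ (e u) : Segments G fun v : Fin n => point X Y v)) := by
    rintro ⟨⟨z, hz⟩⟩
    obtain ⟨u, hu, hu0, hze⟩ : ∃ u < n, u ≠ 0 ∧ z = (e u).1 := by
      induction z with
      | _ a b =>
        rcases (hG a b).1 hz with ⟨k1, k2⟩ | ⟨k1, k2⟩
        · refine ⟨a, a.2, k1, ?_⟩
          simp only [e, dif_pos (⟨a.2, k1⟩ : (a : ℕ) < n ∧ (a : ℕ) ≠ 0)]
          congr 2
          exact Fin.ext k2.symm
        · refine ⟨b, b.2, k1, ?_⟩
          simp only [e, dif_pos (⟨b.2, k1⟩ : (b : ℕ) < n ∧ (b : ℕ) ≠ 0)]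
          rw [Sym2.eq_swap]
          congr 2
          exact Fin.ext k2.symm
    obtain ⟨w, w1, w2, w3, w4⟩ := hL.exists_not_continues hn e he hu hu0
    refine ⟨⟨w, by simp [hn, w1, w2, w3]⟩, ?_⟩
    have hz' : (⟨z, hz⟩ : G.edgeSet) = e u := Subtype.ext hze
    rw [hz']
    exact w4.symm
  have hcard := Nat.card_le_card_of_surjective _ hsurj
  change segmentCount G _ ≤ _ at hcard
  rw [Nat.card_eq_fintype_card, Fintype.card_coe] at hcard
  have := T.card_not_continues
  omega

end IsLayout

end HeavyTree

end SegmentDrawing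

namespace SegmentDrawing

/-! ### The program: reading the edges and rooting the tree

Variables: `0` number of vertices, `1` number of edges, `2` loop counter, `3` end of the queue,
`4` current vertex, `5` its parent, `6` slot. Arrays: `0`, `1` edges, `2`, `3` coordinates,
`4` remaining degree, `5` sum of the remaining neighbours, `6` queue, `7` parent, `8` number of proper
descendants, `9` heavy child, `10` rank of a twig, `11` number of twigs, `12` number of vertices in
twigs, `13` offset of a branch, `14` number of vertices in branches, `15` halves, `16` mark of twigs,
`17` lowest row. -/

@[simp] theorem State.setVar_var (s : State) (x v y : ℕ) :
    (s.setVar x v).var y = if y = x then v else s.var y := by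
  simp [State.setVar, Function.update_apply]

@[simp] theorem State.setVar_arr (s : State) (x v : ℕ) : (s.setVar x v).arr = s.arr := rfl

@[simp] theorem State.setArr_var (s : State) (a i v : ℕ) : (s.setArr a i v).var = s.var := rfl

@[simp] theorem State.setArr_arr (s : State) (a i v b : ℕ) :
    (s.setArr a i v).arr b = if b = a then Function.update (s.arr a) i v else s.arr b := by
  simp [State.setArr, Function.update_apply]

/-- The cell of an array at the index in a variable. -/
def Expr.cell (a x : ℕ) : Expr := .get a (.var x)

def Expr.plus (e₁ e₂ : Expr) : Expr := .bin .add e₁ e₂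

def Expr.minus (e₁ e₂ : Expr) : Expr := .bin .sub e₁ e₂

def Expr.times (e₁ e₂ : Expr) : Expr := .bin .mul e₁ e₂

def Expr.less (e₁ e₂ : Expr) : Expr := .bin .lt e₁ e₂

def Expr.equal (e₁ e₂ : Expr) : Expr := .bin .eq e₁ e₂

/-- Run programs one after another. -/
def Program.block : List Program → Program
  | [] => .nop
  | p :: l => .seq p (Program.block l)

/-- Increase the loop counter. -/
def stepCounter : Program := .assign 2 (.plus (.var 2) (.lit 1))

/-- Compute the degree and the sum of the neighbours of every vertex. -/
def degreeBody : Program := .block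
  [.assign 4 (.cell 0 2), .assign 5 (.cell 1 2),
    .store 4 (.var 4) (.plus (.cell 4 4) (.lit 1)),
    .store 4 (.var 5) (.plus (.cell 4 5) (.lit 1)),
    .store 5 (.var 4) (.plus (.cell 5 4) (.var 5)),
    .store 5 (.var 5) (.plus (.cell 5 5) (.var 4)),
    stepCounter]

/-- Collect the leaves other than the root in the queue. -/
def leafBody : Program := .block
  [.cond (.equal (.cell 4 2) (.lit 1))
      (.seq (.store 6 (.var 3) (.var 2)) (.assign 3 (.plus (.var 3) (.lit 1)))) .nop,
    stepCounter]

/-- Remove the next vertex of the queue, whose only remaining neighbour is its parent. -/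
def peelBody : Program := .block
  [.assign 4 (.cell 6 2), .assign 5 (.cell 5 4),
    .store 7 (.var 4) (.var 5),
    .store 4 (.var 5) (.minus (.cell 4 5) (.lit 1)),
    .store 5 (.var 5) (.minus (.cell 5 5) (.var 4)),
    .store 8 (.var 5) (.plus (.cell 8 5) (.plus (.cell 8 4) (.lit 1))),
    .cond (.plus (.equal (.cell 9 5) (.lit 0)) (.less (.lit 0) (.cell 8 4)))
      (.store 9 (.var 5) (.var 4)) .nop,
    .cond (.times (.equal (.cell 4 5) (.lit 1)) (.less (.lit 0) (.var 5)))
      (.seq (.store 6 (.var 3) (.var 5)) (.assign 3 (.plus (.var 3) (.lit 1)))) .nop,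
    stepCounter]

/-! ### Invariants of the degree and leaf passes -/

theorem sum_insert_mem {n u : ℕ} {D : Finset ℕ} (hu : u < n) (hD : u ∉ D) (P : ℕ → Prop)
    [DecidablePred P] (g : ℕ → ℕ) :
    ∑ c ∈ Finset.range n, (if P c ∧ c ∈ insert u D then g c else 0)
      = (∑ c ∈ Finset.range n, if P c ∧ c ∈ D then g c else 0) + if P u then g u else 0 := by
  have h : (∑ c ∈ Finset.range n, if c = u then (if P u then g u else 0) else 0)
      = if P u then g u else 0 := by
    simp [hu]
  rw [← h, ← Finset.sum_add_distrib]
  refine Finset.sum_congr rfl fun c _ => ?_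
  by_cases hc : c = u
  · subst hc
    simp [hD]
  · simp [hc]

theorem sum_insert_not_mem {n u : ℕ} {D : Finset ℕ} (hu : u < n) (hD : u ∉ D) (P : ℕ → Prop)
    [DecidablePred P] (g : ℕ → ℕ) :
    (∑ c ∈ Finset.range n, if P c ∧ c ∉ insert u D then g c else 0) + (if P u then g u else 0)
      = ∑ c ∈ Finset.range n, if P c ∧ c ∉ D then g c else 0 := by
  have h : (∑ c ∈ Finset.range n, if c = u then (if P u then g u else 0) else 0)
      = if P u then g u else 0 := by
    simp [hu]
  rw [← h, ← Finset.sum_add_distrib]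
  refine Finset.sum_congr rfl fun c _ => ?_
  by_cases hc : c = u
  · subst hc
    simp [hD]
  · simp [hc]

/-- The memory after `i` edges. -/
structure DegreeInv (n m : ℕ) (a b : ℕ → ℕ) (i : ℕ) (s : State) : Prop where
  var0 : s.var 0 = n
  var1 : s.var 1 = m
  var2 : s.var 2 = i
  var3 : s.var 3 = 0
  arr0 : s.arr 0 = a
  arr1 : s.arr 1 = b
  deg : ∀ v, s.arr 4 v
    = ∑ j ∈ Finset.range i, ((if a j = v then 1 else 0) + if b j = v then 1 else 0)
  sum : ∀ v, s.arr 5 v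
    = ∑ j ∈ Finset.range i, ((if a j = v then b j else 0) + if b j = v then a j else 0)
  zero : ∀ k v, 6 ≤ k → s.arr k v = 0

theorem degree_loop {W M n m : ℕ} (hn : 3 ≤ n) (hm : m < n) (hM : 9 * n * n ≤ M)
    (hW : M ^ (Program.loop (.less (.var 2) (.var 1)) degreeBody).rank < W) {a b : ℕ → ℕ}
    (ha : ∀ j < m, a j < n) (hb : ∀ j < m, b j < n) {s : State} (hs : Small M s)
    (h0 : DegreeInv n m a b 0 s) :
    Runs W M (.loop (.less (.var 2) (.var 1)) degreeBody) s
      ((m + 1) * ((Expr.less (.var 2) (.var 1)).cost + 1 + degreeBody.cost))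
      (DegreeInv n m a b m) := by
  have hM2 : 2 ≤ M := by nlinarith
  refine runs_loop hM2 (DegreeInv n m a b) hW ?_ ?_ hs h0
  · intro i hi s hs h
    have b1 : ∀ k ≤ m, ∀ v, ∑ j ∈ Finset.range k,
        ((if a j = v then 1 else 0) + if b j = v then 1 else 0) ≤ 2 * k := by
      intro k hk v
      refine (Finset.sum_le_card_nsmul _ _ 2 fun j _ => ?_).trans (by simp [mul_comm])
      split_ifs <;> omega
    -- Sums of neighbours can be quadratic in `n`, which the word bound `9 * n * n ≤ M`
    -- accommodates.
    have b2 : ∀ k ≤ m, ∀ v, ∑ j ∈ Finset.range k,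
        ((if a j = v then b j else 0) + if b j = v then a j else 0) ≤ 2 * n * k := by
      intro k hk v
      refine (Finset.sum_le_card_nsmul _ _ (2 * n) fun j hj => ?_).trans (by simp [mul_comm])
      have := ha j (by have := Finset.mem_range.1 hj; omega)
      have := hb j (by have := Finset.mem_range.1 hj; omega)
      split_ifs <;> omega
    have c1 : ∀ v, s.arr 4 v ≤ 2 * i := fun v => (h.deg v).trans_le (b1 i hi.le v)
    have c2 : ∀ v, s.arr 5 v ≤ 2 * n * i := fun v => (h.sum v).trans_le (b2 i hi.le v)
    have hin : 2 * n * i + 2 * n ≤ M := by nlinarith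
    have hin' : 9 * n ≤ M := by nlinarith
    have hai := ha i hi
    have hbi := hb i hi
    refine ⟨?_, ?_, ?_⟩
    · simp [Expr.less, Expr.eval, BinOp.eval, h.var1, h.var2, hi]
    · simp [degreeBody, Program.block, stepCounter, Program.Safe, Program.denote, Expr.cell,
        Expr.plus, Expr.eval, BinOp.eval, State.setVar, State.setArr, Function.update_apply,
        h.var2, h.arr0, h.arr1]
      have := c1 (a i)
      have := c1 (b i)
      have := c2 (a i)
      have := c2 (b i)
      refine ⟨?_, ?_, ?_, ?_, ?_, ?_, ?_⟩ <;> (try split_ifs) <;> omega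
    · constructor <;> simp only [degreeBody, Program.block, stepCounter, Program.denote, Expr.cell,
        Expr.plus, Expr.eval, BinOp.eval, State.setVar, State.setArr, Function.update_apply,
        h.var0, h.var1, h.var2, h.var3, h.arr0, h.arr1]
      all_goals simp [Function.update_apply]
      · intro v
        rw [Finset.sum_range_succ, ← h.deg v]
        by_cases h1 : v = a i <;> by_cases h2 : v = b i
        · simp [← h1, ← h2]
        · simp [← h1, h2, Ne.symm h2]
        · simp [h1, ← h2, Ne.symm h1]
        · simp [h1, h2, Ne.symm h1, Ne.symm h2]
      · intro v
        rw [Finset.sum_range_succ, ← h.sum v]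
        by_cases h1 : v = a i <;> by_cases h2 : v = b i
        · simp [← h1, ← h2, add_assoc]
        · simp [← h1, h2, Ne.symm h2]
        · simp [h1, ← h2, Ne.symm h1]
        · simp [h1, h2, Ne.symm h1, Ne.symm h2]
      · intro k v hk
        have : k ≠ 4 := by omega
        have : k ≠ 5 := by omega
        simp [*, h.zero k v hk]
  · intro s hs h
    simp [Expr.less, Expr.eval, BinOp.eval, h.var1, h.var2]

/-- The memory after the search for leaves among the vertices up to `i`. -/
structure LeafInv (n : ℕ) (deg sum : ℕ → ℕ) (i : ℕ) (s : State) : Prop where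
  var0 : s.var 0 = n
  -- The search starts at vertex `1`, so that the root never enters the queue.
  var2 : s.var 2 = i + 1
  le : s.var 3 ≤ i
  arr4 : s.arr 4 = deg
  arr5 : s.arr 5 = sum
  mem : ∀ v, (∃ j < s.var 3, s.arr 6 j = v) ↔ v ≠ 0 ∧ v < i + 1 ∧ deg v = 1
  inj : ∀ j < s.var 3, ∀ k < s.var 3, s.arr 6 j = s.arr 6 k → j = k
  zero : ∀ k v, 7 ≤ k → s.arr k v = 0

theorem leaf_loop {W M n : ℕ} (hn : 3 ≤ n) (hM : 9 * n * n ≤ M)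
    (hW : M ^ (Program.loop (.less (.var 2) (.var 0)) leafBody).rank < W) {deg sum : ℕ → ℕ}
    {s : State} (hs : Small M s) (h0 : LeafInv n deg sum 0 s) :
    Runs W M (.loop (.less (.var 2) (.var 0)) leafBody) s
      ((n - 1 + 1) * ((Expr.less (.var 2) (.var 0)).cost + 1 + leafBody.cost))
      (LeafInv n deg sum (n - 1)) := by
  have hM2 : 2 ≤ M := by nlinarith
  refine runs_loop hM2 (LeafInv n deg sum) hW ?_ ?_ hs h0
  · intro i hi s hs h
    have hin : 9 * n ≤ M := by nlinarith
    have hle := h.le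
    refine ⟨?_, ?_, ?_⟩
    · simp [Expr.less, Expr.eval, BinOp.eval, h.var0, h.var2]
      omega
    · by_cases hd : deg (i + 1) = 1
      · simp [leafBody, Program.block, stepCounter, Program.Safe, Program.denote, Expr.cell,
          Expr.plus, Expr.equal, Expr.eval, BinOp.eval, State.setVar, State.setArr, h.var2, h.arr4, hd]
        omega
      · simp [leafBody, Program.block, stepCounter, Program.Safe, Program.denote, Expr.cell,
          Expr.plus, Expr.equal, Expr.eval, BinOp.eval, h.var2, h.arr4, hd]
        omega
    · by_cases hd : deg (i + 1) = 1
      · have hden : leafBody.denote s = ((s.setArr 6 (s.var 3) (i + 1)).setVar 3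
            (s.var 3 + 1)).setVar 2 (i + 1 + 1) := by
          simp [leafBody, Program.block, stepCounter, Program.denote, Expr.cell,
            Expr.plus, Expr.equal, Expr.eval, BinOp.eval, State.setVar, State.setArr,
            h.var2, h.arr4, hd]
        rw [hden]
        constructor <;> simp [State.setVar, State.setArr, Function.update_apply, h.var0, h.arr4,
          h.arr5]
        · exact hle
        · intro v
          constructor
          · rintro ⟨j, hj, hv⟩
            split_ifs at hv with hjj
            · subst hv
              omega
            · have := (h.mem v).1 ⟨j, by omega, hv⟩
              omega
          · rintro ⟨h1, h2, h3⟩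
            by_cases hv : v = i + 1
            · exact ⟨s.var 3, by omega, by simp [hv]⟩
            · obtain ⟨j, hj, hjv⟩ := (h.mem v).2 ⟨h1, by omega, h3⟩
              exact ⟨j, by omega, by rw [if_neg (by omega), hjv]⟩
        · intro j hj k hk hjk
          split_ifs at hjk with h1 h2 h2
          · omega
          · have := (h.mem _).1 ⟨k, by omega, hjk.symm⟩
            omega
          · have := (h.mem _).1 ⟨j, by omega, hjk⟩
            omega
          · exact h.inj j (by omega) k (by omega) hjk
        · intro k v hk
          rw [if_neg (by omega), h.zero k v hk]
      · have hden : leafBody.denote s = s.setVar 2 (i + 1 + 1) := by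
          simp [leafBody, Program.block, stepCounter, Program.denote, Expr.cell,
            Expr.plus, Expr.equal, Expr.eval, BinOp.eval, State.setVar, h.var2, h.arr4, hd]
        rw [hden]
        constructor <;> simp [State.setVar, h.var0, h.arr4, h.arr5]
        · omega
        · intro v
          have := h.mem v
          rw [this]
          constructor
          · rintro ⟨h1, h2, h3⟩
            exact ⟨h1, by omega, h3⟩
          · rintro ⟨h1, h2, h3⟩
            refine ⟨h1, ?_, h3⟩
            by_contra h4
            obtain rfl : v = i + 1 := by omega
            exact hd h3
        · exact h.inj
        · exact h.zero
  · intro s hs h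
    simp [Expr.less, Expr.eval, BinOp.eval, h.var0, h.var2]
    omega

end SegmentDrawing

/-! ### Correctness of peeling leaves -/

namespace SegmentDrawing

/-- The memory after the removal of the `i` vertices in `D`. -/
structure PeelInv (n : ℕ) (par : ℕ → ℕ) (D : Finset ℕ) (i : ℕ) (s : State) : Prop where
  var0 : s.var 0 = n
  var2 : s.var 2 = i
  le : i ≤ s.var 3
  lt : ∀ j < s.var 3, s.arr 6 j ≠ 0 ∧ s.arr 6 j < n
  inj : ∀ j < s.var 3, ∀ k < s.var 3, s.arr 6 j = s.arr 6 k → j = k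
  mem_done : ∀ c, c ∈ D ↔ ∃ j < i, s.arr 6 j = c
  card : D.card = i
  mem_queue : ∀ v, (∃ j < s.var 3, s.arr 6 j = v) ↔
    v ≠ 0 ∧ v < n ∧ ∀ c < n, c ≠ 0 → par c = v → c ∈ D
  order : ∀ j < s.var 3, ∀ c < n, c ≠ 0 → par c = s.arr 6 j → ∃ k < j, s.arr 6 k = c
  -- The last term is the edge to the parent, which remains as long as `v` itself; the cells of
  -- removed vertices are not cleared.
  deg : ∀ v < n, s.arr 4 v = (∑ c ∈ Finset.range n, if (c ≠ 0 ∧ par c = v) ∧ c ∉ D then 1 else 0)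
    + if v ≠ 0 then 1 else 0
  sum : ∀ v < n, s.arr 5 v = (∑ c ∈ Finset.range n, if (c ≠ 0 ∧ par c = v) ∧ c ∉ D then c else 0)
    + if v ≠ 0 then par v else 0
  par_done : ∀ u ∈ D, s.arr 7 u = par u
  par_zero : s.arr 7 0 = 0
  d : ∀ v < n, s.arr 8 v
    = ∑ c ∈ Finset.range n, if (c ≠ 0 ∧ par c = v) ∧ c ∈ D then s.arr 8 c + 1 else 0
  -- Each removed vertex is counted below exactly one remaining vertex; this bounds the sizes in
  -- array `8`.
  d_sum : (∑ v ∈ Finset.range n, if True ∧ v ∉ D then s.arr 8 v else 0) = i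
  -- The value `0` can mark a missing heavy child because the root is nobody's child.
  hv : ∀ v < n, (s.arr 9 v = 0 ∧ ∀ c < n, c ≠ 0 → par c = v → c ∉ D) ∨
    (s.arr 9 v ≠ 0 ∧ s.arr 9 v < n ∧ par (s.arr 9 v) = v ∧ s.arr 9 v ∈ D ∧
      (s.arr 8 (s.arr 9 v) = 0 → ∀ c ∈ D, par c = v → s.arr 8 c = 0))
  zero : ∀ k v, 10 ≤ k → s.arr k v = 0

/-- Among the remaining vertices other than the root, a deepest one has all its children removed and
hence is in the queue; so the queue runs empty only when all are removed. -/
theorem PeelInv.lt_queue {n : ℕ} {par dep : ℕ → ℕ} (hdep : ∀ v < n, v ≠ 0 → dep (par v) < dep v)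
    {D : Finset ℕ} {i : ℕ} {s : State} (h : PeelInv n par D i s) (hi : i < n - 1) :
    i < s.var 3 := by
  by_contra hlt
  have hle := h.le
  have hti : s.var 3 = i := by omega
  let S := (Finset.range n).filter fun v => v ≠ 0 ∧ v ∉ D
  have hS : ¬ S.Nonempty := by
    intro hS
    obtain ⟨v, hv, hmax⟩ := S.exists_max_image dep hS
    obtain ⟨h1, h2, h3⟩ := Finset.mem_filter.1 hv
    refine h3 ((h.mem_done v).2 ?_)
    rw [← hti]
    refine (h.mem_queue v).2 ⟨h2, Finset.mem_range.1 h1, fun c hc hc0 hcv => ?_⟩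
    by_contra hcD
    have h4 := hmax c (Finset.mem_filter.2 ⟨Finset.mem_range.2 hc, hc0, hcD⟩)
    have h5 := hdep c hc hc0
    rw [hcv] at h5
    omega
  have hsub : (Finset.range n).erase 0 ⊆ D := by
    intro v hv
    by_contra hvD
    obtain ⟨h1, h2⟩ := Finset.mem_erase.1 hv
    exact hS ⟨v, Finset.mem_filter.2 ⟨h2, h1, hvD⟩⟩
  have := Finset.card_le_card hsub
  rw [Finset.card_erase_of_mem (Finset.mem_range.2 (by omega)), Finset.card_range, h.card] at this
  omega

theorem PeelInv.queue_le {n : ℕ} {par : ℕ → ℕ} {D : Finset ℕ} {i : ℕ} {s : State}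
    (h : PeelInv n par D i s) : s.var 3 + 1 ≤ n ∨ n = 0 := by
  have := Finset.card_le_card_of_injOn (s := Finset.range (s.var 3))
    (t := (Finset.range n).erase 0) (s.arr 6)
    (fun j hj => Finset.mem_coe.2 (Finset.mem_erase.2
      ⟨(h.lt j (by simpa using hj)).1, Finset.mem_range.2 (h.lt j (by simpa using hj)).2⟩))
    (fun j hj k hk hjk => h.inj j (by simpa using hj) k (by simpa using hk) hjk)
  by_cases hn : n = 0
  · exact Or.inr hn
  · rw [Finset.card_erase_of_mem (Finset.mem_range.2 (by omega)), Finset.card_range,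
      Finset.card_range] at this
    omega

set_option maxHeartbeats 2000000 in
/-- The effect of removing the next vertex `u` with parent `p`. -/
theorem peelBody_denote {s : State} {i t u p : ℕ} (h2 : s.var 2 = i) (h3 : s.var 3 = t)
    (hu : s.arr 6 i = u) (hp : s.arr 5 u = p) (hne : u ≠ p) :
    (peelBody.denote s).var 0 = s.var 0 ∧ (peelBody.denote s).var 2 = i + 1 ∧
    (peelBody.denote s).var 3 = (if s.arr 4 p - 1 = 1 ∧ 0 < p then t + 1 else t) ∧
    (peelBody.denote s).arr 4 = Function.update (s.arr 4) p (s.arr 4 p - 1) ∧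
    (peelBody.denote s).arr 5 = Function.update (s.arr 5) p (s.arr 5 p - u) ∧
    (peelBody.denote s).arr 6 = (if s.arr 4 p - 1 = 1 ∧ 0 < p then Function.update (s.arr 6) t p
      else s.arr 6) ∧
    (peelBody.denote s).arr 7 = Function.update (s.arr 7) u p ∧
    (peelBody.denote s).arr 8 = Function.update (s.arr 8) p (s.arr 8 p + (s.arr 8 u + 1)) ∧
    (peelBody.denote s).arr 9 = (if s.arr 9 p = 0 ∨ 0 < s.arr 8 u then Function.update (s.arr 9) p u
      else s.arr 9) ∧
    ∀ k, 10 ≤ k → (peelBody.denote s).arr k = s.arr k := by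
  obtain ⟨q, hq⟩ : ∃ q, s.arr 4 p - 1 = q := ⟨_, rfl⟩
  obtain ⟨r, hr⟩ : ∃ r, s.arr 9 p = r := ⟨_, rfl⟩
  obtain ⟨d, hd⟩ : ∃ d, s.arr 8 u = d := ⟨_, rfl⟩
  have hk : ∀ k, 10 ≤ k → k ≠ 4 ∧ k ≠ 5 ∧ k ≠ 6 ∧ k ≠ 7 ∧ k ≠ 8 ∧ k ≠ 9 := by omega
  rw [hq, hr, hd]
  simp only [peelBody, Program.block, stepCounter, Program.denote, Expr.cell, Expr.plus,
    Expr.minus, Expr.times, Expr.less, Expr.equal, Expr.eval, BinOp.eval]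
  by_cases c1 : r = 0 <;> by_cases c2 : 0 < d <;> by_cases c3 : q = 1 <;> by_cases c4 : 0 < p <;>
    simp +contextual [h2, h3, hu, hp, hne, hq, hr, hd, c1, c2, c3, c4, hk]

theorem peelBody_safe {M : ℕ} {s : State} {i t u p : ℕ} (hs : Small M s) (hM : 9 ≤ M)
    (h2 : s.var 2 = i) (h3 : s.var 3 = t) (hu : s.arr 6 i = u) (hp : s.arr 5 u = p) (hne : u ≠ p)
    (ht : t + 1 ≤ M) (hi : i + 1 ≤ M) (hd : s.arr 8 p + (s.arr 8 u + 1) ≤ M) :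
    peelBody.Safe M s := by
  have g1 := hs.2 6 i
  have g2 := hs.2 5 u
  have g3 := hs.2 4 p
  have g4 := hs.2 5 p
  obtain ⟨q, hq⟩ : ∃ q, s.arr 4 p - 1 = q := ⟨_, rfl⟩
  obtain ⟨r, hr⟩ : ∃ r, s.arr 9 p = r := ⟨_, rfl⟩
  obtain ⟨d, hd'⟩ : ∃ d, s.arr 8 u = d := ⟨_, rfl⟩
  rw [hd'] at hd
  simp only [peelBody, Program.block, stepCounter, Program.Safe, Program.denote, Expr.cell,
    Expr.plus, Expr.minus, Expr.times, Expr.less, Expr.equal, Expr.eval, BinOp.eval]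
  by_cases c1 : r = 0 <;> by_cases c2 : 0 < d <;> by_cases c3 : q = 1 <;> by_cases c4 : 0 < p <;>
    simp [h2, h3, hu, hp, hne, hq, hr, hd', c1, c2, c3, c4] <;> omega

/-- All children of the next queue entry are removed, so its sum of remaining neighbours is its
parent. The parent still remains: it could have entered the queue only after this child was removed.
-/
theorem PeelInv.step {n : ℕ} {par dep : ℕ → ℕ} (hpar : ∀ v < n, par v < n)
    (hdep : ∀ v < n, v ≠ 0 → dep (par v) < dep v) {D : Finset ℕ} {i : ℕ} {s : State}
    (h : PeelInv n par D i s) (hi : i < n - 1) :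
    ∃ u p, s.arr 6 i = u ∧ s.arr 5 u = p ∧ u ≠ p ∧ s.arr 8 p + s.arr 8 u ≤ i ∧
      PeelInv n par (insert u D) (i + 1) (peelBody.denote s) := by
  have hit := h.lt_queue hdep hi
  obtain ⟨u, hu⟩ : ∃ u, s.arr 6 i = u := ⟨_, rfl⟩
  obtain ⟨hu0, hun⟩ := h.lt i hit
  rw [hu] at hu0 hun
  have huD : u ∉ D := fun hD => by
    obtain ⟨j, hj, hju⟩ := (h.mem_done u).1 hD
    have := h.inj j (by omega) i hit (hju.trans hu.symm)
    omega
  have huC := ((h.mem_queue u).1 ⟨i, hit, hu⟩).2.2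
  obtain ⟨p, hp⟩ : ∃ p, par u = p := ⟨_, rfl⟩
  have hpn : p < n := hp ▸ hpar u hun
  have hpu : u ≠ p := fun e => by
    have := hdep u hun hu0
    rw [hp, ← e] at this
    omega
  have hsu : s.arr 5 u = p := by
    rw [h.sum u hun, if_pos hu0, hp, Finset.sum_eq_zero, zero_add]
    intro c hc
    rw [if_neg]
    rintro ⟨⟨h1, h2⟩, h3⟩
    exact h3 (huC c (Finset.mem_range.1 hc) h1 h2)
  have hpD : p ∉ D := fun hD => by
    obtain ⟨j, hj, hjp⟩ := (h.mem_done p).1 hD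
    exact huD (((h.mem_queue p).1 ⟨j, by omega, hjp⟩).2.2 u hun hu0 hp)
  have hdd : s.arr 8 p + s.arr 8 u ≤ i := by
    have h1 := Finset.sum_le_sum_of_subset (f := fun v => if True ∧ v ∉ D then s.arr 8 v else 0)
      (show ({p, u} : Finset ℕ) ⊆ Finset.range n by
        intro x hx
        simp only [Finset.mem_insert, Finset.mem_singleton] at hx
        rcases hx with rfl | rfl <;> simpa)
    rw [h.d_sum, Finset.sum_pair hpu.symm] at h1
    simpa [hpD, huD] using h1
  refine ⟨u, p, hu, hsu, hpu, hdd, ?_⟩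
  obtain ⟨e0, e2, e3, e4, e5, e6, e7, e8, e9, e10⟩ := peelBody_denote h.var2 rfl hu hsu hpu
  set s' := peelBody.denote s with hs'
  have hdeg : ∀ v < n, s'.arr 4 v
      = (∑ c ∈ Finset.range n, if (c ≠ 0 ∧ par c = v) ∧ c ∉ insert u D then 1 else 0)
        + if v ≠ 0 then 1 else 0 := by
    intro v hv
    have h1 := sum_insert_not_mem hun huD (fun c => c ≠ 0 ∧ par c = v) (fun _ => 1)
    have h2 := h.deg v hv
    rw [e4, Function.update_apply]
    by_cases hvp : v = p
    · subst hvp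
      simp only [hu0, hp, ne_eq, not_false_eq_true, and_self, if_true] at h1 h2 ⊢
      omega
    · have : ¬ (u ≠ 0 ∧ par u = v) := fun h' => hvp (h'.2.symm.trans hp)
      simp only [this, if_false] at h1 ⊢
      rw [if_neg hvp]
      omega
  have hsum : ∀ v < n, s'.arr 5 v
      = (∑ c ∈ Finset.range n, if (c ≠ 0 ∧ par c = v) ∧ c ∉ insert u D then c else 0)
        + if v ≠ 0 then par v else 0 := by
    intro v hv
    have h1 := sum_insert_not_mem hun huD (fun c => c ≠ 0 ∧ par c = v) (fun c => c)
    have h2 := h.sum v hv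
    rw [e5, Function.update_apply]
    by_cases hvp : v = p
    · subst hvp
      simp only [hu0, hp, ne_eq, not_false_eq_true, and_self, if_true] at h1 h2 ⊢
      omega
    · have : ¬ (u ≠ 0 ∧ par u = v) := fun h' => hvp (h'.2.symm.trans hp)
      simp only [this, if_false] at h1 ⊢
      rw [if_neg hvp]
      omega
  -- For a vertex other than the root, degree `1` means that only the parent edge remains, so each
  -- vertex is pushed exactly when its last child goes.
  have hpush : (s.arr 4 p - 1 = 1 ∧ 0 < p) ↔
      p ≠ 0 ∧ ∀ c < n, c ≠ 0 → par c = p → c ∈ insert u D := by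
    have h1 := hdeg p hpn
    rw [e4, Function.update_self] at h1
    rw [h1]
    by_cases hp0 : p = 0
    · simp [hp0]
    · simp only [hp0, ne_eq, not_false_eq_true, if_true, true_and, Nat.add_eq_right,
        Nat.pos_of_ne_zero hp0, and_true, Finset.sum_eq_zero_iff, Finset.mem_range]
      refine forall₂_congr fun c hc => ?_
      by_cases hcI : c ∈ insert u D
      · simp [hcI]
      · simp [hcI]
  have hd8 : ∀ c, c ≠ p → s'.arr 8 c = s.arr 8 c := fun c hc => by
    rw [e8, Function.update_of_ne hc]
  have hqueue : ∀ j < s.var 3, s'.arr 6 j = s.arr 6 j := by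
    intro j hj
    rw [e6]
    split_ifs
    · rw [Function.update_of_ne (by omega)]
    · rfl
  have hlen : s.var 3 ≤ s'.var 3 := by
    rw [e3]
    split_ifs <;> omega
  have hnew : ∀ j < s'.var 3, j < s.var 3 ∨ (j = s.var 3 ∧ s'.arr 6 j = p ∧ p ≠ 0 ∧
      ∀ c < n, c ≠ 0 → par c = p → c ∈ insert u D) := by
    intro j hj
    by_cases hjt : j < s.var 3
    · exact Or.inl hjt
    · rw [e3] at hj
      split_ifs at hj with hc
      · obtain rfl : j = s.var 3 := by omega
        refine Or.inr ⟨rfl, ?_, hpush.1 hc⟩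
        rw [e6, if_pos hc, Function.update_self]
      · omega
  have hpQ : ∀ j < s.var 3, s.arr 6 j ≠ p := fun j hj hjp =>
    huD (((h.mem_queue p).1 ⟨j, hj, hjp⟩).2.2 u hun hu0 hp)
  have hdone : ∀ c, c ∈ insert u D ↔ ∃ j < i + 1, s'.arr 6 j = c := by
    intro c
    rw [Finset.mem_insert, h.mem_done]
    constructor
    · rintro (rfl | ⟨j, hj, hjc⟩)
      · exact ⟨i, by omega, (hqueue i hit).trans hu⟩
      · exact ⟨j, by omega, (hqueue j (by omega)).trans hjc⟩
    · rintro ⟨j, hj, hjc⟩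
      rw [hqueue j (by omega)] at hjc
      by_cases hji : j = i
      · subst hji
        exact Or.inl (hjc.symm.trans hu)
      · exact Or.inr ⟨j, by omega, hjc⟩
  constructor
  · exact e0.trans h.var0
  · exact e2
  · omega
  · intro j hj
    rcases hnew j hj with h1 | ⟨h1, h2, h3, h4⟩
    · rw [hqueue j h1]
      exact h.lt j h1
    · rw [h2]
      exact ⟨h3, hpn⟩
  · intro j hj k hk hjk
    rcases hnew j hj with h1 | ⟨h1, h2, h3, h4⟩ <;> rcases hnew k hk with g1 | ⟨g1, g2, g3, g4⟩
    · rw [hqueue j h1, hqueue k g1] at hjk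
      exact h.inj j h1 k g1 hjk
    · rw [g2, hqueue j h1] at hjk
      exact (hpQ j h1 hjk).elim
    · rw [h2, hqueue k g1] at hjk
      exact (hpQ k g1 hjk.symm).elim
    · omega
  · exact hdone
  · rw [Finset.card_insert_of_notMem huD, h.card]
  · intro v
    constructor
    · rintro ⟨j, hj, rfl⟩
      rcases hnew j hj with h1 | ⟨h1, h2, h3, h4⟩
      · rw [hqueue j h1]
        obtain ⟨g1, g2, g3⟩ := (h.mem_queue _).1 ⟨j, h1, rfl⟩
        exact ⟨g1, g2, fun c hc hc0 hcv => Finset.mem_insert_of_mem (g3 c hc hc0 hcv)⟩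
      · rw [h2]
        exact ⟨h3, hpn, h4⟩
    · rintro ⟨g1, g2, g3⟩
      by_cases hvp : v = p
      · subst hvp
        have hc := hpush.2 ⟨g1, g3⟩
        refine ⟨s.var 3, ?_, ?_⟩
        · rw [e3, if_pos hc]
          omega
        · rw [e6, if_pos hc, Function.update_self]
      · obtain ⟨j, hj, hjv⟩ := (h.mem_queue v).2 ⟨g1, g2, fun c hc hc0 hcv => by
          rcases Finset.mem_insert.1 (g3 c hc hc0 hcv) with rfl | hcD
          · exact (hvp (hcv.symm.trans hp)).elim
          · exact hcD⟩
        exact ⟨j, by omega, (hqueue j hj).trans hjv⟩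
  · intro j hj c hc hc0 hcj
    rcases hnew j hj with h1 | ⟨h1, h2, h3, h4⟩
    · rw [hqueue j h1] at hcj
      obtain ⟨k, hk, hkc⟩ := h.order j h1 c hc hc0 hcj
      exact ⟨k, hk, (hqueue k (by omega)).trans hkc⟩
    · rw [h2] at hcj
      obtain ⟨k, hk, hkc⟩ := (hdone c).1 (h4 c hc hc0 hcj)
      exact ⟨k, by omega, hkc⟩
  · exact hdeg
  · exact hsum
  · intro c hc
    rw [e7, Function.update_apply]
    split_ifs with hcu
    · rw [hcu, hp]
    · exact h.par_done c ((Finset.mem_insert.1 hc).resolve_left hcu)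
  · rw [e7, Function.update_of_ne hu0.symm, h.par_zero]
  · intro v hv
    have h1 := sum_insert_mem hun huD (fun c => c ≠ 0 ∧ par c = v) (fun c => s'.arr 8 c + 1)
    rw [h1]
    have h2 : (∑ c ∈ Finset.range n, if (c ≠ 0 ∧ par c = v) ∧ c ∈ D then s'.arr 8 c + 1 else 0)
        = s.arr 8 v := by
      rw [h.d v hv]
      refine Finset.sum_congr rfl fun c _ => ?_
      by_cases hcD : c ∈ D
      · rw [hd8 c (fun e => hpD (e ▸ hcD))]
      · rw [if_neg (fun h' => hcD h'.2), if_neg (fun h' => hcD h'.2)]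
    rw [h2, hd8 u hpu]
    by_cases hvp : v = p
    · subst hvp
      rw [if_pos ⟨hu0, hp⟩, e8, Function.update_self]
    · rw [if_neg (fun h' => hvp (h'.2.symm.trans hp)), hd8 v hvp, add_zero]
  · have h1 := sum_insert_not_mem hun huD (fun _ => True) (fun c => s'.arr 8 c)
    have h2 : (∑ v ∈ Finset.range n, if True ∧ v ∉ D then s'.arr 8 v else 0)
        = (∑ v ∈ Finset.range n, if True ∧ v ∉ D then s.arr 8 v else 0) + (s.arr 8 u + 1) := by
      have h3 : (∑ v ∈ Finset.range n, if v = p then s.arr 8 u + 1 else 0) = s.arr 8 u + 1 := by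
        simp [hpn]
      rw [← h3, ← Finset.sum_add_distrib]
      refine Finset.sum_congr rfl fun v _ => ?_
      by_cases hvp : v = p
      · subst hvp
        simp [hpD, e8]
      · rw [hd8 v hvp, if_neg hvp, add_zero]
    rw [h2, h.d_sum, hd8 u hpu] at h1
    simp only [if_true] at h1
    omega
  · intro v hv
    have hold := h.hv v hv
    by_cases hvp : v = p
    · subst hvp
      right
      rw [e9]
      -- A recorded heavy child is replaced by any child with descendants, so a leaf stays recorded
      -- only while all removed children are leaves.
      by_cases hc : s.arr 9 v = 0 ∨ 0 < s.arr 8 u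
      · rw [if_pos hc, Function.update_self]
        refine ⟨hu0, hun, hp, Finset.mem_insert_self _ _, ?_⟩
        rw [hd8 u hpu]
        intro hz c hcI hcv
        rcases Finset.mem_insert.1 hcI with rfl | hcD
        · rw [hd8 c hpu, hz]
        · exfalso
          obtain ⟨j, hj, hjc⟩ := (h.mem_done c).1 hcD
          have hcn := h.lt j (by omega)
          rw [hjc] at hcn
          exact (hold.resolve_right (fun h' => by
            rcases hc with hc | hc
            · exact h'.1 hc
            · omega)).2 c hcn.2 hcn.1 hcv hcD
      · rw [if_neg hc]
        rw [not_or] at hc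
        obtain ⟨g1, g2, g3, g4, g5⟩ := hold.resolve_left (fun h' => hc.1 h'.1)
        refine ⟨g1, g2, g3, Finset.mem_insert_of_mem g4, ?_⟩
        rw [hd8 _ (fun e => hpD (e ▸ g4))]
        intro hz c hcI hcv
        rcases Finset.mem_insert.1 hcI with rfl | hcD
        · rw [hd8 c hpu]
          omega
        · rw [hd8 c (fun e => hpD (e ▸ hcD))]
          exact g5 hz c hcD hcv
    · have e9' : s'.arr 9 v = s.arr 9 v := by
        rw [e9]
        split_ifs
        · rw [Function.update_of_ne hvp]
        · rfl
      rw [e9']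
      rcases hold with ⟨g1, g2⟩ | ⟨g1, g2, g3, g4, g5⟩
      · refine Or.inl ⟨g1, fun c hc hc0 hcv hcI => ?_⟩
        rcases Finset.mem_insert.1 hcI with rfl | hcD
        · exact hvp (hcv.symm.trans hp)
        · exact g2 c hc hc0 hcv hcD
      · refine Or.inr ⟨g1, g2, g3, Finset.mem_insert_of_mem g4, ?_⟩
        rw [hd8 _ (fun e => hpD (e ▸ g4))]
        intro hz c hcI hcv
        rcases Finset.mem_insert.1 hcI with rfl | hcD
        · exact (hvp (hcv.symm.trans hp)).elim
        · rw [hd8 c (fun e => hpD (e ▸ hcD))]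
          exact g5 hz c hcD hcv
  · intro k v hk
    rw [e10 k hk]
    exact h.zero k v hk

theorem peel_loop {W M n : ℕ} (hn : 3 ≤ n) (hM : 9 * n * n ≤ M)
    (hW : M ^ (Program.loop (.less (.var 2) (.var 3)) peelBody).rank < W) {par dep : ℕ → ℕ}
    (hpar : ∀ v < n, par v < n) (hdep : ∀ v < n, v ≠ 0 → dep (par v) < dep v)
    {s : State} (hs : Small M s) (h0 : PeelInv n par ∅ 0 s) :
    Runs W M (.loop (.less (.var 2) (.var 3)) peelBody) s
      ((n - 1 + 1) * ((Expr.less (.var 2) (.var 3)).cost + 1 + peelBody.cost))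
      (fun s => ∃ D, PeelInv n par D (n - 1) s) := by
  have hM2 : 2 ≤ M := by nlinarith
  refine runs_loop hM2 (fun i s => ∃ D, PeelInv n par D i s) hW ?_ ?_ hs ⟨∅, h0⟩
  · rintro i hi s hs ⟨D, h⟩
    have hin : 9 * n ≤ M := by nlinarith
    obtain ⟨u, p, h1, h2, h3, h4, h5⟩ := h.step hpar hdep hi
    have hq := h.queue_le
    refine ⟨?_, peelBody_safe hs (by omega) h.var2 rfl h1 h2 h3 (by omega) (by omega) (by omega),
      _, h5⟩
    have := h.lt_queue hdep hi
    simp [Expr.less, Expr.eval, BinOp.eval, h.var2, this]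
  · rintro s hs ⟨D, h⟩
    have := h.queue_le
    simp [Expr.less, Expr.eval, BinOp.eval, h.var2]
    omega

/-- The heavy tree that the removal of all vertices computes, and the order of the queue. -/
theorem PeelInv.exists_tree {n : ℕ} (hn : 3 ≤ n) {par dep : ℕ → ℕ} (hpar0 : par 0 = 0)
    (hpar : ∀ v < n, par v < n) (hdep : ∀ v < n, v ≠ 0 → dep (par v) < dep v) {D : Finset ℕ}
    {s : State} (h : PeelInv n par D (n - 1) s) :
    ∃ T : HeavyTree, T.n = n ∧ T.par = s.arr 7 ∧ T.d = s.arr 8 ∧ T.hv = s.arr 9 ∧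
      (∀ v < n, T.par v = par v) ∧
      (∀ v < n, v ≠ 0 → ∃ j < n - 1, s.arr 6 j = v) ∧
      (∀ j < n - 1, s.arr 6 j ≠ 0 ∧ s.arr 6 j < n) ∧
      (∀ j < n - 1, ∀ k < n - 1, s.arr 6 j = s.arr 6 k → j = k) ∧
      ∀ j < n - 1, ∀ c < n, c ≠ 0 → T.par c = s.arr 6 j → ∃ k < j, s.arr 6 k = c := by
  have hle := h.le
  have hsub : D ⊆ (Finset.range n).erase 0 := by
    intro c hc
    obtain ⟨j, hj, rfl⟩ := (h.mem_done c).1 hc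
    have := h.lt j (by omega)
    exact Finset.mem_erase.2 ⟨this.1, Finset.mem_range.2 this.2⟩
  -- There are `n - 1` removed vertices and none is the root, so all others are removed.
  have hD : D = (Finset.range n).erase 0 := by
    refine Finset.eq_of_subset_of_card_le hsub ?_
    rw [Finset.card_erase_of_mem (Finset.mem_range.2 (by omega)), Finset.card_range, h.card]
  have hmem : ∀ c, c < n → c ≠ 0 → c ∈ D := fun c hc h0 => by
    rw [hD]
    exact Finset.mem_erase.2 ⟨h0, Finset.mem_range.2 hc⟩
  have hparv : ∀ v < n, s.arr 7 v = par v := by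
    intro v hv
    by_cases h0 : v = 0
    · rw [h0, h.par_zero, hpar0]
    · exact h.par_done v (hmem v hv h0)
  have hdeq : ∀ v < n, s.arr 8 v = ∑ c ∈ Finset.range n,
      if c ≠ 0 ∧ s.arr 7 c = v then s.arr 8 c + 1 else 0 := by
    intro v hv
    conv_lhs => rw [h.d v hv]
    refine Finset.sum_congr rfl fun c hc => ?_
    rw [hparv c (Finset.mem_range.1 hc)]
    by_cases h0 : c = 0
    · simp [h0]
    · simp [h0, hmem c (Finset.mem_range.1 hc) h0]
  refine ⟨{ n := n, par := s.arr 7, dep := dep, d := s.arr 8, hv := s.arr 9, three_le := hn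
            par_zero := h.par_zero
            par_lt := fun v hv => hparv v hv ▸ hpar v hv
            dep_par := fun v hv h0 => (hparv v hv).symm ▸ hdep v hv h0
            d_eq := hdeq
            hv_spec := ?_ }, rfl, rfl, rfl, rfl, hparv, ?_, ?_, ?_, ?_⟩
  · intro v hv hz
    rcases h.hv v hv with ⟨h1, h2⟩ | ⟨h1, h2, h3, h4, h5⟩
    · refine (hz ?_).elim
      rw [hdeq v hv]
      refine Finset.sum_eq_zero fun c hc => if_neg ?_
      rintro ⟨h3, h4⟩
      rw [hparv c (Finset.mem_range.1 hc)] at h4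
      exact h2 c (Finset.mem_range.1 hc) h3 h4 (hmem c (Finset.mem_range.1 hc) h3)
    · refine ⟨h1, h2, (hparv _ h2).trans h3, fun hz c hc h0 hcv => ?_⟩
      exact h5 hz c (hmem c hc h0) ((hparv c hc).symm.trans hcv)
  · intro v hv h0
    exact (h.mem_done v).1 (hmem v hv h0)
  · exact fun j hj => h.lt j (by omega)
  · exact fun j hj k hk => h.inj j (by omega) k (by omega)
  · intro j hj c hc h0 hcj
    exact h.order j (by omega) c hc h0 ((hparv c hc).symm.trans hcj)

end SegmentDrawing

namespace SegmentDrawing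

/-! ### The program: classification of the vertices -/

/-- Tabulate a half and classify the next vertex as heavy child, twig or branch. -/
def classBody : Program := .block
  [.store 15 (.plus (.var 2) (.lit 1)) (.plus (.get 15 (.minus (.var 2) (.lit 1))) (.lit 1)),
    .assign 5 (.cell 7 2),
    .cond (.equal (.cell 9 5) (.var 2)) .nop
      (.cond (.less (.cell 8 2) (.lit 2))
        (.block [.store 16 (.var 2) (.lit 1), .store 10 (.var 2) (.cell 11 5),
          .store 11 (.var 5) (.plus (.cell 11 5) (.lit 1)),
          .store 12 (.var 5) (.plus (.cell 12 5) (.plus (.cell 8 2) (.lit 1)))])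
        (.block [.store 13 (.var 2) (.cell 14 5),
          .store 14 (.var 5) (.plus (.cell 14 5) (.plus (.cell 8 2) (.lit 1)))])),
    stepCounter]

/-- The tables that the placement reads, after the classification of the vertices below `k`. -/
structure Tables (T : HeavyTree) (ord : ℕ → ℕ) (k : ℕ) (s : State) : Prop where
  var0 : s.var 0 = T.n
  arr6 : s.arr 6 = ord
  arr7 : s.arr 7 = T.par
  arr8 : s.arr 8 = T.d
  arr9 : s.arr 9 = T.hv
  rank : ∀ c < k, T.Twig c → s.arr 10 c = T.rank c
  twigs : ∀ v, s.arr 11 v = ∑ c ∈ Finset.range k, if T.Twig c ∧ T.par c = v then 1 else 0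
  own : ∀ v, s.arr 12 v = ∑ c ∈ Finset.range k, if T.Twig c ∧ T.par c = v then T.d c + 1 else 0
  off : ∀ c < k, T.Branch c → s.arr 13 c = T.off c
  branchSum : ∀ v, s.arr 14 v
    = ∑ c ∈ Finset.range k, if T.Branch c ∧ T.par c = v then T.d c + 1 else 0
  half : ∀ j ≤ k, s.arr 15 j = j / 2
  mark : ∀ c, s.arr 16 c = if c < k ∧ T.Twig c then 1 else 0

/-- Placement writes only the arrays `2`, `3` and `17`, so it cannot disturb the tables. -/
theorem Tables.congr {T : HeavyTree} {ord : ℕ → ℕ} {k : ℕ} {s s' : State} (h : Tables T ord k s)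
    (h0 : s'.var 0 = s.var 0) (ha : ∀ a, a ≠ 2 → a ≠ 3 → a ≠ 17 → s'.arr a = s.arr a) :
    Tables T ord k s' := by
  have h6 := ha 6 (by omega) (by omega) (by omega)
  have h7 := ha 7 (by omega) (by omega) (by omega)
  have h8 := ha 8 (by omega) (by omega) (by omega)
  have h9 := ha 9 (by omega) (by omega) (by omega)
  have h10 := ha 10 (by omega) (by omega) (by omega)
  have h11 := ha 11 (by omega) (by omega) (by omega)
  have h12 := ha 12 (by omega) (by omega) (by omega)
  have h13 := ha 13 (by omega) (by omega) (by omega)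
  have h14 := ha 14 (by omega) (by omega) (by omega)
  have h15 := ha 15 (by omega) (by omega) (by omega)
  have h16 := ha 16 (by omega) (by omega) (by omega)
  exact ⟨h0.trans h.var0, h6 ▸ h.arr6, h7 ▸ h.arr7, h8 ▸ h.arr8, h9 ▸ h.arr9, h10 ▸ h.rank,
    h11 ▸ h.twigs, h12 ▸ h.own, h13 ▸ h.off, h14 ▸ h.branchSum, h15 ▸ h.half, h16 ▸ h.mark⟩

namespace HeavyTree

theorem d_lt {T : HeavyTree} {v : ℕ} (hv : v < T.n) : T.d v < T.n := by
  induction hk : T.dep v using Nat.strong_induction_on generalizing v with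
  | _ k ih =>
    by_cases h0 : v = 0
    · subst h0
      have := T.d_root
      omega
    · have h1 := ih _ (hk ▸ T.dep_par v hv h0) (T.par_lt v hv) rfl
      have h2 := d_child hv h0
      omega

theorem par_ne {T : HeavyTree} {v : ℕ} (hv : v < T.n) (h0 : v ≠ 0) : T.par v ≠ v := fun h => by
  have := T.dep_par v hv h0
  rw [h] at this
  omega

end HeavyTree

/-- Rank and offset are prefix sums over smaller vertices. Since vertices are visited in numerical
order, they are the current values of the counters at the parent. -/
theorem Tables.class_step {M : ℕ} {T : HeavyTree} {ord : ℕ → ℕ} {u : ℕ} {s : State}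
    (hM : 9 * T.n ≤ M) (h : Tables T ord u s) (hu : u < T.n) (hu0 : u ≠ 0)
    (h2 : s.var 2 = u) :
    classBody.Safe M s ∧ (classBody.denote s).var 2 = u + 1 ∧
      (classBody.denote s).arr 17 = s.arr 17 ∧ Tables T ord (u + 1) (classBody.denote s) := by
  obtain ⟨p, hp⟩ : ∃ p, T.par u = p := ⟨_, rfl⟩
  have hpn : p < T.n := hp ▸ T.par_lt u hu
  have hpu : p ≠ u := hp ▸ HeavyTree.par_ne hu hu0
  have hn := T.three_le
  have hdu := HeavyTree.d_lt hu
  have hdp := HeavyTree.d_lt hpn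
  have hop := HeavyTree.own_le hpn
  have hcu := HeavyTree.d_child hu hu0
  have hsp := HeavyTree.d_split hpn (by rw [hp] at hcu; omega)
  -- The machine has no division; halves are tabulated by `(u + 1) / 2 = (u - 1) / 2 + 1`.
  have hhalf : ∀ j ≤ u + 1, (if j = u + 1 then s.arr 15 (u - 1) + 1 else s.arr 15 j) = j / 2 := by
    intro j hj
    split_ifs with hju
    · rw [h.half _ (by omega)]
      omega
    · exact h.half j (by omega)
  have hh := h.half (u - 1) (by omega)
  by_cases hhv : T.hv p = u
  · have ht : ¬ T.Twig u := fun h' => h'.2.1 (by rw [hp, hhv])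
    have hb : ¬ T.Branch u := fun h' => h'.2.1 (by rw [hp, hhv])
    refine ⟨?_, ?_, ?_, ?_⟩
    · simp [classBody, Program.block, stepCounter, Program.Safe, Program.denote, Expr.cell, Expr.plus,
        Expr.minus, Expr.equal, Expr.eval, BinOp.eval, h2, h.arr7, h.arr9, hp, hhv]
      omega
    · simp [classBody, Program.block, stepCounter, Program.denote, Expr.cell, Expr.plus,
        Expr.minus, Expr.equal, Expr.eval, BinOp.eval, h2, h.arr7, h.arr9, hp, hhv]
    · simp [classBody, Program.block, stepCounter, Program.denote, Expr.cell, Expr.plus,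
        Expr.minus, Expr.equal, Expr.eval, BinOp.eval, h2, h.arr7, h.arr9, hp, hhv]
    · have hden : classBody.denote s = ((s.setArr 15 (u + 1) (s.arr 15 (u - 1) + 1)).setVar 5
          p).setVar 2 (u + 1) := by
        simp [classBody, Program.block, stepCounter, Program.denote, Expr.cell, Expr.plus,
          Expr.minus, Expr.equal, Expr.eval, BinOp.eval, h2, h.arr7, h.arr9, hp, hhv]
      rw [hden]
      constructor <;> simp [-Finset.sum_boole, h.var0, h.arr6, h.arr7, h.arr8, h.arr9, Finset.sum_range_succ, ht, hb,
        h.twigs, h.own, h.branchSum, Function.update_apply]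
      · intro c hc hct
        by_cases hcu : c = u
        · exact (ht (hcu ▸ hct)).elim
        · exact h.rank c (by omega) hct
      · intro c hc hct
        by_cases hcu : c = u
        · exact (hb (hcu ▸ hct)).elim
        · exact h.off c (by omega) hct
      · exact hhalf
      · intro c
        rw [h.mark c]
        refine if_congr ⟨fun h' => ⟨by omega, h'.2⟩, fun h' => ⟨?_, h'.2⟩⟩ rfl rfl
        have : c ≠ u := fun e => ht (e ▸ h'.2)
        omega
  by_cases hd : T.d u < 2
  · have ht : T.Twig u := ⟨hu0, by rwa [hp], hd⟩
    have hb : ¬ T.Branch u := fun h' => by have := h'.2.2; omega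
    have hr : s.arr 11 p = T.rank u := by rw [h.twigs, HeavyTree.rank, hp]
    have hrl := HeavyTree.rank_lt hu ht
    have htw := T.twigs_le_own p
    have ho : s.arr 12 p + (T.d u + 1) ≤ T.own p := by
      have h1 : ∑ c ∈ Finset.range (u + 1), (if T.Twig c ∧ T.par c = p then T.d c + 1 else 0)
          ≤ T.own p := Finset.sum_le_sum_of_subset (Finset.range_subset_range.2 hu)
      rwa [Finset.sum_range_succ, if_pos ⟨ht, hp⟩, ← h.own] at h1
    rw [hp] at hrl
    refine ⟨?_, ?_, ?_, ?_⟩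
    · simp [classBody, Program.block, stepCounter, Program.Safe, Program.denote, Expr.cell, Expr.plus,
        Expr.minus, Expr.equal, Expr.less, Expr.eval, BinOp.eval, h2, h.arr7, h.arr8, h.arr9, hp, hhv,
        hd]
      omega
    · simp [classBody, Program.block, stepCounter, Program.denote, Expr.cell, Expr.plus,
        Expr.minus, Expr.equal, Expr.less, Expr.eval, BinOp.eval, h2, h.arr7, h.arr8, h.arr9, hp, hhv,
        hd]
    · simp [classBody, Program.block, stepCounter, Program.denote, Expr.cell, Expr.plus,
        Expr.minus, Expr.equal, Expr.less, Expr.eval, BinOp.eval, h2, h.arr7, h.arr8, h.arr9, hp, hhv,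
        hd]
    · have hden : classBody.denote s = ((((((s.setArr 15 (u + 1) (s.arr 15 (u - 1) + 1)).setVar 5
          p).setArr 16 u 1).setArr 10 u (s.arr 11 p)).setArr 11 p (s.arr 11 p + 1)).setArr 12 p
          (s.arr 12 p + (T.d u + 1))).setVar 2 (u + 1) := by
        simp [classBody, Program.block, stepCounter, Program.denote, Expr.cell, Expr.plus,
          Expr.minus, Expr.equal, Expr.less, Expr.eval, BinOp.eval, h2, h.arr7, h.arr8, h.arr9, hp,
          hhv, hd]
      rw [hden]
      constructor <;> simp [-Finset.sum_boole, h.var0, h.arr6, h.arr7, h.arr8, h.arr9, Finset.sum_range_succ, ht, hb,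
        h.branchSum, Function.update_apply, hp]
      · intro c hc hct
        split_ifs with hcu
        · rw [hcu, hr]
        · exact h.rank c (by omega) hct
      · intro v
        rw [← h.twigs v]
        by_cases hvp : v = p
        · simp [hvp]
        · simp [hvp, Ne.symm hvp]
      · intro v
        rw [← h.own v]
        by_cases hvp : v = p
        · simp [hvp]
        · simp [hvp, Ne.symm hvp]
      · intro c hc hct
        by_cases hcu : c = u
        · exact (hb (hcu ▸ hct)).elim
        · exact h.off c (by omega) hct
      · exact hhalf
      · intro c
        rw [h.mark c]
        by_cases hcu : c = u
        · simp [hcu, ht]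
        · rw [if_neg hcu]
          refine if_congr ⟨fun h' => ⟨by omega, h'.2⟩, fun h' => ⟨by omega, h'.2⟩⟩ rfl rfl
  · have ht : ¬ T.Twig u := fun h' => hd h'.2.2
    have hb : T.Branch u := ⟨hu0, by rwa [hp], by omega⟩
    have hr : s.arr 14 p = T.off u := by rw [h.branchSum, HeavyTree.off, hp]
    have hrl := HeavyTree.off_add_le hu hb
    rw [hp] at hrl
    refine ⟨?_, ?_, ?_, ?_⟩
    · simp [classBody, Program.block, stepCounter, Program.Safe, Program.denote, Expr.cell, Expr.plus,
        Expr.minus, Expr.equal, Expr.less, Expr.eval, BinOp.eval, h2, h.arr7, h.arr8, h.arr9, hp, hhv,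
        hd]
      omega
    · simp [classBody, Program.block, stepCounter, Program.denote, Expr.cell, Expr.plus,
        Expr.minus, Expr.equal, Expr.less, Expr.eval, BinOp.eval, h2, h.arr7, h.arr8, h.arr9, hp, hhv,
        hd]
    · simp [classBody, Program.block, stepCounter, Program.denote, Expr.cell, Expr.plus,
        Expr.minus, Expr.equal, Expr.less, Expr.eval, BinOp.eval, h2, h.arr7, h.arr8, h.arr9, hp, hhv,
        hd]
    · have hden : classBody.denote s = ((((s.setArr 15 (u + 1) (s.arr 15 (u - 1) + 1)).setVar 5
          p).setArr 13 u (s.arr 14 p)).setArr 14 p (s.arr 14 p + (T.d u + 1))).setVar 2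
          (u + 1) := by
        simp [classBody, Program.block, stepCounter, Program.denote, Expr.cell, Expr.plus,
          Expr.minus, Expr.equal, Expr.less, Expr.eval, BinOp.eval, h2, h.arr7, h.arr8, h.arr9, hp,
          hhv, hd]
      rw [hden]
      constructor <;> simp [-Finset.sum_boole, h.var0, h.arr6, h.arr7, h.arr8, h.arr9, Finset.sum_range_succ, ht, hb,
        h.twigs, h.own, Function.update_apply, hp]
      · intro c hc hct
        by_cases hcu : c = u
        · exact (ht (hcu ▸ hct)).elim
        · exact h.rank c (by omega) hct
      · intro c hc hct
        split_ifs with hcu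
        · rw [hcu, hr]
        · exact h.off c (by omega) hct
      · intro v
        rw [← h.branchSum v]
        by_cases hvp : v = p
        · simp [hvp]
        · simp [hvp, Ne.symm hvp]
      · exact hhalf
      · intro c
        rw [h.mark c]
        refine if_congr ⟨fun h' => ⟨by omega, h'.2⟩, fun h' => ⟨?_, h'.2⟩⟩ rfl rfl
        have : c ≠ u := fun e => ht (e ▸ h'.2)
        omega

theorem class_loop {W M : ℕ} {T : HeavyTree} {ord : ℕ → ℕ} (hM : 9 * T.n * T.n ≤ M)
    (hW : M ^ (Program.loop (.less (.var 2) (.var 0)) classBody).rank < W) {s : State}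
    (hs : Small M s) (h0 : Tables T ord 1 s) (h2 : s.var 2 = 1) (h17 : ∀ v, s.arr 17 v = 0) :
    Runs W M (.loop (.less (.var 2) (.var 0)) classBody) s
      ((T.n - 1 + 1) * ((Expr.less (.var 2) (.var 0)).cost + 1 + classBody.cost))
      (fun s => Tables T ord T.n s ∧ ∀ v, s.arr 17 v = 0) := by
  have hn := T.three_le
  have hM2 : 2 ≤ M := by nlinarith
  have hM9 : 9 * T.n ≤ M := by nlinarith
  have key : Runs W M (.loop (.less (.var 2) (.var 0)) classBody) s
      ((T.n - 1 + 1) * ((Expr.less (.var 2) (.var 0)).cost + 1 + classBody.cost))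
      (fun s => Tables T ord (T.n - 1 + 1) s ∧ s.var 2 = T.n - 1 + 1 ∧ ∀ v, s.arr 17 v = 0) := by
    refine runs_loop hM2
      (fun i s => Tables T ord (i + 1) s ∧ s.var 2 = i + 1 ∧ ∀ v, s.arr 17 v = 0) hW ?_ ?_ hs
      ⟨h0, h2, h17⟩
    · rintro i hi s hs ⟨g1, g2, g3⟩
      obtain ⟨e1, e2, e3, e4⟩ := g1.class_step hM9 (by omega) (by omega) g2
      refine ⟨?_, e1, e4, e2, fun v => by rw [e3, g3]⟩
      simp [Expr.less, Expr.eval, BinOp.eval, g1.var0, g2]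
      omega
    · rintro s hs ⟨g1, g2, g3⟩
      simp [Expr.less, Expr.eval, BinOp.eval, g1.var0, g2]
      omega
  obtain ⟨t, s', h1, h3, h4, h5, h6, h7⟩ := key
  refine ⟨t, s', h1, h3, h4, ?_, h7⟩
  rwa [show T.n - 1 + 1 = T.n by omega] at h5

end SegmentDrawing

namespace SegmentDrawing

/-! ### The program: placement of the vertices -/

/-- The row of a vertex of the spine. -/
def rowExpr : Expr :=
  .plus (.minus (.plus (.cell 17 4) (.cell 8 4)) (.cell 12 4)) (.get 15 (.cell 11 4))

/-- Place a vertex of the spine, given the expressions for its lowest row and its column. -/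
def placeSpine (l x : Expr) : Program := .block
  [.store 17 (.var 4) l, .store 2 (.var 4) x, .store 3 (.var 4) rowExpr]

/-- Place the leaf of a twig. -/
def placeLeaf : Program := .block
  [.store 17 (.var 4) (.lit 0),
    .store 3 (.var 4) (.plus (.cell 3 5) (.equal (.cell 2 5) (.cell 2 7))),
    .store 2 (.var 4) (.minus (.times (.lit 2) (.cell 2 5)) (.cell 2 7))]

/-- Place a vertex at given coordinates. -/
def placeAt (x y : Expr) : Program := .block [.store 2 (.var 4) x, .store 3 (.var 4) y]

/-- Place a twig. -/
def placeTwig : Program := .block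
  [.store 17 (.var 4) (.lit 0),
    .assign 6 (.plus (.cell 10 4) (.equal (.cell 9 7) (.var 5))),
    .cond (.equal (.var 6) (.lit 0))
      (placeAt (.cell 2 5) (.plus (.cell 3 5) (.lit 1)))
      -- Parity test: the slot is even if it is twice its tabulated half.
      (.cond (.equal (.times (.lit 2) (.cell 15 6)) (.var 6))
        (placeAt (.plus (.cell 2 5) (.lit 1)) (.minus (.plus (.cell 3 5) (.cell 15 6)) (.lit 1)))
        (placeAt (.minus (.cell 2 5) (.lit 1)) (.minus (.cell 3 5) (.cell 15 6))))]

def placeHeavy : Program := placeSpine (.cell 17 5) (.cell 2 5)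

def placeBranch : Program := placeSpine
  (.plus (.plus (.plus (.cell 17 5) (.get 8 (.cell 9 5))) (.lit 1)) (.cell 13 4))
  (.plus (.plus (.plus (.cell 2 5) (.get 8 (.cell 9 5))) (.cell 13 4)) (.lit 2))

/-- Place the vertex in variable `4` with parent and grandparent in the variables `5` and `7`. -/
def placeVertex : Program :=
  .cond (.equal (.cell 9 5) (.var 4))
    -- The leaf of a twig is the heavy child of the twig, so it is recognised in this case.
    (.cond (.cell 16 5) placeLeaf placeHeavy)
    (.cond (.cell 16 4) placeTwig placeBranch)

/-- Place the next vertex, in the reverse order of the queue. -/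
def placeBody : Program := .block
  [.assign 4 (.get 6 (.minus (.minus (.var 0) (.lit 2)) (.var 2))), .assign 5 (.cell 7 4),
    .assign 7 (.cell 7 5), placeVertex, stepCounter]

/-- The vertex `u` gets the lowest row `l` and the coordinates `x`, `y`, and nothing else that is
still needed changes. -/
structure Placed (u l x y : ℕ) (s s' : State) : Prop where
  var0 : s'.var 0 = s.var 0
  var2 : s'.var 2 = s.var 2
  arr17 : s'.arr 17 = Function.update (s.arr 17) u l
  arr2 : s'.arr 2 = Function.update (s.arr 2) u x
  arr3 : s'.arr 3 = Function.update (s.arr 3) u y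
  arr : ∀ a, a ≠ 2 → a ≠ 3 → a ≠ 17 → s'.arr a = s.arr a

theorem placeSpine_spec {M u l x y : ℕ} {s : State} {el ex : Expr} (h4 : s.var 4 = u)
    (hl : el.eval s = l) (hx : ex.eval (s.setArr 17 u l) = x)
    (hy : y = l + s.arr 8 u - s.arr 12 u + s.arr 15 (s.arr 11 u)) (hlM : l ≤ M) (hxM : x ≤ M)
    (hyM : y ≤ M) :
    (placeSpine el ex).Safe M s ∧ Placed u l x y s ((placeSpine el ex).denote s) := by
  constructor
  · simp [placeSpine, rowExpr, Program.block, Program.Safe, Program.denote, Expr.cell, Expr.plus,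
      Expr.minus, Expr.eval, BinOp.eval, h4, hl, hx, hlM, hxM]
    omega
  · constructor <;> simp +contextual [placeSpine, rowExpr, Program.block, Program.denote, Expr.cell,
      Expr.plus, Expr.minus, Expr.eval, BinOp.eval, h4, hl, hx, hy]

theorem placeLeaf_spec {M u p q x y : ℕ} {s : State} (h4 : s.var 4 = u) (h5 : s.var 5 = p)
    (h7 : s.var 7 = q) (hx : x = 2 * s.arr 2 p - s.arr 2 q)
    (hy : y = s.arr 3 p + if s.arr 2 p = s.arr 2 q then 1 else 0) (hxM : x ≤ M) (hyM : y ≤ M) :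
    placeLeaf.Safe M s ∧ Placed u 0 x y s (placeLeaf.denote s) := by
  constructor
  · simp [placeLeaf, Program.block, Program.Safe, Program.denote, Expr.cell, Expr.plus,
      Expr.minus, Expr.times, Expr.equal, Expr.eval, BinOp.eval, h4, h5, h7, ← hx, ← hy, hxM, hyM]
  · constructor <;> simp +contextual [placeLeaf, Program.block, Program.denote, Expr.cell, Expr.plus,
      Expr.minus, Expr.times, Expr.equal, Expr.eval, BinOp.eval, h4, h5, h7, hx, hy]

theorem placeTwig_spec {M u p q j x y : ℕ} {s : State} (h4 : s.var 4 = u) (h5 : s.var 5 = p)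
    (h7 : s.var 7 = q) (hj : s.arr 10 u + (if s.arr 9 q = p then 1 else 0) = j)
    (hh : s.arr 15 j = j / 2)
    (h0 : j = 0 → x = s.arr 2 p ∧ y = s.arr 3 p + 1)
    (hodd : j % 2 = 1 → x = s.arr 2 p - 1 ∧ y = s.arr 3 p - j / 2)
    (heven : j ≠ 0 → j % 2 = 0 → x = s.arr 2 p + 1 ∧ y = s.arr 3 p + j / 2 - 1)
    (hjM : j ≤ M) (hxM : x ≤ M) (hyM : y ≤ M) :
    placeTwig.Safe M s ∧ Placed u 0 x y s (placeTwig.denote s) := by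
  by_cases c0 : j = 0
  · obtain ⟨rfl, rfl⟩ := h0 c0
    constructor
    · simp [placeTwig, placeAt, Program.block, Program.Safe, Program.denote, Expr.cell, Expr.plus,
        Expr.minus, Expr.times, Expr.equal, Expr.eval, BinOp.eval, h4, h5, h7, hj, c0, hxM, hyM]
    · constructor <;> simp +contextual [placeTwig, placeAt, Program.block, Program.denote, Expr.cell,
        Expr.plus, Expr.minus, Expr.times, Expr.equal, Expr.eval, BinOp.eval, h4, h5, h7, hj, c0]
  by_cases c1 : 2 * (j / 2) = j
  · obtain ⟨rfl, rfl⟩ := heven c0 (by omega)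
    constructor
    · simp [placeTwig, placeAt, Program.block, Program.Safe, Program.denote, Expr.cell, Expr.plus,
        Expr.minus, Expr.times, Expr.equal, Expr.eval, BinOp.eval, h4, h5, h7, hj, c0, hh, c1, hxM, hjM]
      omega
    · constructor <;> simp +contextual [placeTwig, placeAt, Program.block, Program.denote, Expr.cell,
        Expr.plus, Expr.minus, Expr.times, Expr.equal, Expr.eval, BinOp.eval, h4, h5, h7, hj, c0, hh,
        c1]
  · obtain ⟨rfl, rfl⟩ := hodd (by omega)
    constructor
    · simp [placeTwig, placeAt, Program.block, Program.Safe, Program.denote, Expr.cell, Expr.plus,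
        Expr.minus, Expr.times, Expr.equal, Expr.eval, BinOp.eval, h4, h5, h7, hj, c0, hh, c1, hjM]
      omega
    · constructor <;> simp +contextual [placeTwig, placeAt, Program.block, Program.denote, Expr.cell,
        Expr.plus, Expr.minus, Expr.times, Expr.equal, Expr.eval, BinOp.eval, h4, h5, h7, hj, c0, hh,
        c1]

theorem Tables.row_eq {T : HeavyTree} {ord : ℕ → ℕ} {s : State} (h : Tables T ord T.n s) {u : ℕ}
    (hu : u < T.n) (l : ℕ) :
    l + s.arr 8 u - s.arr 12 u + s.arr 15 (s.arr 11 u) = l + T.d u - T.own u + T.twigs u / 2 := by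
  have h1 : s.arr 11 u = T.twigs u := h.twigs u
  have h2 : s.arr 12 u = T.own u := h.own u
  have := HeavyTree.d_lt hu
  have := HeavyTree.own_le hu
  have := T.twigs_le_own u
  rw [h1, h2, h.arr8, h.half _ (by omega)]

/-- The crude growth by at most `4 * T.n` per vertex bounds the words without any of the geometry.
-/
theorem placeVertex_spec {M B : ℕ} {T : HeavyTree} {ord : ℕ → ℕ} {s : State}
    (h : Tables T ord T.n s) {u : ℕ} (hu : u < T.n) (hu0 : u ≠ 0) (h4 : s.var 4 = u)
    (h5 : s.var 5 = T.par u) (h7 : s.var 7 = T.par (T.par u)) {l' y' : ℕ}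
    (hp : T.EqAt (s.arr 17) (s.arr 2) (s.arr 3) (T.par u) l' (s.arr 2 (T.par u)) y')
    (hb17 : s.arr 17 (T.par u) ≤ B) (hb2 : s.arr 2 (T.par u) ≤ B) (hb3 : s.arr 3 (T.par u) ≤ B)
    (hBM : B + 4 * T.n ≤ M) :
    ∃ l x y, T.EqAt (s.arr 17) (s.arr 2) (s.arr 3) u l x y ∧ l ≤ B + 4 * T.n ∧ x ≤ B + 4 * T.n ∧
      y ≤ B + 4 * T.n ∧ placeVertex.Safe M s ∧ Placed u l x y s (placeVertex.denote s) := by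
  have hpn := T.par_lt u hu
  have hdu := HeavyTree.d_lt hu
  have hou := HeavyTree.own_le hu
  have htu := T.twigs_le_own u
  have hdp := HeavyTree.d_lt hpn
  have hop := HeavyTree.own_le hpn
  have htp := T.twigs_le_own (T.par u)
  have hcu := HeavyTree.d_child hu hu0
  have hsp := HeavyTree.d_split hpn (by omega)
  have hmu := h.mark u
  have hmp := h.mark (T.par u)
  simp only [hu, hpn, true_and] at hmu hmp
  have hsafe : ∀ q : Program, q.Safe M s →
      ((if T.hv (T.par u) = u then (if T.Twig (T.par u) then placeLeaf else placeHeavy)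
        else (if T.Twig u then placeTwig else placeBranch)) = q) → placeVertex.Safe M s := by
    rintro q hq rfl
    simp only [placeVertex, Program.Safe, Expr.equal, Expr.cell, Expr.eval, BinOp.eval, h4, h5,
      h.arr9, hmu, hmp]
    split_ifs at hq ⊢ <;> simp_all
  have hden : ∀ q : Program,
      ((if T.hv (T.par u) = u then (if T.Twig (T.par u) then placeLeaf else placeHeavy)
        else (if T.Twig u then placeTwig else placeBranch)) = q) →
      placeVertex.denote s = q.denote s := by
    rintro q rfl
    simp only [placeVertex, Program.denote, Expr.equal, Expr.cell, Expr.eval, BinOp.eval, h4, h5,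
      h.arr9, hmu, hmp]
    split_ifs <;> simp_all
  by_cases hh : T.hv (T.par u) = u
  · have ht : ¬ T.Twig u := fun h' => h'.2.1 hh
    have hb : ¬ T.Branch u := fun h' => h'.2.1 hh
    by_cases hpt : T.Twig (T.par u)
    · have hns : ¬ T.Spine u := fun h' => h'.2 ⟨hu0, hpt⟩
      obtain ⟨x, hx⟩ : ∃ x, x = 2 * s.arr 2 (T.par u) - s.arr 2 (T.par (T.par u)) := ⟨_, rfl⟩
      obtain ⟨y, hy⟩ : ∃ y, y = s.arr 3 (T.par u) +
        if s.arr 2 (T.par u) = s.arr 2 (T.par (T.par u)) then 1 else 0 := ⟨_, rfl⟩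
      have hxB : x ≤ B + 4 * T.n := by
        -- The equations of the twig itself keep `2 * X p - X q` from doubling the bound.
        have h1 : s.arr 2 (T.par u) ≤ s.arr 2 (T.par (T.par u)) + 1 := by
          by_cases c0 : T.slot (T.par u) = 0
          · have := hp.twig_zero hpt c0
            omega
          · rcases Nat.mod_two_eq_zero_or_one (T.slot (T.par u)) with c1 | c1
            · have := hp.twig_even hpt c0 c1
              omega
            · have := hp.twig_odd hpt c1
              omega
        omega
      have hyB : y ≤ B + 4 * T.n := by
        split_ifs at hy <;> omega
      obtain ⟨g1, g2⟩ := placeLeaf_spec h4 h5 h7 hx hy (hxB.trans hBM) (hyB.trans hBM)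
      have hq := show (if T.hv (T.par u) = u then (if T.Twig (T.par u) then placeLeaf else placeHeavy)
        else (if T.Twig u then placeTwig else placeBranch)) = placeLeaf by rw [if_pos hh, if_pos hpt]
      refine ⟨0, x, y, ?_, by omega, hxB, hyB, hsafe _ g1 hq, hden _ hq ▸ g2⟩
      exact ⟨fun h' => (hu0 h').elim, fun h' => (hns h').elim, fun _ h' => (hns h').elim,
        fun h' => (hb h').elim, fun h' => (ht h').elim, fun h' => (ht h').elim,
        fun h' => (ht h').elim, fun _ _ => ⟨hx, hy⟩⟩
    · obtain ⟨y, hy⟩ : ∃ y, y = s.arr 17 (T.par u) + T.d u - T.own u + T.twigs u / 2 := ⟨_, rfl⟩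
      have hyB : y ≤ B + 4 * T.n := by omega
      obtain ⟨g1, g2⟩ := placeSpine_spec (el := .cell 17 5) (ex := .cell 2 5) (M := M) h4
        (by simp [Expr.cell, Expr.eval, h5]) (by simp [Expr.cell, Expr.eval, h5]; rfl)
        (hy.trans (h.row_eq hu _).symm) (by omega) (by omega) (by omega)
      have hq := show (if T.hv (T.par u) = u then (if T.Twig (T.par u) then placeLeaf else placeHeavy)
        else (if T.Twig u then placeTwig else placeBranch)) = placeHeavy by
          rw [if_pos hh, if_neg hpt]
      refine ⟨_, _, y, ?_, by omega, ?_, hyB, hsafe _ g1 hq, hden _ hq ▸ g2⟩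
      · exact ⟨fun h' => (hu0 h').elim, fun _ => hy, fun _ _ _ => ⟨rfl, rfl⟩,
          fun h' => (hb h').elim, fun h' => (ht h').elim, fun h' => (ht h').elim,
          fun h' => (ht h').elim, fun _ h' => (hpt h').elim⟩
      · omega
  · have hpt : ¬ T.Twig (T.par u) := fun h' => hh (HeavyTree.Twig.leaf hu hu0 h').2.2
    by_cases ht : T.Twig u
    · have hns : ¬ T.Spine u := fun h' => h'.1 ht
      have hb : ¬ T.Branch u := fun h' => by
        have := h'.2.2
        have := ht.2.2
        omega
      have hsl := HeavyTree.IsLayout.slot_le hu ht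
      have hj : s.arr 10 u + (if s.arr 9 (T.par (T.par u)) = T.par u then 1 else 0) = T.slot u := by
        rw [h.rank u hu ht, h.arr9, HeavyTree.slot]
      obtain ⟨x, y, h0, hodd, heven, hxB, hyB⟩ : ∃ x y,
          (T.slot u = 0 → x = s.arr 2 (T.par u) ∧ y = s.arr 3 (T.par u) + 1) ∧
          (T.slot u % 2 = 1 → x = s.arr 2 (T.par u) - 1 ∧ y = s.arr 3 (T.par u) - T.slot u / 2) ∧
          (T.slot u ≠ 0 → T.slot u % 2 = 0 →
            x = s.arr 2 (T.par u) + 1 ∧ y = s.arr 3 (T.par u) + T.slot u / 2 - 1) ∧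
          x ≤ B + 4 * T.n ∧ y ≤ B + 4 * T.n := by
        by_cases c0 : T.slot u = 0
        · exact ⟨s.arr 2 (T.par u), s.arr 3 (T.par u) + 1, fun _ => ⟨rfl, rfl⟩, by omega, by omega,
            by omega, by omega⟩
        · by_cases c1 : T.slot u % 2 = 1
          · exact ⟨s.arr 2 (T.par u) - 1, s.arr 3 (T.par u) - T.slot u / 2, by omega,
              fun _ => ⟨rfl, rfl⟩, by omega, by omega, by omega⟩
          · exact ⟨s.arr 2 (T.par u) + 1, s.arr 3 (T.par u) + T.slot u / 2 - 1, by omega, by omega,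
              fun _ _ => ⟨rfl, rfl⟩, by omega, by omega⟩
      obtain ⟨g1, g2⟩ := placeTwig_spec (M := M) h4 h5 h7 hj (h.half _ (by omega)) h0 hodd heven
        (by omega) (by omega) (by omega)
      have hq := show (if T.hv (T.par u) = u then (if T.Twig (T.par u) then placeLeaf else placeHeavy)
        else (if T.Twig u then placeTwig else placeBranch)) = placeTwig by rw [if_neg hh, if_pos ht]
      refine ⟨0, x, y, ?_, by omega, hxB, hyB, hsafe _ g1 hq, hden _ hq ▸ g2⟩
      exact ⟨fun h' => (hu0 h').elim, fun h' => (hns h').elim, fun _ h' => (hns h').elim,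
        fun h' => (hb h').elim, fun _ => h0, fun _ => hodd, fun _ => heven,
        fun _ h' => (hpt h').elim⟩
    · have hb : T.Branch u := ⟨hu0, hh, by
        by_contra hd
        exact ht ⟨hu0, hh, by omega⟩⟩
      have hob := HeavyTree.off_add_le hu hb
      obtain ⟨l, hl⟩ : ∃ l, s.arr 17 (T.par u) + T.d (T.hv (T.par u)) + 1 + T.off u = l := ⟨_, rfl⟩
      obtain ⟨x, hx⟩ : ∃ x, s.arr 2 (T.par u) + T.d (T.hv (T.par u)) + T.off u + 2 = x := ⟨_, rfl⟩
      obtain ⟨y, hy⟩ : ∃ y, y = l + T.d u - T.own u + T.twigs u / 2 := ⟨_, rfl⟩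
      obtain ⟨g1, g2⟩ := placeSpine_spec (M := M)
        (el := .plus (.plus (.plus (.cell 17 5) (.get 8 (.cell 9 5))) (.lit 1)) (.cell 13 4))
        (ex := .plus (.plus (.plus (.cell 2 5) (.get 8 (.cell 9 5))) (.cell 13 4)) (.lit 2))
        (l := l) (x := x) h4
        (by simp [Expr.cell, Expr.plus, Expr.eval, BinOp.eval, h4, h5, h.arr8, h.arr9, h.off u hu hb,
          hl])
        (by simp [Expr.cell, Expr.plus, Expr.eval, BinOp.eval, h4, h5, h.arr8, h.arr9, h.off u hu hb,
          hx])
        (hy.trans (h.row_eq hu _).symm) (by omega) (by omega) (by omega)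
      have hq := show (if T.hv (T.par u) = u then (if T.Twig (T.par u) then placeLeaf else placeHeavy)
        else (if T.Twig u then placeTwig else placeBranch)) = placeBranch by
          rw [if_neg hh, if_neg ht]
      refine ⟨l, x, y, ?_, by omega, by omega, by omega, hsafe _ g1 hq, hden _ hq ▸ g2⟩
      exact ⟨fun h' => (hu0 h').elim, fun _ => hy, fun _ _ h' => (hh h').elim,
        fun _ => ⟨hl.symm, hx.symm⟩, fun h' => (ht h').elim, fun h' => (ht h').elim,
        fun h' => (ht h').elim, fun _ h' => (hpt h').elim⟩

end SegmentDrawing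

/-! ### Placement in reverse peeling order -/

namespace SegmentDrawing

/-- The equations at `u` read only values at the parent and the grandparent, so placing another
vertex later preserves them. -/
theorem HeavyTree.EqAt.congr {T : HeavyTree} {lo X Y lo' X' Y' : ℕ → ℕ} {u l x y : ℕ}
    (h : T.EqAt lo X Y u l x y) (hlo : lo' (T.par u) = lo (T.par u))
    (hX : X' (T.par u) = X (T.par u)) (hX2 : X' (T.par (T.par u)) = X (T.par (T.par u)))
    (hY : Y' (T.par u) = Y (T.par u)) : T.EqAt lo' X' Y' u l x y := by
  obtain ⟨h1, h2, h3, h4, h5, h6, h7, h8⟩ := h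
  rw [← hlo, ← hX] at h3 h4
  rw [← hX, ← hY] at h5 h6 h7 h8
  rw [← hX2] at h8
  exact ⟨h1, h2, h3, h4, h5, h6, h7, h8⟩

/-- The first `n - 1` values of `ord` are the vertices other than the root, children before
parents. -/
structure HeavyTree.IsOrder (T : HeavyTree) (ord : ℕ → ℕ) : Prop where
  surj : ∀ v < T.n, v ≠ 0 → ∃ j < T.n - 1, ord j = v
  mem : ∀ j < T.n - 1, ord j ≠ 0 ∧ ord j < T.n
  inj : ∀ j < T.n - 1, ∀ k < T.n - 1, ord j = ord k → j = k
  child : ∀ j < T.n - 1, ∀ c < T.n, c ≠ 0 → T.par c = ord j → ∃ k < j, ord k = c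

/-- The vertices that are placed after `i` steps. -/
def HeavyTree.Done (T : HeavyTree) (ord : ℕ → ℕ) (i u : ℕ) : Prop :=
  u = 0 ∨ ∃ k, T.n - 1 ≤ k + i ∧ k < T.n - 1 ∧ ord k = u

namespace HeavyTree.IsOrder

variable {T : HeavyTree} {ord : ℕ → ℕ}

/-- Children precede parents in the queue, so read backwards a parent is placed before its children.
-/
theorem done_par_of_eq (h : T.IsOrder ord) {i k : ℕ} (hk : k < T.n - 1) (hki : T.n - 1 ≤ k + 1 + i) :
    T.Done ord i (T.par (ord k)) := by
  obtain ⟨h1, h2⟩ := h.mem k hk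
  by_cases h0 : T.par (ord k) = 0
  · exact Or.inl h0
  · obtain ⟨j, hj, hjp⟩ := h.surj _ (T.par_lt _ h2) h0
    obtain ⟨l, hl, hlk⟩ := h.child j hj _ h2 h1 hjp.symm
    have := h.inj l (by omega) k hk hlk
    exact Or.inr ⟨j, by omega, hj, hjp⟩

theorem done_par (h : T.IsOrder ord) {i u : ℕ} (hu : T.Done ord i u) : T.Done ord i (T.par u) := by
  rcases hu with rfl | ⟨k, hk1, hk2, rfl⟩
  · exact Or.inl T.par_zero
  · exact h.done_par_of_eq hk2 (by omega)

theorem not_done (h : T.IsOrder ord) {i k : ℕ} (hk : k < T.n - 1) (hki : k + i < T.n - 1) :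
    ¬ T.Done ord i (ord k) := by
  rintro (h0 | ⟨j, hj1, hj2, hj3⟩)
  · exact (h.mem k hk).1 h0
  · have := h.inj j hj2 k hk hj3
    omega

theorem done_succ {i u : ℕ} (hi : i < T.n - 1) (hu : T.Done ord (i + 1) u) :
    T.Done ord i u ∨ u = ord (T.n - 2 - i) := by
  rcases hu with rfl | ⟨k, hk1, hk2, rfl⟩
  · exact Or.inl (Or.inl rfl)
  · by_cases hk : k = T.n - 2 - i
    · exact Or.inr (by rw [hk])
    · exact Or.inl (Or.inr ⟨k, by omega, hk2, rfl⟩)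

end HeavyTree.IsOrder

/-- The memory after the placement of the root and `i` further vertices. -/
structure PlaceInv (T : HeavyTree) (ord : ℕ → ℕ) (i : ℕ) (s : State) : Prop where
  tables : Tables T ord T.n s
  var2 : s.var 2 = i
  eqAt : ∀ u, T.Done ord i u →
    T.EqAt (s.arr 17) (s.arr 2) (s.arr 3) u (s.arr 17 u) (s.arr 2 u) (s.arr 3 u)
  bound : ∀ u, T.Done ord i u →
    s.arr 17 u ≤ 4 * T.n * (i + 1) ∧ s.arr 2 u ≤ 4 * T.n * (i + 1) ∧ s.arr 3 u ≤ 4 * T.n * (i + 1)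

theorem PlaceInv.step {M : ℕ} {T : HeavyTree} {ord : ℕ → ℕ} (ho : T.IsOrder ord)
    (hM : 9 * T.n * T.n ≤ M) {i : ℕ} {s : State} (h : PlaceInv T ord i s) (hi : i < T.n - 1) :
    placeBody.Safe M s ∧ PlaceInv T ord (i + 1) (placeBody.denote s) := by
  have hn := T.three_le
  obtain ⟨u, hu⟩ : ∃ u, ord (T.n - 2 - i) = u := ⟨_, rfl⟩
  obtain ⟨hu0, hun⟩ := ho.mem (T.n - 2 - i) (by omega)
  have hnd := ho.not_done (i := i) (k := T.n - 2 - i) (by omega) (by omega)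
  have hpd := ho.done_par_of_eq (i := i) (k := T.n - 2 - i) (by omega) (by omega)
  rw [hu] at hu0 hun hnd hpd
  have hpd2 := ho.done_par hpd
  have hne : ∀ v, T.Done ord i v → v ≠ u := fun v hv e => hnd (e ▸ hv)
  have hpn := T.par_lt u hun
  have hun' := HeavyTree.d_lt hun
  -- At most `n` placements, the root included, each adding at most `4 * n`, stay within `4 * n *
  -- n`.
  have hMi : 4 * T.n * (i + 1) + 4 * T.n ≤ M := by
    have : 4 * T.n * (i + 1) ≤ 4 * T.n * (T.n - 1) := Nat.mul_le_mul_left _ (by omega)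
    have h2 : 4 * T.n * (T.n - 1) + 4 * T.n = 4 * T.n * T.n := by
      obtain ⟨k, hk⟩ : ∃ k, T.n = k + 1 := ⟨T.n - 1, by omega⟩
      rw [hk]
      simp
      ring
    nlinarith
  have hnM : 9 * T.n ≤ M := by nlinarith
  obtain ⟨s₁, hs₁⟩ : ∃ s₁, s₁ = ((s.setVar 4 u).setVar 5 (T.par u)).setVar 7 (T.par (T.par u)) :=
    ⟨_, rfl⟩
  have ha : s₁.arr = s.arr := by rw [hs₁]; rfl
  have ht₁ : Tables T ord T.n s₁ := h.tables.congr (by simp [hs₁]) (fun a _ _ _ => by rw [ha])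
  obtain ⟨b17, b2, b3⟩ := h.bound _ hpd
  obtain ⟨l, x, y, g1, g2, g3, g4, g5, g6⟩ := placeVertex_spec (M := M) (B := 4 * T.n * (i + 1)) ht₁
    hun hu0 (by simp [hs₁]) (by simp [hs₁]) (by simp [hs₁]) (by rw [ha]; exact h.eqAt _ hpd)
    (by rwa [ha]) (by rwa [ha]) (by rwa [ha]) hMi
  rw [ha] at g1
  have hidx : T.n - 2 - i = T.n - 2 - s.var 2 := by rw [h.var2]
  have hden : placeBody.denote s = stepCounter.denote (placeVertex.denote s₁) := by
    simp [placeBody, Program.block, Program.denote, Expr.minus, Expr.cell, Expr.eval, BinOp.eval,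
      h.tables.var0, h.var2, h.tables.arr6, h.tables.arr7, hu, hs₁]
  have hsc : stepCounter.denote (placeVertex.denote s₁) = (placeVertex.denote s₁).setVar 2 (i + 1) := by
    have : (placeVertex.denote s₁).var 2 = i := by rw [g6.var2, hs₁]; simp [h.var2]
    simp [stepCounter, Program.denote, Expr.plus, Expr.eval, BinOp.eval, this]
  have hsafe : placeBody.Safe M s := by
    have : (placeVertex.denote s₁).var 2 = i := by rw [g6.var2, hs₁]; simp [h.var2]
    have h5 := T.par_lt _ hpn
    simp only [placeBody, Program.block, Program.Safe, Program.denote, Expr.minus, Expr.cell,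
      Expr.eval, BinOp.eval, h.tables.var0, h.var2, h.tables.arr6, h.tables.arr7, hu, State.setVar_var,
      State.setVar_arr, if_true, ← hs₁, stepCounter, Expr.plus, this]
    simp only [g5, and_true, true_and]
    simp
    omega
  refine ⟨hsafe, ?_⟩
  rw [hden, hsc]
  have e17 : ((placeVertex.denote s₁).setVar 2 (i + 1)).arr 17
      = Function.update (s.arr 17) u l := by rw [State.setVar_arr, g6.arr17, ha]
  have e2 : ((placeVertex.denote s₁).setVar 2 (i + 1)).arr 2
      = Function.update (s.arr 2) u x := by rw [State.setVar_arr, g6.arr2, ha]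
  have e3 : ((placeVertex.denote s₁).setVar 2 (i + 1)).arr 3
      = Function.update (s.arr 3) u y := by rw [State.setVar_arr, g6.arr3, ha]
  have hstep : 4 * T.n * (i + 1 + 1) = 4 * T.n * (i + 1) + 4 * T.n := by ring
  have old : ∀ (f : ℕ → ℕ) (z v : ℕ), T.Done ord i v → Function.update f u z v = f v :=
    fun f z v hv => Function.update_of_ne (hne v hv) _ _
  refine ⟨ht₁.congr (by simp [g6.var0]) (fun a h2 h3 h17 => g6.arr a h2 h3 h17), by simp, ?_, ?_⟩
  · intro v hv
    rw [e17, e2, e3]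
    rcases HeavyTree.IsOrder.done_succ hi hv with hv | rfl
    · have hvp := ho.done_par hv
      rw [old _ _ _ hv, old _ _ _ hv, old _ _ _ hv]
      exact (h.eqAt v hv).congr (old _ _ _ hvp) (old _ _ _ hvp) (old _ _ _ (ho.done_par hvp))
        (old _ _ _ hvp)
    · rw [hu, Function.update_self, Function.update_self, Function.update_self]
      exact g1.congr (old _ _ _ hpd) (old _ _ _ hpd) (old _ _ _ hpd2) (old _ _ _ hpd)
  · intro v hv
    rw [e17, e2, e3, hstep]
    rcases HeavyTree.IsOrder.done_succ hi hv with hv | rfl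
    · have := h.bound v hv
      rw [old _ _ _ hv, old _ _ _ hv, old _ _ _ hv]
      omega
    · rw [hu, Function.update_self, Function.update_self, Function.update_self]
      exact ⟨g2, g3, g4⟩

/-- Place the root. -/
def placeRoot : Program := .block
  [.assign 4 (.lit 0), placeSpine (.lit 0) (.lit 2), .assign 2 (.lit 0)]

theorem placeRoot_spec {M : ℕ} {T : HeavyTree} {ord : ℕ → ℕ} (hM : 9 * T.n ≤ M) {s : State}
    (h : Tables T ord T.n s) : placeRoot.Safe M s ∧ PlaceInv T ord 0 (placeRoot.denote s) := by
  have hn := T.three_le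
  have hd := HeavyTree.d_lt (T := T) (v := 0) (by omega)
  have ho := HeavyTree.own_le (T := T) (v := 0) (by omega)
  have ht := T.twigs_le_own 0
  obtain ⟨y, hy⟩ : ∃ y, y = 0 + T.d 0 - T.own 0 + T.twigs 0 / 2 := ⟨_, rfl⟩
  have h₁ : Tables T ord T.n (s.setVar 4 0) := h.congr (by simp) (fun a _ _ _ => rfl)
  obtain ⟨g1, g2⟩ := placeSpine_spec (M := M) (s := s.setVar 4 0) (u := 0) (l := 0) (x := 2) (y := y)
    (el := .lit 0) (ex := .lit 2) (by simp) rfl rfl (hy.trans (h₁.row_eq (by omega) 0).symm) (by omega)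
    (by omega) (by omega)
  have hden : placeRoot.denote s
      = ((placeSpine (.lit 0) (.lit 2)).denote (s.setVar 4 0)).setVar 2 0 := rfl
  have hb : T.Done ord 0 0 := Or.inl rfl
  have hz : ∀ u, T.Done ord 0 u → u = 0 := by
    rintro u (h0 | ⟨k, hk1, hk2, -⟩)
    · exact h0
    · omega
  refine ⟨⟨Nat.zero_le _, g1, Nat.zero_le _, trivial⟩, ?_⟩
  rw [hden]
  refine ⟨h₁.congr (by simp [g2.var0]) (fun a h2 h3 h17 => g2.arr a h2 h3 h17), by simp, ?_, ?_⟩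
  · intro u hu
    obtain rfl := hz u hu
    simp only [State.setVar_arr, g2.arr17, g2.arr2, g2.arr3, Function.update_self]
    have h0 : ¬ T.Twig 0 := fun h' => h'.1 rfl
    exact ⟨fun _ => ⟨rfl, rfl⟩, fun _ => hy, fun h' => (h' rfl).elim, fun h' => (h'.1 rfl).elim,
      fun h' => (h0 h').elim, fun h' => (h0 h').elim, fun h' => (h0 h').elim, fun h' => (h' rfl).elim⟩
  · intro u hu
    obtain rfl := hz u hu
    simp only [State.setVar_arr, g2.arr17, g2.arr2, g2.arr3, Function.update_self]
    omega

theorem place_loop {W M : ℕ} {T : HeavyTree} {ord : ℕ → ℕ} (ho : T.IsOrder ord)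
    (hM : 9 * T.n * T.n ≤ M)
    (hW : M ^ (Program.loop (.less (.plus (.var 2) (.lit 1)) (.var 0)) placeBody).rank < W)
    {s : State} (hs : Small M s) (h0 : PlaceInv T ord 0 s) :
    Runs W M (.loop (.less (.plus (.var 2) (.lit 1)) (.var 0)) placeBody) s
      ((T.n - 1 + 1) * ((Expr.less (.plus (.var 2) (.lit 1)) (.var 0)).cost + 1 + placeBody.cost))
      (fun s => T.IsLayout (s.arr 17) (s.arr 2) (s.arr 3)) := by
  have hn := T.three_le
  have hM2 : 2 ≤ M := by nlinarith
  have key : Runs W M (.loop (.less (.plus (.var 2) (.lit 1)) (.var 0)) placeBody) s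
      ((T.n - 1 + 1) * ((Expr.less (.plus (.var 2) (.lit 1)) (.var 0)).cost + 1 + placeBody.cost))
      (PlaceInv T ord (T.n - 1)) := by
    refine runs_loop hM2 (PlaceInv T ord) hW ?_ ?_ hs h0
    · intro i hi s hs h
      refine ⟨?_, h.step ho hM hi⟩
      simp [Expr.less, Expr.plus, Expr.eval, BinOp.eval, h.tables.var0, h.var2]
      omega
    · intro s hs h
      simp [Expr.less, Expr.plus, Expr.eval, BinOp.eval, h.tables.var0, h.var2]
      omega
  obtain ⟨t, s', h1, h3, h4, h5⟩ := key
  refine ⟨t, s', h1, h3, h4, fun u hu => h5.eqAt u ?_⟩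
  by_cases hu0 : u = 0
  · exact Or.inl hu0
  · obtain ⟨j, hj, hju⟩ := ho.surj u hu hu0
    exact Or.inr ⟨j, by omega, hj, hju⟩

end SegmentDrawing

namespace SegmentDrawing

/-! ### The whole program -/

/-- Draw the tree whose edge list is in the memory. -/
def drawTree : Program :=
  .seq (.loop (.less (.var 2) (.var 1)) degreeBody) <|
  .seq (.assign 2 (.lit 1)) <|
  .seq (.loop (.less (.var 2) (.var 0)) leafBody) <|
  .seq (.assign 2 (.lit 0)) <|
  .seq (.loop (.less (.var 2) (.var 3)) peelBody) <|
  .seq (.assign 2 (.lit 1)) <|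
  .seq (.loop (.less (.var 2) (.var 0)) classBody) <|
  .seq placeRoot (.loop (.less (.plus (.var 2) (.lit 1)) (.var 0)) placeBody)

/-- The time of `drawTree` per vertex. -/
def drawTreeFactor : ℕ :=
  ((Expr.less (.var 2) (.var 1)).cost + 1 + degreeBody.cost) +
  ((Expr.less (.var 2) (.var 0)).cost + 1 + leafBody.cost) +
  ((Expr.less (.var 2) (.var 3)).cost + 1 + peelBody.cost) +
  ((Expr.less (.var 2) (.var 0)).cost + 1 + classBody.cost) +
  ((Expr.less (.plus (.var 2) (.lit 1)) (.var 0)).cost + 1 + placeBody.cost) +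
  (6 + placeRoot.cost)

theorem Runs.mono {W M T T' : ℕ} {p : Program} {s : State} {Q : State → Prop}
    (h : Runs W M p s T Q) (hT : T ≤ T') : Runs W M p s T' Q := by
  obtain ⟨t, s', h1, h2, h3⟩ := h
  exact ⟨t, s', h1, h2.trans hT, h3⟩

theorem runs_assign_lit {W M : ℕ} (hM : 2 ≤ M) {x c : ℕ} (hc : c ≤ M) (hW : M ^ (c + 1) < W)
    {s : State} (hs : Small M s) :
    Runs W M (.assign x (.lit c)) s 2 (fun s' => s' = s.setVar x c) :=
  runs_of_safe hM (.assign x (.lit c)) s hs hc hW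

theorem inputState_small {n m M : ℕ} (hm : m ≤ n) (hM : n ≤ M) (E : Fin m → Fin n × Fin n) :
    Small M (inputState E) := by
  constructor
  · intro x
    simp only [inputState]
    split_ifs <;> omega
  · intro a i
    simp only [inputState]
    split_ifs with h
    · exact (E ⟨i, h⟩).1.2.le.trans hM
    · exact (E ⟨i, h⟩).2.2.le.trans hM
    all_goals exact Nat.zero_le _

/-- A parent edge is seen from `v` either as its own or as that of a child. This puts degrees and
neighbour sums into the form that `PeelInv` requires. -/
theorem sum_edge_split {n v : ℕ} (hv : v < n) (par f g : ℕ → ℕ) :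
    (∑ u ∈ Finset.range n, if u ≠ 0 then
        (if u = v then f u else 0) + (if par u = v then g u else 0) else 0)
      = (∑ u ∈ Finset.range n, if (u ≠ 0 ∧ par u = v) ∧ u ∉ (∅ : Finset ℕ) then g u else 0)
        + if v ≠ 0 then f v else 0 := by
  have h : (∑ u ∈ Finset.range n, if u = v then (if v ≠ 0 then f v else 0) else 0)
      = if v ≠ 0 then f v else 0 := by
    simp [hv]
  rw [← h, ← Finset.sum_add_distrib]
  refine Finset.sum_congr rfl fun u _ => ?_
  by_cases h0 : u = 0
  · subst h0
    by_cases h1 : 0 = v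
    · simp [← h1]
    · simp [h1]
  · by_cases h1 : u = v
    · subst h1
      simp [h0, add_comm]
    · simp [h0, h1]

theorem inputState_degreeInv {n m : ℕ} (E : Fin m → Fin n × Fin n) :
    DegreeInv n m ((inputState E).arr 0) ((inputState E).arr 1) 0 (inputState E) := by
  constructor
  all_goals first | rfl | skip
  · intro v
    simp [inputState]
  · intro v
    simp [inputState]
  · intro k v hk
    simp only [inputState]
    split_ifs <;> omega

theorem sum_inputState {n m : ℕ} (E : Fin m → Fin n × Fin n) (F : ℕ → ℕ → ℕ) :
    ∑ j ∈ Finset.range m, F ((inputState E).arr 0 j) ((inputState E).arr 1 j)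
      = ∑ j : Fin m, F (E j).1 (E j).2 := by
  rw [Finset.sum_range]
  refine Finset.sum_congr rfl fun j _ => ?_
  simp [inputState]

theorem PeelInv.of_leafInv {n : ℕ} (hn : 0 < n) {par deg sum : ℕ → ℕ}
    (hdeg : ∀ v < n, deg v = (∑ c ∈ Finset.range n,
      if (c ≠ 0 ∧ par c = v) ∧ c ∉ (∅ : Finset ℕ) then 1 else 0) + if v ≠ 0 then 1 else 0)
    (hsum : ∀ v < n, sum v = (∑ c ∈ Finset.range n,
      if (c ≠ 0 ∧ par c = v) ∧ c ∉ (∅ : Finset ℕ) then c else 0) + if v ≠ 0 then par v else 0)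
    {s : State} (h : LeafInv n deg sum (n - 1) s) : PeelInv n par ∅ 0 (s.setVar 2 0) := by
  have hleaf : ∀ v < n, v ≠ 0 → (deg v = 1 ↔ ∀ c < n, c ≠ 0 → par c ≠ v) := by
    intro v hv h0
    rw [hdeg v hv, if_pos h0]
    simp only [Nat.add_eq_right, Finset.sum_eq_zero_iff, Finset.mem_range]
    refine forall₂_congr fun c hc => ?_
    simp
  have hq : ∀ v, (∃ j < s.var 3, s.arr 6 j = v) ↔
      v ≠ 0 ∧ v < n ∧ ∀ c < n, c ≠ 0 → par c = v → c ∈ (∅ : Finset ℕ) := by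
    intro v
    rw [h.mem v, Nat.sub_add_cancel hn]
    refine and_congr_right fun h0 => and_congr_right fun hv => ?_
    rw [hleaf v hv h0]
    simp
  refine ⟨by simp [h.var0], by simp, Nat.zero_le _, ?_, ?_, by simp, rfl, by simpa using hq, ?_, ?_, ?_,
    by simp, h.zero 7 0 (by omega), ?_, ?_, ?_, fun k v hk => h.zero k v (by omega)⟩
  · intro j hj
    have := (hq _).1 ⟨j, by simpa using hj, rfl⟩
    exact ⟨this.1, this.2.1⟩
  · simpa using h.inj
  · intro j hj c hc h0 hcj
    have := ((hq _).1 ⟨j, by simpa using hj, rfl⟩).2.2 c hc h0 hcj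
    simp at this
  · intro v hv
    rw [State.setVar_arr, h.arr4, hdeg v hv]
  · intro v hv
    rw [State.setVar_arr, h.arr5, hsum v hv]
  · intro v hv
    simp [h.zero 8 _ (by omega)]
  · simp [h.zero 8 _ (by omega)]
  · intro v hv
    exact Or.inl ⟨h.zero 9 v (by omega), by simp⟩

/-- The root is neither twig nor branch, and `0 / 2 = 1 / 2 = 0`, so zeroed arrays are correct
tables for the vertices below `1`. -/
theorem tables_one {T : HeavyTree} {s : State} {k n : ℕ} {par : ℕ → ℕ} {D : Finset ℕ}
    (h : PeelInv n par D k s) (hn : T.n = n) (h7 : T.par = s.arr 7) (h8 : T.d = s.arr 8)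
    (h9 : T.hv = s.arr 9) : Tables T (s.arr 6) 1 (s.setVar 2 1) := by
  have ht : ¬ T.Twig 0 := fun h' => h'.1 rfl
  have hb : ¬ T.Branch 0 := fun h' => h'.1 rfl
  refine ⟨by simp [h.var0, hn], rfl, h7.symm, h8.symm, h9.symm, ?_, ?_, ?_, ?_, ?_, ?_, ?_⟩
  · intro c hc hct
    obtain rfl : c = 0 := by omega
    exact (ht hct).elim
  · intro v
    simp [-Finset.sum_boole, ht, h.zero 11 v]
  · intro v
    simp [ht, h.zero 12 v]
  · intro c hc hct
    obtain rfl : c = 0 := by omega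
    exact (hb hct).elim
  · intro v
    simp [hb, h.zero 14 v]
  · intro j hj
    rw [State.setVar_arr, h.zero 15 j (by omega)]
    omega
  · intro c
    rw [State.setVar_arr, h.zero 16 c (by omega), if_neg]
    rintro ⟨hc, hct⟩
    obtain rfl : c = 0 := by omega
    exact ht hct

theorem drawTree_runs {n : ℕ} (hn : 3 ≤ n) {G : SimpleGraph (Fin n)} (hG : G.IsTree) {m : ℕ}
    {E : Fin m → Fin n × Fin n} (hE : IsEdgeList G E) {W : ℕ} (hW : (n ^ 4) ^ drawTree.rank < W) :
    Runs W (n ^ 4) drawTree (inputState E) (drawTreeFactor * n)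
      (fun s => ∃ T : HeavyTree, T.n = n ∧
        (∀ u v : Fin n, G.Adj u v ↔ ((u : ℕ) ≠ 0 ∧ T.par u = v) ∨ ((v : ℕ) ≠ 0 ∧ T.par v = u)) ∧
        T.IsLayout (s.arr 17) (s.arr 2) (s.arr 3)) := by
  obtain ⟨par, dep, hpar0, hpar, hdep, hadj, hedges⟩ := exists_parent (by omega) G hG
  obtain ⟨hm, hF⟩ := hedges m E hE
  obtain ⟨M, hMdef⟩ : ∃ M, n ^ 4 = M := ⟨_, rfl⟩
  -- The hypothesis `3 ≤ n` turns the constant `9` into a further factor `n * n`; hence the bound `n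
  -- ^ 4`.
  have hM : 9 * n * n ≤ M := by
    have h1 : 9 ≤ n * n := Nat.mul_le_mul hn hn
    calc 9 * n * n = 9 * (n * n) := by ring
      _ ≤ n * n * (n * n) := Nat.mul_le_mul_right _ h1
      _ = M := by rw [← hMdef]; ring
  have hM9 : 9 * n ≤ M := by nlinarith
  rw [hMdef] at hW ⊢
  have hWle : ∀ r, r ≤ drawTree.rank → M ^ r < W := fun r hr =>
    (Nat.pow_le_pow_right (by omega) hr).trans_lt hW
  have hrank : drawTree.rank = (Program.loop (.less (.var 2) (.var 1)) degreeBody).rank + (2 +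
      ((Program.loop (.less (.var 2) (.var 0)) leafBody).rank + (1 +
      ((Program.loop (.less (.var 2) (.var 3)) peelBody).rank + (2 +
      ((Program.loop (.less (.var 2) (.var 0)) classBody).rank + (placeRoot.rank +
      (Program.loop (.less (.plus (.var 2) (.lit 1)) (.var 0)) placeBody).rank))))))) := rfl
  refine Runs.mono (T := (m + 1) * ((Expr.less (.var 2) (.var 1)).cost + 1 + degreeBody.cost) + (2 +
      ((n - 1 + 1) * ((Expr.less (.var 2) (.var 0)).cost + 1 + leafBody.cost) + (2 +
      ((n - 1 + 1) * ((Expr.less (.var 2) (.var 3)).cost + 1 + peelBody.cost) + (2 +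
      ((n - 1 + 1) * ((Expr.less (.var 2) (.var 0)).cost + 1 + classBody.cost) + (placeRoot.cost +
      (n - 1 + 1) * ((Expr.less (.plus (.var 2) (.lit 1)) (.var 0)).cost + 1
        + placeBody.cost))))))))) ?_ ?_
  · refine (degree_loop hn (by omega) hM (hWle _ (by omega)) ?_ ?_
      (inputState_small (by omega) (by omega) E) (inputState_degreeInv E)).seq fun s hs hA => ?_
    · intro j hj
      simp [inputState, hj]
    · intro j hj
      simp [inputState, hj]
    have hdeg : ∀ v < n, s.arr 4 v = (∑ c ∈ Finset.range n,
        if (c ≠ 0 ∧ par c = v) ∧ c ∉ (∅ : Finset ℕ) then 1 else 0) + if v ≠ 0 then 1 else 0 := by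
      intro v hv
      rw [hA.deg v, sum_inputState E fun x y => (if x = v then 1 else 0) + if y = v then 1 else 0,
        hF (fun x y => (if x = v then 1 else 0) + if y = v then 1 else 0)
          (fun _ _ => add_comm _ _)]
      exact sum_edge_split hv par (fun _ => 1) (fun _ => 1)
    have hsum : ∀ v < n, s.arr 5 v = (∑ c ∈ Finset.range n,
        if (c ≠ 0 ∧ par c = v) ∧ c ∉ (∅ : Finset ℕ) then c else 0) + if v ≠ 0 then par v else 0 := by
      intro v hv
      rw [hA.sum v, sum_inputState E fun x y => (if x = v then y else 0) + if y = v then x else 0,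
        hF (fun x y => (if x = v then y else 0) + if y = v then x else 0)
          (fun _ _ => add_comm _ _)]
      exact sum_edge_split hv par par (fun u => u)
    refine (runs_assign_lit (by omega) (by omega) (hWle _ (by omega)) hs).seq fun s₁ hs₁ h₁ => ?_
    have hB0 : LeafInv n (s.arr 4) (s.arr 5) 0 s₁ := by
      subst h₁
      refine ⟨by simp [hA.var0], by simp, by simp [hA.var3], rfl, rfl, ?_, ?_,
        fun k v hk => hA.zero k v (by omega)⟩
      · intro v
        simp only [State.setVar_var, hA.var3]
        constructor
        · rintro ⟨j, hj, -⟩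
          simp at hj
        · rintro ⟨h0, hv, -⟩
          omega
      · intro j hj
        simp [hA.var3] at hj
    refine (leaf_loop hn hM (hWle _ (by omega)) hs₁ hB0).seq fun s₂ hs₂ hB => ?_
    refine (runs_assign_lit (by omega) (by omega) (hWle _ (by omega)) hs₂).seq fun s₃ hs₃ h₃ => ?_
    have hC0 : PeelInv n par ∅ 0 s₃ := h₃ ▸ PeelInv.of_leafInv (by omega) hdeg hsum hB
    refine (peel_loop hn hM (hWle _ (by omega)) hpar hdep hs₃ hC0).seq fun s₄ hs₄ ⟨D, hC⟩ => ?_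
    obtain ⟨T, hTn, h7, h8, h9, hTpar, o1, o2, o3, o4⟩ := hC.exists_tree hn hpar0 hpar hdep
    refine (runs_assign_lit (by omega) (by omega) (hWle _ (by omega)) hs₄).seq fun s₅ hs₅ h₅ => ?_
    have hD0 : Tables T (s₄.arr 6) 1 s₅ := h₅ ▸ tables_one hC hTn h7 h8 h9
    subst hTn
    refine (class_loop hM (hWle _ (by omega)) hs₅ hD0 (by simp [h₅])
      (fun v => by rw [h₅]; exact hC.zero 17 v (by omega))).seq fun s₆ hs₆ hD => ?_
    obtain ⟨g1, g2⟩ := placeRoot_spec hM9 hD.1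
    refine (runs_of_safe (by omega) placeRoot s₆ hs₆ g1 (hWle _ (by omega))).seq
      fun s₇ hs₇ h₇ => ?_
    obtain ⟨t, s', r1, r2, r3, r4⟩ := place_loop ⟨o1, o2, o3, o4⟩ hM (hWle _ (by omega)) hs₇ (h₇ ▸ g2)
    refine ⟨t, s', r1, r2, r3, T, rfl, fun u v => ?_, r4⟩
    rw [hadj u v, hTpar u u.2, hTpar v v.2]
  · have hc : ∀ q, q ≤ q * n := fun q => Nat.le_mul_of_pos_right q (by omega)
    have := hc (6 + placeRoot.cost)
    rw [hm, Nat.sub_add_cancel (by omega)]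
    rw [drawTreeFactor]
    simp only [Nat.add_mul, mul_comm n] at this ⊢
    omega

end SegmentDrawing

theorem theorem1 :
    ∃ (P : SegmentDrawing.Program) (c k : ℕ),
      ∀ n : ℕ, 3 ≤ n → ∀ G : SimpleGraph (Fin n), G.IsTree →
        ∀ (m : ℕ) (E : Fin m → Fin n × Fin n), SegmentDrawing.IsEdgeList G E →
          ∃ (t : ℕ) (s : SegmentDrawing.State),
            SegmentDrawing.Exec (n ^ k) P (SegmentDrawing.inputState E) t s ∧
            t ≤ c * n ∧
            (∀ v : Fin n, s.arr 2 v < n ∧ s.arr 3 v < n) ∧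
            SegmentDrawing.IsPlanarStraightLineDrawing G (SegmentDrawing.outputDrawing n s) ∧
            (SegmentDrawing.segmentCount G (SegmentDrawing.outputDrawing n s) : ℝ)
              ≤ 3 * (n : ℝ) / 4 - 1 := by
  -- With stored words at most `n ^ 4`, all values are at most `n ^ (4 * rank)`; the `+ 1` makes the
  -- inequality strict.
  refine ⟨SegmentDrawing.drawTree, SegmentDrawing.drawTreeFactor,
    4 * SegmentDrawing.drawTree.rank + 1, fun n hn G hG m E hE => ?_⟩
  obtain ⟨t, s, h1, h2, -, T, hTn, hadj, hL⟩ := SegmentDrawing.drawTree_runs hn hG hE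
    (W := n ^ (4 * SegmentDrawing.drawTree.rank + 1)) (by
      rw [← pow_mul]
      exact Nat.pow_lt_pow_right (by omega) (by omega))
  refine ⟨t, s, h1, h2, fun v => ?_, hL.planar hTn hadj, ?_⟩
  · have := hL.coord_lt (u := v) (hTn ▸ v.2)
    rwa [hTn] at this
  · have h3 : ((4 * SegmentDrawing.segmentCount G (SegmentDrawing.outputDrawing n s) + 4 : ℕ) : ℝ)
        ≤ ((3 * n : ℕ) : ℝ) := Nat.cast_le.2 (hL.segmentCount_le hTn hadj)
    push_cast at h3
    linarith
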